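/- **Setting.** A game graph with live edges consists of a finite nonempty set $V$ of $n$ vertices, a partition $V=V_0\uplus V_1$ into vertices of Player 0 and of Player 1, a set $E\subseteq V\times V$ of edges such that every vertex has at least one outgoing edge, and a set $E^\ell\subseteq E\cap(V_1\times V)$ of live edges. Strategies may depend on the whole history. A play $\pi=v^0v^1\ldots$ is *fair* if for every live edge $(v,v')$: if $v$ occurs infinitely often on $\pi$, then $v$ is followed by $v'$ infinitely often. A Rabin condition $\mathcal R=\{\langle G_1,R_1\rangle,\dots,\langle G_k,R_k\rangle\}$ ($k\ge 0$) is satisfied by the plays in $\varphi=\bigvee_{j=1}^k(\Diamond\Box\overline R_j\wedge\Box\Diamond G_j)$. In the *fair adversarial Rabin game* Player 0 wins a play if it is unfair or in $\varphi$; $\mathcal W$ is the set of vertices from which Player 0 has a winning strategy. For $S,T\subseteq V$ let $\mathrm{Cpre}(S)$ be the set of all $v\in V_0$ with some successor in $S$ and all $v\in V_1$ with all successors in $S$, and let $$\mathrm{Apre}(S,T)=\mathrm{Cpre}(T)\cup\{v\in V_1 : \text{some live edge of } v \text{ leads into } T \text{ and all successors of } v \text{ are in } S\}.$$ Let $P=\{1,\dots,k\}$,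 $p_0=0$, $G_0=R_0=\emptyset$, and $$Z^*=\nu Y_{p_0}.\mu X_{p_0}.\bigcup_{p_1\in P}\nu Y_{p_1}.\mu X_{p_1}.\bigcup_{p_2\in P\setminus\{p_1\}}\nu Y_{p_2}.\mu X_{p_2}.\cdots\bigcup_{p_k\in P\setminus\{p_1,\dots,p_{k-1}\}}\nu Y_{p_k}.\mu X_{p_k}.\ \bigcup_{j=0}^k\mathcal C_{p_j},$$ $$\mathcal C_{p_j}=\Big(\bigcap_{i=0}^j\overline R_{p_i}\Big)\cap\Big[\big(G_{p_j}\cap\mathrm{Cpre}(Y_{p_j})\big)\cup\mathrm{Apre}(Y_{p_j},X_{p_j})\Big].$$ **Ranking.** A configuration prefix is a sequence $\delta=p_0i_0p_1i_1\cdots p_ji_j$ with $p_0=0$, distinct $p_1,\dots,p_j\in P$ and counters $i_b\in\{1,\dots,n\}$. For a configuration prefix or the empty sequence $\delta$ and a next index $p$, let $Y^*_{\delta p}$ be the value of $\nu Y_p.\mu X_p.\cdots$ when, for each index $p_b$ in $\delta=\cdots p_bi_b\cdots$, $Y_{p_b}$ has the value $Y^*_{p_0i_0\cdots p_b}$ and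 $X_{p_b}$ the value $X^{i_b-1}_{p_0i_0\cdots p_b}$; here $X^{i}_{\delta p}$ is the $i$-th iterate, from $\emptyset$, of the fixpoint over $X_p$ for $Y_p=Y^*_{\delta p}$. Let $S_\delta$ be the union of the sets $\mathcal C_{p_0},\dots,\mathcal C_{p_j}$ for these values. The rank of $v$ is the lexicographically least sequence $\delta\,p_{j+1}0\cdots p_k0$, where $\delta=p_0i_0\cdots p_ji_j$ is a configuration prefix with $v\in S_\delta$ and $p_{j+1}<\dots<p_k$ are the remaining indices; it is $\infty$ if there is none. **Algorithm.** $Z^*$ is evaluated by nested iteration ($n$ iterations for each $\mu$-variable from $\emptyset$; each $\nu$-variable until it is stable) with two accelerations: the iteration for $Y_{\delta p}$ restarts from the last value stored for the same $\delta p$ (initially $V$), and the fixpoints below a prefix $\delta$ are evaluated again only if the current value of $S_\delta$ has changed since their last evaluation. A symbolic step is an application of $\cup$, $\cap$, $\mathrm{Cpre}$ or $\mathrm{Apre}$, or an equality test of two sets. **Theorem.** For every game graph with live edges and every Rabin condition $\mathcal R$ with $k$ pairs: 1. $Z^*=\mathcal W$. 2. The algorithm computes $Z^*$ and, in its final memory,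 the sets $S_{\delta pi}$ and $X^i_{\delta p}$ for all configuration prefixes $\delta pi$. It runs in $O(n^{k+2}\,k!)$ symbolic steps, with an absolute constant. 3. A memoryless winning strategy for Player 0 can be extracted: memoryless strategies that move from every vertex of $V_0\cap Z^*$ to a successor of minimal rank exist, and each of them wins the fair adversarial Rabin game from every vertex of $\mathcal W$. -/

import Mathlib

open Filter

universe u

namespace FairRabin

/-! ### Game graphs with live edges, plays, strategies, winning regions -/

/-- A two-player game graph with live edges. The vertices of Player 0 are `V₀`, those of Player 1
are the complement of `V₀`; live edges are edges that leave vertices of Player 1. -/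
structure GameGraph (V : Type u) where
  V₀ : Set V
  E : V → V → Prop
  live : V → V → Prop
  live_edge : ∀ v w, live v w → E v w
  live_owner : ∀ v w, live v w → v ∉ V₀

variable {V : Type u} {k : ℕ}

/-- The vertices of Player 1. -/
def GameGraph.V₁ (𝒢 : GameGraph V) : Set V := 𝒢.V₀ᶜ

/-- A strategy of the player who owns the vertices in `U`: `move w v` is the successor chosen
after the history `w · v`. -/
structure Strategy (𝒢 : GameGraph V) (U : Set V) where
  move : List V → U → V
  legal : ∀ (w : List V) (v : U), 𝒢.E v (move w v)

/-- The chosen successor depends on the current vertex only. -/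
def Strategy.Memoryless {𝒢 : GameGraph V} {U : Set V} (ρ : Strategy 𝒢 U) : Prop :=
  ∀ (w₁ w₂ : List V) (v : U), ρ.move w₁ v = ρ.move w₂ v

/-- The play `π` obeys the strategy `ρ` at every visit to a vertex in `U`. -/
def Strategy.Obeys {𝒢 : GameGraph V} {U : Set V} (ρ : Strategy 𝒢 U) (π : ℕ → V) : Prop :=
  ∀ (t : ℕ) (h : π t ∈ U), π (t + 1) = ρ.move ((List.range t).map π) ⟨π t, h⟩

/-- The strategy `ρ₀` of Player 0 wins from `v` for the winning condition `φ`: against every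
strategy of Player 1, the play from `v` compliant with both strategies is in `φ`. -/
def GameGraph.WinsFrom (𝒢 : GameGraph V) (ρ₀ : Strategy 𝒢 𝒢.V₀) (φ : Set (ℕ → V)) (v : V) :
    Prop :=
  ∀ (ρ₁ : Strategy 𝒢 𝒢.V₁) (π : ℕ → V), π 0 = v → ρ₀.Obeys π → ρ₁.Obeys π → π ∈ φ

/-- The winning region of Player 0 for the winning condition `φ`. -/
def GameGraph.winningRegion (𝒢 : GameGraph V) (φ : Set (ℕ → V)) : Set V :=
  {v | ∃ ρ₀ : Strategy 𝒢 𝒢.V₀, 𝒢.WinsFrom ρ₀ φ v}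

/-- Strong transition fairness: every live edge whose source is visited infinitely often is taken
infinitely often. -/
def GameGraph.fairPlays (𝒢 : GameGraph V) : Set (ℕ → V) :=
  {π | ∀ v w, 𝒢.live v w → (∃ᶠ t in atTop, π t = v) →
    ∃ᶠ t in atTop, π t = v ∧ π (t + 1) = w}

/-- The winning condition of the fair adversarial game for `φ`: fairness implies `φ`. -/
def GameGraph.fairAdversarial (𝒢 : GameGraph V) (φ : Set (ℕ → V)) : Set (ℕ → V) :=
  {π | π ∈ 𝒢.fairPlays → π ∈ φ}

/-- A Rabin condition with `k` pairs `(G j, R j)`. -/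
structure RabinCondition (V : Type u) (k : ℕ) where
  G : Fin k → Set V
  R : Fin k → Set V

/-- For some pair `j`, the play is eventually outside `R j` for good and visits `G j` infinitely
often. -/
def RabinCondition.plays (ℛ : RabinCondition V k) : Set (ℕ → V) :=
  {π | ∃ j, (∀ᶠ t in atTop, π t ∉ ℛ.R j) ∧ ∃ᶠ t in atTop, π t ∈ ℛ.G j}

/-- The goal sets indexed by `0, 1, …, k`, where `0` is the artificial pair `(∅, ∅)`. -/
def RabinCondition.goal (ℛ : RabinCondition V k) : Fin (k + 1) → Set V :=
  Fin.cons (α := fun _ => Set V) ∅ ℛ.G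

/-- The sets to be avoided, indexed by `0, 1, …, k`, where `0` is the artificial pair `(∅, ∅)`. -/
def RabinCondition.avoid (ℛ : RabinCondition V k) : Fin (k + 1) → Set V :=
  Fin.cons (α := fun _ => Set V) ∅ ℛ.R

/-! ### Set transformers -/

/-- Vertices of Player 0 with some successor in `S`. -/
def GameGraph.preExists₀ (𝒢 : GameGraph V) (S : Set V) : Set V :=
  {v | v ∈ 𝒢.V₀ ∧ ∃ w, 𝒢.E v w ∧ w ∈ S}

/-- Vertices of Player 1 with all successors in `S`. -/
def GameGraph.preForall₁ (𝒢 : GameGraph V) (S : Set V) : Set V :=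
  {v | v ∈ 𝒢.V₁ ∧ ∀ w, 𝒢.E v w → w ∈ S}

/-- The controllable predecessor operator. -/
def GameGraph.cpre (𝒢 : GameGraph V) (S : Set V) : Set V :=
  𝒢.preExists₀ S ∪ 𝒢.preForall₁ S

/-- Vertices with some live edge into `S`. -/
def GameGraph.lpre (𝒢 : GameGraph V) (S : Set V) : Set V :=
  {v | ∃ w, 𝒢.live v w ∧ w ∈ S}

/-- The almost sure predecessor operator. -/
def GameGraph.apre (𝒢 : GameGraph V) (S T : Set V) : Set V :=
  𝒢.cpre T ∪ (𝒢.lpre T ∩ 𝒢.preForall₁ S)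

/-! ### The nested fixpoint -/

/-- `μX. F X`. -/
def mu (F : Set V → Set V) : Set V := sInf {X | F X ⊆ X}

/-- `νY. F Y`. -/
def nu (F : Set V → Set V) : Set V := sSup {Y | Y ⊆ F Y}

theorem mu_isLeast {F : Set V → Set V} (hF : Monotone F) : IsLeast {X | F X = X} (mu F) :=
  OrderHom.isLeast_lfp ⟨F, hF⟩

theorem nu_isGreatest {F : Set V → Set V} (hF : Monotone F) :
    IsGreatest {Y | F Y = Y} (nu F) :=
  OrderHom.isGreatest_gfp ⟨F, hF⟩

/-- A list of bound indices together with the values of their two fixpoint variables: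
`[(p₀, Y_{p₀}, X_{p₀}), …, (p_j, Y_{p_j}, X_{p_j})]`. -/
abbrev Context (V : Type u) (k : ℕ) := List (Fin (k + 1) × Set V × Set V)

/-- The union of the sets `𝒞_{p_j}` over all entries of the context, where `𝒞_{p_j}` is
`(⋂_{i ≤ j} R_{p_i}ᶜ) ∩ [(G_{p_j} ∩ Cpre Y_{p_j}) ∪ Apre (Y_{p_j}, X_{p_j})]`. -/
def body (𝒢 : GameGraph V) (ℛ : RabinCondition V k) (c : Context V k) : Set V :=
  ⋃ j : Fin c.length, (⋂ i : Fin c.length, ⋂ _ : i ≤ j, (ℛ.avoid (c.get i).1)ᶜ) ∩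
    ((ℛ.goal (c.get j).1 ∩ 𝒢.cpre (c.get j).2.1) ∪ 𝒢.apre (c.get j).2.1 (c.get j).2.2)

/-- The `d` innermost layers `⋃ p, νY_p. μX_p. …` of the formula, where `p` ranges over the indices
that are not bound yet, around the body. -/
def nest (𝒢 : GameGraph V) (ℛ : RabinCondition V k) : ℕ → Context V k → Set V
  | 0, c => body 𝒢 ℛ c
  | d + 1, c => ⋃ p : Fin (k + 1), ⋃ _ : p ∉ c.map Prod.fst,
      nu fun Y => mu fun X => nest 𝒢 ℛ d (c ++ [(p, Y, X)])

/-- `Z* = νY₀. μX₀. ⋃_{p₁} νY_{p₁}. μX_{p₁}. ⋯ ⋃_{p_k} νY_{p_k}. μX_{p_k}. ⋃_{j ≤ k} 𝒞_{p_j}`. -/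
def rabinFixpoint (𝒢 : GameGraph V) (ℛ : RabinCondition V k) : Set V :=
  nu fun Y₀ => mu fun X₀ => nest 𝒢 ℛ k [(0, Y₀, X₀)]

/-! ### Configurations, iterates and ranks -/

/-- A list `p₀ i₀ p₁ i₁ ⋯ p_j i_j` of indices and iteration counters. -/
abbrev Prefix (k : ℕ) := List (Fin (k + 1) × ℕ)

/-- Configuration prefixes: `p₀ = 0`, no index is repeated, all counters are in `[1; n]`. -/
def Prefix.Valid (n : ℕ) (δ : Prefix k) : Prop :=
  δ.head?.map Prod.fst = some 0 ∧ (δ.map Prod.fst).Nodup ∧ ∀ q ∈ δ, 1 ≤ q.2 ∧ q.2 ≤ n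

/-- `Y*_{δ p}`, where `c` holds the values of the variables bound by `δ`. -/
def limitY (𝒢 : GameGraph V) (ℛ : RabinCondition V k) (c : Context V k) (p : Fin (k + 1)) :
    Set V :=
  nu fun Y => mu fun X => nest 𝒢 ℛ (k - c.length) (c ++ [(p, Y, X)])

/-- `X^i_{δ p}`: the `i`-th iterate, from `∅`, of the fixpoint over `X_p` when `Y_p` has reached its
limit `Y*_{δ p}`; here `c` holds the values of the variables bound by `δ`. -/
def iterX (𝒢 : GameGraph V) (ℛ : RabinCondition V k) (c : Context V k) (p : Fin (k + 1)) (i : ℕ) :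
    Set V :=
  (fun X => nest 𝒢 ℛ (k - c.length) (c ++ [(p, limitY 𝒢 ℛ c p, X)]))^[i] ∅

/-- The values `Y_{p_b} = Y*_{p₀ i₀ ⋯ p_b}` and `X_{p_b} = X^{i_b - 1}_{p₀ i₀ ⋯ p_b}` that belong to
the prefix `p₀ i₀ ⋯ p_j i_j`. -/
def context (𝒢 : GameGraph V) (ℛ : RabinCondition V k) (δ : Prefix k) : Context V k :=
  δ.foldl (fun c q => c ++ [(q.1, limitY 𝒢 ℛ c q.1, iterX 𝒢 ℛ c q.1 (q.2 - 1))]) []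

/-- `S_δ`, the union of the sets `𝒞_{p₀ i₀ ⋯ p_b i_b}` over the nonempty prefixes
`p₀ i₀ ⋯ p_b i_b` of `δ`. -/
def prefixSet (𝒢 : GameGraph V) (ℛ : RabinCondition V k) (δ : Prefix k) : Set V :=
  body 𝒢 ℛ (context 𝒢 ℛ δ)

/-- Sequences `p₀ i₀ p₁ i₁ ⋯ p_k i_k`, ordered lexicographically. -/
abbrev Config (k : ℕ) := Lex (Fin (k + 1) → Fin (k + 1) ×ₗ ℕ)

/-- The index `p_b` of a configuration. -/
def Config.idx (d : Config k) (b : Fin (k + 1)) : Fin (k + 1) := (ofLex (ofLex d b)).1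

/-- The counter `i_b` of a configuration. -/
def Config.ctr (d : Config k) (b : Fin (k + 1)) : ℕ := (ofLex (ofLex d b)).2

/-- The prefix `p₀ i₀ ⋯ p_j i_j` of a configuration. -/
def Config.take (d : Config k) (j : Fin (k + 1)) : Prefix k :=
  (List.ofFn fun b => (d.idx b, d.ctr b)).take (j + 1)

/-- The rank set of `v`: it contains `∞`, and the configuration `δ p_j i_j p_{j+1} 0 ⋯ p_k 0` with
`p_{j+1} < ⋯ < p_k` and with positive counters in `δ p_j i_j` iff `v ∈ S_{δ p_j i_j}`. -/
def rankSet [Fintype V] (𝒢 : GameGraph V) (ℛ : RabinCondition V k) (v : V) :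
    Set (WithTop (Config k)) :=
  {⊤} ∪ {r | ∃ (d : Config k) (j : Fin (k + 1)), r = d ∧ Function.Injective d.idx ∧
    (∀ b, j < b → d.ctr b = 0) ∧ (∀ b b', j < b → b < b' → d.idx b < d.idx b') ∧
    (d.take j).Valid (Fintype.card V) ∧ v ∈ prefixSet 𝒢 ℛ (d.take j)}

/-- The rank of `v`: the least element of its rank set. -/
noncomputable def rank [Fintype V] (𝒢 : GameGraph V) (ℛ : RabinCondition V k) (v : V) :
    WithTop (Config k) :=
  wellFounded_lt.min (rankSet 𝒢 ℛ v) ⟨⊤, Or.inl rfl⟩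

theorem rank_isLeast [Fintype V] (𝒢 : GameGraph V) (ℛ : RabinCondition V k) (v : V) :
    IsLeast (rankSet 𝒢 ℛ v) (rank 𝒢 ℛ v) :=
  ⟨wellFounded_lt.min_mem _ _, fun _ h => not_lt.1 (wellFounded_lt.not_lt_min _ h)⟩

/-- At every vertex of Player 0 in `Z*`, the strategy moves to a successor of minimal rank. -/
def MinRank [Fintype V] (𝒢 : GameGraph V) (ℛ : RabinCondition V k) (ρ : Strategy 𝒢 𝒢.V₀) : Prop :=
  ∀ (w : List V) (v : 𝒢.V₀), (v : V) ∈ rabinFixpoint 𝒢 ℛ →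
    ∀ u, 𝒢.E v u → rank 𝒢 ℛ (ρ.move w v) ≤ rank 𝒢 ℛ u

/-! ### The accelerated symbolic evaluation of the fixpoint

The nested fixpoint is evaluated by iteration, and the algorithm touches the game only through
symbolic steps: an application of `∪`, of `∩`, of `Cpre` or of `Apre`, or a test of two sets for
equality. The evaluation is accelerated by a memory:
* when the computation of `Y_{δ p}` is restarted, for the same indices and the same counters of the
  enclosing least fixpoints, it starts from the value reached before, and not from the full set;
* the fixpoints below the prefix `δ` depend on the enclosing variables through `S_δ` only, and they
  are evaluated again only if `S_δ` has changed. -/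

/-- Terms of symbolic operations over computed sets. -/
inductive SymTerm (V : Type u) : Type u
  | set (A : Set V)
  | union (a b : SymTerm V)
  | inter (a b : SymTerm V)
  | cpre (a : SymTerm V)
  | apre (a b : SymTerm V)

/-- The set that a term denotes. -/
def SymTerm.eval (𝒢 : GameGraph V) : SymTerm V → Set V
  | set A => A
  | union a b => a.eval 𝒢 ∪ b.eval 𝒢
  | inter a b => a.eval 𝒢 ∩ b.eval 𝒢
  | cpre a => 𝒢.cpre (a.eval 𝒢)
  | apre a b => 𝒢.apre (a.eval 𝒢) (b.eval 𝒢)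

/-- The number of symbolic operations in a term. -/
def SymTerm.ops : SymTerm V → ℕ
  | set _ => 0
  | union a b => a.ops + b.ops + 1
  | inter a b => a.ops + b.ops + 1
  | cpre a => a.ops + 1
  | apre a b => a.ops + b.ops + 1

/-- The state of the algorithm. For a prefix `δ`, `node δ` is the pair of the value of `S_δ` at the
last evaluation of the fixpoints below `δ` and the result `X_δ` of that evaluation, if there was
one; `limit δ p` is the last value of `Y_{δ p}`; `steps` counts the symbolic steps so far. -/
structure Memory (V : Type u) (k : ℕ) where
  node : Prefix k → Option (Set V × Set V)
  limit : Prefix k → Fin (k + 1) → Set V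
  steps : ℕ

/-- The initial state. -/
def Memory.init : Memory V k where
  node _ := none
  limit _ _ := Set.univ
  steps := 0

/-- Compute the value of a term, at the price of its operations. -/
def Memory.compute (𝒢 : GameGraph V) (M : Memory V k) (a : SymTerm V) : Set V × Memory V k :=
  (a.eval 𝒢, { M with steps := M.steps + a.ops })

/-- Pay for one equality test. -/
def Memory.payTest (M : Memory V k) : Memory V k :=
  { M with steps := M.steps + 1 }

open Classical in
/-- Evaluate the fixpoints below the prefix `δ` for `S_δ = S` by `child`, unless the last evaluation
was for the same set. -/
noncomputable def visit (child : Set V → Memory V k → Set V × Memory V k) (δ : Prefix k)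
    (S : Set V) (M : Memory V k) : Set V × Memory V k :=
  let again : Set V × Memory V k :=
    let r := child S M.payTest
    (r.1, { r.2 with node := Function.update r.2.node δ (some (S, r.1)) })
  match M.node δ with
  | none => again
  | some (S', X) => if S' = S then (X, M.payTest) else again

/-- The iteration `X⁰ = ∅, X¹, …, Xⁱ` over `X_p` for a fixed value `Y` of `Y_p`, below the prefix
`δ` with `S_δ = S`; `Q` is the intersection of the sets `R_qᶜ` over the indices `q` in `δ p`. -/
noncomputable def sweep (𝒢 : GameGraph V) (ℛ : RabinCondition V k)
    (child : Prefix k → Set V → Memory V k → Set V × Memory V k)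
    (δ : Prefix k) (p : Fin (k + 1)) (Q S Y : Set V) : ℕ → Memory V k → Set V × Memory V k
  | 0, M => (∅, M)
  | i + 1, M =>
    let x := sweep 𝒢 ℛ child δ p Q S Y i M
    let s := x.2.compute 𝒢 (.union (.set S) (.inter (.set Q)
      (.union (.inter (.set (ℛ.goal p)) (.cpre (.set Y))) (.apre (.set Y) (.set x.1)))))
    visit (child (δ ++ [(p, i + 1)])) (δ ++ [(p, i + 1)]) s.1 s.2

open Classical in
/-- The iteration over `Y_p` below `δ`, from the stored value of `Y_{δ p}` until it is stable; the
first numerical argument bounds the number of rounds. -/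
noncomputable def settle (round : Set V → Memory V k → Set V × Memory V k)
    (δ : Prefix k) (p : Fin (k + 1)) : ℕ → Memory V k → Set V × Memory V k
  | 0, M => (M.limit δ p, M)
  | m + 1, M =>
    let x := round (M.limit δ p) M
    if x.1 = M.limit δ p then (x.1, x.2.payTest)
    else
      let M' := x.2.payTest
      settle round δ p m
        { M' with limit := Function.update M'.limit δ (Function.update (M'.limit δ) p x.1) }

/-- Evaluate `νY_p. μX_p. …` below the prefix `δ` with `S_δ = S`, where `Q` is the intersection of
the sets `R_qᶜ` over the indices `q` in `δ`. On `n` vertices, `n` iterations over `X_p` reach its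
least fixpoint, and `Y_p` is stable after at most `n + 1` rounds. -/
noncomputable def evalPair [Fintype V] (𝒢 : GameGraph V) (ℛ : RabinCondition V k)
    (child : Prefix k → Set V → Set V → Memory V k → Set V × Memory V k)
    (δ : Prefix k) (Q S : Set V) (p : Fin (k + 1)) (M : Memory V k) : Set V × Memory V k :=
  let q := M.compute 𝒢 (.inter (.set Q) (.set (ℛ.avoid p)ᶜ))
  settle (fun Y => sweep 𝒢 ℛ (fun δ' => child δ' q.1) δ p q.1 S Y (Fintype.card V)) δ p
    (Fintype.card V + 1) q.2

/-- Evaluate the `d` innermost layers of the formula below the prefix `δ` with `S_δ = S`. -/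
noncomputable def evalNode [Fintype V] (𝒢 : GameGraph V) (ℛ : RabinCondition V k) :
    ℕ → Prefix k → Set V → Set V → Memory V k → Set V × Memory V k
  | 0, _, _, S, M => (S, M)
  | d + 1, δ, Q, S, M =>
    ((List.finRange (k + 1)).filter fun p => p ∉ δ.map Prod.fst).foldl
      (fun x p =>
        let y := evalPair 𝒢 ℛ (evalNode 𝒢 ℛ d) δ Q S p x.2
        y.2.compute 𝒢 (.union (.set x.1) (.set y.1)))
      (∅, M)

/-- The whole run of the algorithm: its result and its final state. -/
noncomputable def fixpointAlgorithm [Fintype V] (𝒢 : GameGraph V) (ℛ : RabinCondition V k) :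
    Set V × Memory V k :=
  evalPair 𝒢 ℛ (evalNode 𝒢 ℛ k) [] Set.univ ∅ 0 Memory.init

end FairRabin

namespace FairRabin

variable {V : Type u} {k : ℕ}

/-! ### Monotonicity and least and greatest fixpoints -/

/-! The body of the formula reads the bound variables only through `S_δ`, the union of the sets 𝒞
along the current prefix (`nest_eq_layers`). So everything below a prefix is a monotone function of
its indices and one set.

Algorithm. For fixed counters, `S_δ` and the stored values `Y_{δp}` only shrink during the run.
Hence a stored limit lies above the new greatest fixpoint and the descending iteration may restart
there, and each node is evaluated at most n + 1 times. The cost is amortised: `potential` pays in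
advance for every round that removes a vertex from a limit and for every evaluation of a node below;
the last, unproductive rounds form the fixed price `evalCost`. The initial potential satisfies
T(d+1) = (d+1)·(n·T(d) + lower terms), which gives n^(k+2)·k!.

Minimal-rank strategies win. The rank of a vertex v in Z* exhibits v in some 𝒞 at a position b. A
successor of minimal rank does not increase the rank up to the index p_b; moreover v is a goal of
p_b, or the rank up to the counter i_b drops, or it drops along some live edge (`exists_progress`).
On a fair play let m be the least position that recurs. The index at m becomes constant and its set
R is eventually avoided; if its goal recurred only finitely often, well-foundedness and fairness
would contradict the minimality of a recurring truncated rank (`mem_plays_of_minRank`).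

Completeness. Whether a play is lost depends only on the edges it takes infinitely often, and the
losing edge sets are closed under union. Hence Player 0 can fix a positional winning strategy
wherever the opponent does not win (`positionalWins_or_opponentWins`): two opponent strategies for
complementary choices at one vertex can be interleaved there. In the graph that remains, a strongly
connected set containing its live edges carries a play through all its edges, so some pair has its
goal met and its R avoided there. Binding that pair next shows that the set together with `S_δ` is a
post-fixpoint: otherwise a bottom component of the missing vertices is such a set again with one
more index bound, and the indices run out (`subset_pairFix`, `component_meets_layers`). -/

theorem mu_subset {F : Set V → Set V} {X : Set V} (h : F X ⊆ X) : mu F ⊆ X :=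
  sInf_le h

theorem subset_nu {F : Set V → Set V} {Y : Set V} (h : Y ⊆ F Y) : Y ⊆ nu F :=
  le_sSup (s := {Y | Y ⊆ F Y}) h

theorem mu_fixed {F : Set V → Set V} (hF : Monotone F) : F (mu F) = mu F :=
  (mu_isLeast hF).1

theorem nu_fixed {F : Set V → Set V} (hF : Monotone F) : F (nu F) = nu F :=
  (nu_isGreatest hF).1

theorem mu_mono {F F' : Set V → Set V} (h : ∀ X, F X ⊆ F' X) : mu F ⊆ mu F' :=
  sInf_le_sInf fun X hX => (h X).trans hX

theorem nu_mono {F F' : Set V → Set V} (h : ∀ X, F X ⊆ F' X) : nu F ⊆ nu F' :=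
  sSup_le_sSup fun X (hX : X ⊆ F X) => hX.trans (h X)

theorem iterate_subset_mu {F : Set V → Set V} (hF : Monotone F) (i : ℕ) :
    F^[i] ∅ ⊆ mu F := by
  induction i with
  | zero => exact Set.empty_subset _
  | succ i ih =>
    rw [Function.iterate_succ_apply', ← mu_fixed hF]
    exact hF ih

theorem iterate_subset_succ {F : Set V → Set V} (hF : Monotone F) (i : ℕ) :
    F^[i] ∅ ⊆ F^[i + 1] ∅ := by
  induction i with
  | zero => exact Set.empty_subset _
  | succ i ih =>
    rw [Function.iterate_succ_apply', Function.iterate_succ_apply' F (i + 1)]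
    exact hF ih

/-- On a finite type the least fixpoint is reached after as many steps as there are elements. -/
theorem iterate_card_eq_mu [Fintype V] {F : Set V → Set V} (hF : Monotone F) :
    F^[Fintype.card V] ∅ = mu F := by
  -- Until the iteration is stable, every step adds an element.
  have key : ∀ i, F^[i] ∅ = mu F ∨ i ≤ (F^[i] (∅ : Set V)).ncard := by
    intro i
    induction i with
    | zero => exact Or.inr (Nat.zero_le _)
    | succ i ih =>
      rcases ih with h | h
      · left
        rw [Function.iterate_succ_apply', h, mu_fixed hF]
      · by_cases he : F^[i + 1] ∅ = F^[i] (∅ : Set V)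
        · left
          rw [he]
          refine (iterate_subset_mu hF i).antisymm (mu_subset ?_)
          rw [← Function.iterate_succ_apply' F i, he]
        · right
          have := Set.ncard_lt_ncard (Set.ssubset_iff_subset_ne.2
            ⟨iterate_subset_succ hF i, Ne.symm he⟩) (Set.toFinite _)
          omega
  rcases key (Fintype.card V) with h | h
  · exact h
  · have hu : F^[Fintype.card V] (∅ : Set V) = Set.univ := by
      refine Set.eq_of_subset_of_ncard_le (Set.subset_univ _) ?_ (Set.toFinite _)
      rwa [Set.ncard_univ, Nat.card_eq_fintype_card]
    exact (iterate_subset_mu hF _).antisymm (by rw [hu]; exact Set.subset_univ _)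

theorem cpre_mono (𝒢 : GameGraph V) {S T : Set V} (h : S ⊆ T) : 𝒢.cpre S ⊆ 𝒢.cpre T := by
  rintro v (⟨hv, w, hw, hS⟩ | ⟨hv, hS⟩)
  · exact Or.inl ⟨hv, w, hw, h hS⟩
  · exact Or.inr ⟨hv, fun w hw => h (hS w hw)⟩

theorem apre_mono (𝒢 : GameGraph V) {S S' T T' : Set V} (hS : S ⊆ S') (hT : T ⊆ T') :
    𝒢.apre S T ⊆ 𝒢.apre S' T' := by
  rintro v (h | ⟨⟨w, hw, hwT⟩, hv, h⟩)
  · exact Or.inl (cpre_mono 𝒢 hT h)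
  · exact Or.inr ⟨⟨w, hw, hT hwT⟩, hv, fun w hw => hS (h w hw)⟩

theorem apre_self_subset (𝒢 : GameGraph V) (S : Set V) : 𝒢.apre S S ⊆ 𝒢.cpre S := by
  rintro v (h | ⟨-, h⟩)
  · exact h
  · exact Or.inr h

/-! ### The nested fixpoint as a function of the indices and of `S_δ` -/

/-- The vertices outside all sets to be avoided with index in `I`. -/
def RabinCondition.safe (ℛ : RabinCondition V k) (I : List (Fin (k + 1))) : Set V :=
  {v | ∀ p ∈ I, v ∉ ℛ.avoid p}

theorem safe_append (ℛ : RabinCondition V k) (I : List (Fin (k + 1))) (p : Fin (k + 1)) :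
    ℛ.safe (I ++ [p]) = ℛ.safe I ∩ (ℛ.avoid p)ᶜ := by
  ext v
  simp only [RabinCondition.safe, List.mem_append, List.mem_singleton, Set.mem_ofPred_eq,
    Set.mem_inter_iff, Set.mem_compl_iff]
  constructor
  · exact fun h => ⟨fun q hq => h q (Or.inl hq), h p (Or.inr rfl)⟩
  · rintro ⟨h, hp⟩ q (hq | rfl)
    · exact h q hq
    · exact hp

/-- `S ∪ 𝒞_p`, where the indices in `I` are bound before `p`. -/
def pairStep (𝒢 : GameGraph V) (ℛ : RabinCondition V k) (I : List (Fin (k + 1)))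
    (p : Fin (k + 1)) (S Y X : Set V) : Set V :=
  S ∪ (ℛ.safe (I ++ [p]) ∩ ((ℛ.goal p ∩ 𝒢.cpre Y) ∪ 𝒢.apre Y X))

/-- The `d` innermost layers below the indices `I`, when the union of the sets `𝒞` that belong to
these indices is `S`. -/
def layers (𝒢 : GameGraph V) (ℛ : RabinCondition V k) :
    ℕ → List (Fin (k + 1)) → Set V → Set V
  | 0, _, S => S
  | d + 1, I, S => ⋃ p : Fin (k + 1), ⋃ _ : p ∉ I,
      nu fun Y => mu fun X => layers 𝒢 ℛ d (I ++ [p]) (pairStep 𝒢 ℛ I p S Y X)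

/-- One evaluation of the body of `μX_p`. -/
def pairBody (𝒢 : GameGraph V) (ℛ : RabinCondition V k) (d : ℕ) (I : List (Fin (k + 1)))
    (p : Fin (k + 1)) (S Y X : Set V) : Set V :=
  layers 𝒢 ℛ d (I ++ [p]) (pairStep 𝒢 ℛ I p S Y X)

/-- `νY_p. μX_p. …` below the indices `I`. -/
def pairFix (𝒢 : GameGraph V) (ℛ : RabinCondition V k) (d : ℕ) (I : List (Fin (k + 1)))
    (p : Fin (k + 1)) (S : Set V) : Set V :=
  nu fun Y => mu fun X => pairBody 𝒢 ℛ d I p S Y X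

/-- The iterates of the fixpoint over `X_p` for a fixed value `Y` of `Y_p`. -/
def pairIter (𝒢 : GameGraph V) (ℛ : RabinCondition V k) (d : ℕ) (I : List (Fin (k + 1)))
    (p : Fin (k + 1)) (S Y : Set V) (i : ℕ) : Set V :=
  (pairBody 𝒢 ℛ d I p S Y)^[i] ∅

section
variable (𝒢 : GameGraph V) (ℛ : RabinCondition V k)

theorem layers_succ (d : ℕ) (I : List (Fin (k + 1))) (S : Set V) :
    layers 𝒢 ℛ (d + 1) I S = ⋃ p : Fin (k + 1), ⋃ _ : p ∉ I, pairFix 𝒢 ℛ d I p S := rfl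

theorem mem_layers_succ {d : ℕ} {I : List (Fin (k + 1))} {S : Set V} {v : V} :
    v ∈ layers 𝒢 ℛ (d + 1) I S ↔ ∃ p, p ∉ I ∧ v ∈ pairFix 𝒢 ℛ d I p S := by
  simp [layers_succ]

theorem pairStep_mono (I : List (Fin (k + 1))) (p : Fin (k + 1)) {S S' Y Y' X X' : Set V}
    (hS : S ⊆ S') (hY : Y ⊆ Y') (hX : X ⊆ X') :
    pairStep 𝒢 ℛ I p S Y X ⊆ pairStep 𝒢 ℛ I p S' Y' X' :=
  Set.union_subset_union hS (Set.inter_subset_inter_right _ (Set.union_subset_union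
    (Set.inter_subset_inter_right _ (cpre_mono 𝒢 hY)) (apre_mono 𝒢 hY hX)))

theorem layers_mono (d : ℕ) (I : List (Fin (k + 1))) {S S' : Set V} (h : S ⊆ S') :
    layers 𝒢 ℛ d I S ⊆ layers 𝒢 ℛ d I S' := by
  induction d generalizing I S S' with
  | zero => exact h
  | succ d ih =>
    exact Set.iUnion_mono fun p => Set.iUnion_mono fun _ => nu_mono fun Y => mu_mono fun X =>
      ih _ (pairStep_mono 𝒢 ℛ I p h subset_rfl subset_rfl)

theorem pairBody_mono (d : ℕ) (I : List (Fin (k + 1))) (p : Fin (k + 1)) {S S' Y Y' X X' : Set V}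
    (hS : S ⊆ S') (hY : Y ⊆ Y') (hX : X ⊆ X') :
    pairBody 𝒢 ℛ d I p S Y X ⊆ pairBody 𝒢 ℛ d I p S' Y' X' :=
  layers_mono 𝒢 ℛ d _ (pairStep_mono 𝒢 ℛ I p hS hY hX)

theorem pairBody_monotone (d : ℕ) (I : List (Fin (k + 1))) (p : Fin (k + 1)) (S Y : Set V) :
    Monotone (pairBody 𝒢 ℛ d I p S Y) :=
  fun _ _ h => pairBody_mono 𝒢 ℛ d I p subset_rfl subset_rfl h

theorem mu_pairBody_monotone (d : ℕ) (I : List (Fin (k + 1))) (p : Fin (k + 1)) (S : Set V) :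
    Monotone fun Y => mu fun X => pairBody 𝒢 ℛ d I p S Y X :=
  fun _ _ h => mu_mono fun _ => pairBody_mono 𝒢 ℛ d I p subset_rfl h subset_rfl

theorem pairFix_mono (d : ℕ) (I : List (Fin (k + 1))) (p : Fin (k + 1)) {S S' : Set V}
    (h : S ⊆ S') : pairFix 𝒢 ℛ d I p S ⊆ pairFix 𝒢 ℛ d I p S' :=
  nu_mono fun _ => mu_mono fun _ => pairBody_mono 𝒢 ℛ d I p h subset_rfl subset_rfl

theorem pairIter_succ (d : ℕ) (I : List (Fin (k + 1))) (p : Fin (k + 1)) (S Y : Set V) (i : ℕ) :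
    pairIter 𝒢 ℛ d I p S Y (i + 1) = pairBody 𝒢 ℛ d I p S Y (pairIter 𝒢 ℛ d I p S Y i) :=
  Function.iterate_succ_apply' _ _ _

theorem pairIter_mono (d : ℕ) (I : List (Fin (k + 1))) (p : Fin (k + 1)) {S S' Y Y' : Set V}
    (hS : S ⊆ S') (hY : Y ⊆ Y') (i : ℕ) :
    pairIter 𝒢 ℛ d I p S Y i ⊆ pairIter 𝒢 ℛ d I p S' Y' i := by
  induction i with
  | zero => exact subset_rfl
  | succ i ih =>
    rw [pairIter_succ, pairIter_succ]
    exact pairBody_mono 𝒢 ℛ d I p hS hY ih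

theorem pairIter_card [Fintype V] (d : ℕ) (I : List (Fin (k + 1))) (p : Fin (k + 1))
    (S Y : Set V) :
    pairIter 𝒢 ℛ d I p S Y (Fintype.card V) = mu fun X => pairBody 𝒢 ℛ d I p S Y X :=
  iterate_card_eq_mu (pairBody_monotone 𝒢 ℛ d I p S Y)

theorem pairFix_eq_mu (d : ℕ) (I : List (Fin (k + 1))) (p : Fin (k + 1)) (S : Set V) :
    (mu fun X => pairBody 𝒢 ℛ d I p S (pairFix 𝒢 ℛ d I p S) X) = pairFix 𝒢 ℛ d I p S :=
  nu_fixed (mu_pairBody_monotone 𝒢 ℛ d I p S)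

theorem pairIter_card_pairFix [Fintype V] (d : ℕ) (I : List (Fin (k + 1))) (p : Fin (k + 1))
    (S : Set V) :
    pairIter 𝒢 ℛ d I p S (pairFix 𝒢 ℛ d I p S) (Fintype.card V) = pairFix 𝒢 ℛ d I p S := by
  rw [pairIter_card, pairFix_eq_mu]

theorem pairBody_pairFix (d : ℕ) (I : List (Fin (k + 1))) (p : Fin (k + 1)) (S : Set V) :
    pairBody 𝒢 ℛ d I p S (pairFix 𝒢 ℛ d I p S) (pairFix 𝒢 ℛ d I p S) = pairFix 𝒢 ℛ d I p S := by
  have h := mu_fixed (pairBody_monotone 𝒢 ℛ d I p S (pairFix 𝒢 ℛ d I p S))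
  rwa [pairFix_eq_mu] at h

theorem pairIter_subset_pairFix (d : ℕ) (I : List (Fin (k + 1))) (p : Fin (k + 1)) (S : Set V)
    (i : ℕ) : pairIter 𝒢 ℛ d I p S (pairFix 𝒢 ℛ d I p S) i ⊆ pairFix 𝒢 ℛ d I p S := by
  have h := iterate_subset_mu (pairBody_monotone 𝒢 ℛ d I p S (pairFix 𝒢 ℛ d I p S)) i
  rwa [pairFix_eq_mu] at h

theorem body_nil : body 𝒢 ℛ [] = ∅ := by
  simp [body]

theorem body_eq (c : Context V k) : body 𝒢 ℛ c = {v | ∃ j : Fin c.length,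
    (∀ q ∈ (c.map Prod.fst).take (j + 1), v ∉ ℛ.avoid q) ∧
    v ∈ (ℛ.goal (c.get j).1 ∩ 𝒢.cpre (c.get j).2.1) ∪ 𝒢.apre (c.get j).2.1 (c.get j).2.2} := by
  ext v
  simp only [body, Set.mem_iUnion, Set.mem_ofPred_eq, Set.mem_inter_iff, Set.mem_iInter,
    Set.mem_compl_iff]
  refine exists_congr fun j => and_congr_left fun _ => ?_
  constructor
  · intro h q hq
    obtain ⟨i, hi, rfl⟩ := List.getElem_of_mem hq
    simp only [List.length_take, List.length_map] at hi
    have := h ⟨i, by omega⟩ (by rw [Fin.le_def]; simp only; omega)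
    simpa using this
  · intro h i hi
    refine h _ (List.mem_iff_getElem.2 ⟨i, ?_, ?_⟩)
    · have := i.2
      have := Fin.le_def.1 hi
      simp only [List.length_take, List.length_map]; omega
    · simp

theorem body_append (c : Context V k) (p : Fin (k + 1)) (Y X : Set V) :
    body 𝒢 ℛ (c ++ [(p, Y, X)]) = pairStep 𝒢 ℛ (c.map Prod.fst) p (body 𝒢 ℛ c) Y X := by
  ext v
  have htake : ((c ++ [(p, Y, X)]).map Prod.fst).take (c.length + 1) = c.map Prod.fst ++ [p] := by
    rw [List.take_of_length_le (by simp), List.map_append, List.map_cons, List.map_nil]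
  rw [body_eq, body_eq, pairStep]
  simp only [Set.mem_ofPred_eq, Set.mem_union]
  constructor
  · rintro ⟨⟨j, hj⟩, h1, h2⟩
    by_cases hjc : j < c.length
    · left
      refine ⟨⟨j, hjc⟩, ?_, ?_⟩
      · intro q hq
        refine h1 q ?_
        rw [List.map_append, List.take_append_of_le_length (by simpa using hjc)]
        exact hq
      · simpa [List.getElem_append_left hjc] using h2
    · right
      have hj' : j = c.length := by simp at hj; omega
      subst hj'
      refine ⟨fun q hq => h1 q ((congrArg (q ∈ ·) htake).mpr hq), ?_⟩
      simpa using h2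
  · rintro (⟨⟨j, hj⟩, h1, h2⟩ | ⟨h1, h2⟩)
    · refine ⟨⟨j, by simp; omega⟩, ?_, ?_⟩
      · intro q hq
        refine h1 q ?_
        rw [List.map_append, List.take_append_of_le_length (by simpa using hj)] at hq
        exact hq
      · simpa [List.getElem_append_left hj] using h2
    · refine ⟨⟨c.length, by simp⟩, fun q hq => h1 q ((congrArg (q ∈ ·) htake).mp hq), ?_⟩
      simpa using h2

/-- Binding one more pair changes the body exactly by `pairStep`, so the values in the context
matter only through their body. This is why the result below a prefix may be reused while `S_δ` is
unchanged. -/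
theorem nest_eq_layers (d : ℕ) (c : Context V k) :
    nest 𝒢 ℛ d c = layers 𝒢 ℛ d (c.map Prod.fst) (body 𝒢 ℛ c) := by
  induction d generalizing c with
  | zero => rfl
  | succ d ih =>
    simp only [nest, layers, ih, body_append, List.map_append, List.map_cons, List.map_nil]

theorem limitY_eq (c : Context V k) (p : Fin (k + 1)) :
    limitY 𝒢 ℛ c p = pairFix 𝒢 ℛ (k - c.length) (c.map Prod.fst) p (body 𝒢 ℛ c) := by
  simp only [limitY, pairFix, pairBody, nest_eq_layers, body_append, List.map_append,
    List.map_cons, List.map_nil]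

theorem iterX_eq (c : Context V k) (p : Fin (k + 1)) (i : ℕ) :
    iterX 𝒢 ℛ c p i = pairIter 𝒢 ℛ (k - c.length) (c.map Prod.fst) p (body 𝒢 ℛ c)
      (pairFix 𝒢 ℛ (k - c.length) (c.map Prod.fst) p (body 𝒢 ℛ c)) i := by
  simp only [iterX, pairIter, limitY_eq, nest_eq_layers, body_append, List.map_append,
    List.map_cons, List.map_nil]
  rfl

theorem rabinFixpoint_eq : rabinFixpoint 𝒢 ℛ = pairFix 𝒢 ℛ k [] 0 ∅ := by
  have h : ∀ Y X, body 𝒢 ℛ [(0, Y, X)] = pairStep 𝒢 ℛ [] 0 ∅ Y X := fun Y X => by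
    rw [← body_nil 𝒢 ℛ]; exact body_append 𝒢 ℛ [] 0 Y X
  simp only [rabinFixpoint, nest_eq_layers, h]
  rfl

theorem context_append (δ : Prefix k) (q : Fin (k + 1) × ℕ) :
    context 𝒢 ℛ (δ ++ [q]) = context 𝒢 ℛ δ ++ [(q.1, limitY 𝒢 ℛ (context 𝒢 ℛ δ) q.1,
      iterX 𝒢 ℛ (context 𝒢 ℛ δ) q.1 (q.2 - 1))] := by
  simp [context]

theorem context_map_fst (δ : Prefix k) : (context 𝒢 ℛ δ).map Prod.fst = δ.map Prod.fst := by
  induction δ using List.reverseRecOn with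
  | nil => rfl
  | append_singleton δ q ih => simp [context_append, ih]

theorem context_length (δ : Prefix k) : (context 𝒢 ℛ δ).length = δ.length := by
  rw [← List.length_map (f := Prod.fst), context_map_fst, List.length_map]

/-- `Y*_{δ p}`. -/
def prefixFix (δ : Prefix k) (p : Fin (k + 1)) : Set V :=
  pairFix 𝒢 ℛ (k - δ.length) (δ.map Prod.fst) p (prefixSet 𝒢 ℛ δ)

/-- `X^i_{δ p}`. -/
def prefixIter (δ : Prefix k) (p : Fin (k + 1)) (i : ℕ) : Set V :=
  pairIter 𝒢 ℛ (k - δ.length) (δ.map Prod.fst) p (prefixSet 𝒢 ℛ δ) (prefixFix 𝒢 ℛ δ p) i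

theorem limitY_context (δ : Prefix k) (p : Fin (k + 1)) :
    limitY 𝒢 ℛ (context 𝒢 ℛ δ) p = prefixFix 𝒢 ℛ δ p := by
  rw [limitY_eq, context_map_fst, context_length]; rfl

theorem iterX_context (δ : Prefix k) (p : Fin (k + 1)) (i : ℕ) :
    iterX 𝒢 ℛ (context 𝒢 ℛ δ) p i = prefixIter 𝒢 ℛ δ p i := by
  rw [iterX_eq, context_map_fst, context_length]; rfl

theorem prefixSet_nil : prefixSet 𝒢 ℛ [] = ∅ := body_nil 𝒢 ℛ

theorem prefixSet_append (δ : Prefix k) (p : Fin (k + 1)) (i : ℕ) :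
    prefixSet 𝒢 ℛ (δ ++ [(p, i)]) = pairStep 𝒢 ℛ (δ.map Prod.fst) p (prefixSet 𝒢 ℛ δ)
      (prefixFix 𝒢 ℛ δ p) (prefixIter 𝒢 ℛ δ p (i - 1)) := by
  rw [prefixSet, context_append, body_append, context_map_fst, limitY_context, iterX_context]
  rfl

/-- The counter i + 1 comes with the value `X^i`, so the layers below `δ p (i + 1)` produce the next
iterate. -/
theorem prefixIter_succ (δ : Prefix k) (p : Fin (k + 1)) (i : ℕ) :
    prefixIter 𝒢 ℛ δ p (i + 1) = layers 𝒢 ℛ (k - δ.length) (δ.map Prod.fst ++ [p])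
      (prefixSet 𝒢 ℛ (δ ++ [(p, i + 1)])) := by
  rw [prefixSet_append, prefixIter, pairIter_succ]
  rfl

end

/-! ### Correctness and cost of the accelerated evaluation -/

/-- The indices that are not in `I`. -/
def remaining (I : List (Fin (k + 1))) : List (Fin (k + 1)) :=
  (List.finRange (k + 1)).filter fun p => p ∉ I

theorem mem_remaining {I : List (Fin (k + 1))} {p : Fin (k + 1)} : p ∈ remaining I ↔ p ∉ I := by
  simp [remaining]

theorem remaining_nodup (I : List (Fin (k + 1))) : (remaining I).Nodup :=
  (List.nodup_finRange _).filter _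

theorem length_remaining_append {I : List (Fin (k + 1))} {p : Fin (k + 1)} (hp : p ∉ I) :
    (remaining (I ++ [p])).length + 1 = (remaining I).length := by
  have h : remaining (I ++ [p]) = (remaining I).erase p := by
    rw [(remaining_nodup I).erase_eq_filter, remaining, remaining, List.filter_filter]
    refine List.filter_congr fun q _ => ?_
    by_cases h1 : q = p <;> simp [h1]
  rw [h, List.length_erase_of_mem (mem_remaining.2 hp)]
  have := List.length_pos_of_mem (mem_remaining.2 hp)
  omega

/-- The value of `S_{δ p (i + 1)}` when `S_δ = S` and `Y_p = Y`. -/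
def nodeSet (𝒢 : GameGraph V) (ℛ : RabinCondition V k) (d : ℕ)
    (I : List (Fin (k + 1))) (p : Fin (k + 1)) (S Y : Set V) (i : ℕ) : Set V :=
  pairStep 𝒢 ℛ I p S Y (pairIter 𝒢 ℛ d I p S Y i)

/-- The source of both accelerations: at fixed counters a node sees a decreasing sequence of sets,
because the enclosing `S` and `Y` only decrease. -/
theorem nodeSet_mono (𝒢 : GameGraph V) (ℛ : RabinCondition V k) (d : ℕ)
    (I : List (Fin (k + 1))) (p : Fin (k + 1)) {S S' Y Y' : Set V}
    (hS : S ⊆ S') (hY : Y ⊆ Y') (i : ℕ) :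
    nodeSet 𝒢 ℛ d I p S Y i ⊆ nodeSet 𝒢 ℛ d I p S' Y' i :=
  pairStep_mono 𝒢 ℛ I p hS hY (pairIter_mono 𝒢 ℛ d I p hS hY i)

/-- The memory below `δ` is still in the initial state. -/
def Blank (δ : Prefix k) (M : Memory V k) : Prop :=
  ∀ δ', δ <+: δ' → (δ' ≠ δ → M.node δ' = none) ∧ ∀ p, M.limit δ' p = Set.univ

/-- The two states agree strictly below `δ`, and on the limits at `δ`. -/
def AgreeBelow (δ : Prefix k) (M M' : Memory V k) : Prop :=
  ∀ δ', δ <+: δ' → (δ' ≠ δ → M'.node δ' = M.node δ') ∧ M'.limit δ' = M.limit δ'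

/-- The two states agree at `δ` and below. -/
def AgreeOn (δ : Prefix k) (M M' : Memory V k) : Prop :=
  ∀ δ', δ <+: δ' → M'.node δ' = M.node δ' ∧ M'.limit δ' = M.limit δ'

theorem AgreeOn.below {δ : Prefix k} {M M' : Memory V k} (h : AgreeOn δ M M') :
    AgreeBelow δ M M' :=
  fun δ' hδ => ⟨fun _ => (h δ' hδ).1, (h δ' hδ).2⟩

theorem AgreeBelow.child {δ : Prefix k} {M M' : Memory V k} (h : AgreeBelow δ M M')
    (q : Fin (k + 1) × ℕ) : AgreeOn (δ ++ [q]) M M' := by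
  intro δ' hδ
  have h1 : δ <+: δ' := (List.prefix_append δ [q]).trans hδ
  refine ⟨(h δ' h1).1 ?_, (h δ' h1).2⟩
  rintro rfl
  simpa using hδ.length_le

/-- The two states agree below `δ p`, and on the limit at `δ p`. -/
def AgreePair (δ : Prefix k) (p : Fin (k + 1)) (M M' : Memory V k) : Prop :=
  M'.limit δ p = M.limit δ p ∧ ∀ i, AgreeOn (δ ++ [(p, i)]) M M'

theorem Blank.congr {δ : Prefix k} {M M' : Memory V k}
    (h : AgreeBelow δ M M') (hD : Blank δ M) : Blank δ M' := by
  intro δ' hδ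
  refine ⟨fun hne => ?_, fun p => ?_⟩
  · rw [(h δ' hδ).1 hne]; exact (hD δ' hδ).1 hne
  · rw [(h δ' hδ).2]; exact (hD δ' hδ).2 p

/-! ### Invariants of the memory -/

section Invariants
variable [Fintype V] (𝒢 : GameGraph V) (ℛ : RabinCondition V k)

/-- The memory below `δ` is that of a finished evaluation for `S_δ = S`. -/
def Done : ℕ → Prefix k → Set V → Memory V k → Prop
  | 0, _, _, _ => True
  | d + 1, δ, S, M => ∀ p ∉ δ.map Prod.fst,
      M.limit δ p = pairFix 𝒢 ℛ d (δ.map Prod.fst) p S ∧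
      ∀ i < Fintype.card V,
        M.node (δ ++ [(p, i + 1)]) = some
          (nodeSet 𝒢 ℛ d (δ.map Prod.fst) p S (pairFix 𝒢 ℛ d (δ.map Prod.fst) p S) i,
            layers 𝒢 ℛ d ((δ ++ [(p, i + 1)]).map Prod.fst)
              (nodeSet 𝒢 ℛ d (δ.map Prod.fst) p S (pairFix 𝒢 ℛ d (δ.map Prod.fst) p S) i)) ∧
        Done d (δ ++ [(p, i + 1)])
          (nodeSet 𝒢 ℛ d (δ.map Prod.fst) p S (pairFix 𝒢 ℛ d (δ.map Prod.fst) p S) i) M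

/-- The memory at `δ` and below is that of a finished evaluation for `S_δ = S`. -/
def NodeDone (d : ℕ) (δ : Prefix k) (S : Set V) (M : Memory V k) : Prop :=
  M.node δ = some (S, layers 𝒢 ℛ d (δ.map Prod.fst) S) ∧ Done 𝒢 ℛ d δ S M

/-- The memory below `δ p` is that of a finished round for `S_δ = S` and `Y_p = Y`. -/
def PairDone (d : ℕ) (δ : Prefix k) (p : Fin (k + 1)) (S Y : Set V) (M : Memory V k) : Prop :=
  ∀ i < Fintype.card V,
    NodeDone 𝒢 ℛ d (δ ++ [(p, i + 1)]) (nodeSet 𝒢 ℛ d (δ.map Prod.fst) p S Y i) M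

theorem done_succ {d : ℕ} {δ : Prefix k} {S : Set V} {M : Memory V k} :
    Done 𝒢 ℛ (d + 1) δ S M ↔ ∀ p ∉ δ.map Prod.fst,
      M.limit δ p = pairFix 𝒢 ℛ d (δ.map Prod.fst) p S ∧
      PairDone 𝒢 ℛ d δ p S (pairFix 𝒢 ℛ d (δ.map Prod.fst) p S) M := Iff.rfl

/-- The memory below `δ` allows an evaluation for `S_δ = S`. -/
def Ready (d : ℕ) (δ : Prefix k) (S : Set V) (M : Memory V k) : Prop :=
  Blank δ M ∨ ∃ S', S ⊆ S' ∧ Done 𝒢 ℛ d δ S' M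

/-- The memory at `δ` and below allows a visit with `S_δ = S`. -/
def NodeReady (d : ℕ) (δ : Prefix k) (S : Set V) (M : Memory V k) : Prop :=
  (M.node δ = none ∧ Blank δ M) ∨ ∃ S', S ⊆ S' ∧ NodeDone 𝒢 ℛ d δ S' M

/-- The memory below `δ p` allows an evaluation of `νY_p. μX_p. …` for `S_δ = S`. -/
def PairReady (d : ℕ) (δ : Prefix k) (p : Fin (k + 1)) (S : Set V) (M : Memory V k) : Prop :=
  ((∀ i, M.node (δ ++ [(p, i + 1)]) = none ∧ Blank (δ ++ [(p, i + 1)]) M) ∨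
    ∃ S' Y', S ⊆ S' ∧ M.limit δ p ⊆ Y' ∧ PairDone 𝒢 ℛ d δ p S' Y' M) ∧
  (mu fun X => pairBody 𝒢 ℛ d (δ.map Prod.fst) p S (M.limit δ p) X) ⊆ M.limit δ p ∧
  pairFix 𝒢 ℛ d (δ.map Prod.fst) p S ⊆ M.limit δ p

theorem Done.congr {d : ℕ} {δ : Prefix k} {S : Set V} {M M' : Memory V k}
    (h : AgreeBelow δ M M') (hD : Done 𝒢 ℛ d δ S M) : Done 𝒢 ℛ d δ S M' := by
  induction d generalizing δ S with
  | zero => trivial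
  | succ d ih =>
    intro p hp
    refine ⟨?_, fun i hi => ⟨?_, ?_⟩⟩
    · rw [(h δ List.prefix_rfl).2]; exact (hD p hp).1
    · rw [(h.child (p, i + 1) _ List.prefix_rfl).1]; exact ((hD p hp).2 i hi).1
    · exact ih (h.child (p, i + 1)).below ((hD p hp).2 i hi).2

theorem NodeDone.congr {d : ℕ} {δ : Prefix k} {S : Set V} {M M' : Memory V k}
    (h : AgreeOn δ M M') (hD : NodeDone 𝒢 ℛ d δ S M) : NodeDone 𝒢 ℛ d δ S M' :=
  ⟨by rw [(h δ List.prefix_rfl).1]; exact hD.1, hD.2.congr 𝒢 ℛ h.below⟩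

theorem NodeReady.congr {d : ℕ} {δ : Prefix k} {S : Set V} {M M' : Memory V k}
    (h : AgreeOn δ M M') (hD : NodeReady 𝒢 ℛ d δ S M) : NodeReady 𝒢 ℛ d δ S M' := by
  rcases hD with ⟨h1, h2⟩ | ⟨S', hS, h1⟩
  · exact Or.inl ⟨by rw [(h δ List.prefix_rfl).1]; exact h1, h2.congr h.below⟩
  · exact Or.inr ⟨S', hS, h1.congr 𝒢 ℛ h⟩

theorem PairReady.congr {d : ℕ} {δ : Prefix k} {p : Fin (k + 1)} {S : Set V} {M M' : Memory V k}
    (h : AgreePair δ p M M') (hD : PairReady 𝒢 ℛ d δ p S M) : PairReady 𝒢 ℛ d δ p S M' := by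
  unfold PairReady
  rw [h.1]
  refine ⟨?_, hD.2⟩
  rcases hD.1 with h1 | ⟨S', Y', hS, hY, h1⟩
  · refine Or.inl fun i => ⟨?_, (h1 i).2.congr (h.2 _).below⟩
    rw [(h.2 (i + 1) _ List.prefix_rfl).1]; exact (h1 i).1
  · exact Or.inr ⟨S', Y', hS, hY, fun i hi => (h1 i hi).congr 𝒢 ℛ (h.2 _)⟩

/-- A blank limit is the full set. A limit `Y'` left by an evaluation for a larger `S'` is the
fixpoint for `S'`; by monotonicity it contains the one for `S`, and a round for `S` maps it into
itself. -/
theorem Ready.pair {d : ℕ} {δ : Prefix k} {S : Set V} {M : Memory V k}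
    (h : Ready 𝒢 ℛ (d + 1) δ S M) {p : Fin (k + 1)} (hp : p ∉ δ.map Prod.fst) :
    PairReady 𝒢 ℛ d δ p S M := by
  rcases h with h | ⟨S', hS, h⟩
  · have hl := (h δ List.prefix_rfl).2 p
    unfold PairReady
    rw [hl]
    refine ⟨Or.inl fun i => ⟨?_, ?_⟩, Set.subset_univ _, Set.subset_univ _⟩
    · exact (h _ (List.prefix_append _ _)).1 (by simp)
    · intro δ' hδ
      have h1 := h δ' ((List.prefix_append _ _).trans hδ)
      refine ⟨fun _ => h1.1 ?_, h1.2⟩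
      rintro rfl
      simpa using hδ.length_le
  · have h1 := (done_succ 𝒢 ℛ).1 h p hp
    refine ⟨Or.inr ⟨S', _, hS, h1.1.subset, h1.2⟩, ?_, ?_⟩
    · rw [h1.1]
      conv_rhs => rw [← pairFix_eq_mu]
      exact mu_mono fun X => pairBody_mono 𝒢 ℛ d _ p hS subset_rfl subset_rfl
    · rw [h1.1]
      exact pairFix_mono 𝒢 ℛ d _ p hS

theorem PairReady.node {d : ℕ} {δ : Prefix k} {p : Fin (k + 1)} {S : Set V} {M : Memory V k}
    (h : PairReady 𝒢 ℛ d δ p S M) {i : ℕ} (hi : i < Fintype.card V) :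
    NodeReady 𝒢 ℛ d (δ ++ [(p, i + 1)])
      (nodeSet 𝒢 ℛ d (δ.map Prod.fst) p S (M.limit δ p) i) M := by
  rcases h.1 with h1 | ⟨S', Y', hS, hY, h1⟩
  · exact Or.inl (h1 i)
  · exact Or.inr ⟨_, nodeSet_mono 𝒢 ℛ d _ p hS hY i, h1 i hi⟩

/-! #### The potential of a state -/

/-- The amount of fixed evaluation costs `e` that a node may still cause. -/
noncomputable def nodePot (e : ℕ) : Option (Set V × Set V) → ℕ
  -- The first evaluation is for a set of at most n vertices, and each later one for a strictly
  -- smaller set.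
  | none => (Fintype.card V + 1) * e
  | some (S, _) => S.ncard * e

variable (V) in
/-- The part of the cost of an evaluation of `d` layers that is not covered by the potential. -/
def evalCost (d : ℕ) : ℕ := d * (7 * Fintype.card V + 3)

/-- The cost that may still arise below `δ`, in addition to the fixed evaluation costs. -/
noncomputable def potential : ℕ → Prefix k → Memory V k → ℕ
  | 0, _, _ => 0
  | d + 1, δ, M => ((remaining (δ.map Prod.fst)).map fun p =>
      -- A round costs 7 per iteration over `X_p` and one stability test; a round that is not the
      -- last removes a vertex from the limit.
      (7 * Fintype.card V + 1) * (M.limit δ p).ncard +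
      ∑ i ∈ Finset.range (Fintype.card V),
        (nodePot (evalCost V d) (M.node (δ ++ [(p, i + 1)])) +
          potential d (δ ++ [(p, i + 1)]) M)).sum

/-- The potential at `δ` and below. -/
noncomputable def fullPot (d : ℕ) (δ : Prefix k) (M : Memory V k) : ℕ :=
  nodePot (evalCost V d) (M.node δ) + potential d δ M

/-- The potential below `δ p`. -/
noncomputable def pairPot (d : ℕ) (δ : Prefix k) (p : Fin (k + 1)) (M : Memory V k) : ℕ :=
  (7 * Fintype.card V + 1) * (M.limit δ p).ncard +
    ∑ i ∈ Finset.range (Fintype.card V), fullPot d (δ ++ [(p, i + 1)]) M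

theorem potential_succ (d : ℕ) (δ : Prefix k) (M : Memory V k) :
    potential (d + 1) δ M =
      ((remaining (δ.map Prod.fst)).map fun p => pairPot d δ p M).sum := rfl

theorem potential_congr {d : ℕ} {δ : Prefix k} {M M' : Memory V k} (h : AgreeBelow δ M M') :
    potential d δ M' = potential d δ M := by
  induction d generalizing δ with
  | zero => rfl
  | succ d ih =>
    rw [potential_succ, potential_succ]
    congr 1
    refine List.map_congr_left fun p _ => ?_
    unfold pairPot fullPot
    rw [(h δ List.prefix_rfl).2]
    congr 1
    refine Finset.sum_congr rfl fun i _ => ?_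
    rw [(h.child (p, i + 1) _ List.prefix_rfl).1, ih (h.child (p, i + 1)).below]

theorem fullPot_congr {d : ℕ} {δ : Prefix k} {M M' : Memory V k} (h : AgreeOn δ M M') :
    fullPot d δ M' = fullPot d δ M := by
  rw [fullPot, fullPot, (h δ List.prefix_rfl).1, potential_congr h.below]

theorem pairPot_congr {d : ℕ} {δ : Prefix k} {p : Fin (k + 1)} {M M' : Memory V k}
    (h : AgreePair δ p M M') : pairPot d δ p M' = pairPot d δ p M := by
  rw [pairPot, pairPot, h.1]
  congr 1
  exact Finset.sum_congr rfl fun i _ => fullPot_congr (h.2 _)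

end Invariants

theorem agreeBelow_payTest (δ : Prefix k) (M : Memory V k) : AgreeBelow δ M M.payTest :=
  fun _ _ => ⟨fun _ => rfl, rfl⟩

/-! ### Specifications of the procedures: value, finished memory, frame and amortised cost -/

section Evaluation
variable [Fintype V] (𝒢 : GameGraph V) (ℛ : RabinCondition V k)

/-- Specification of an evaluation of `d` layers below `δ` for `S_δ = S`, from the state `M`. -/
structure EvalSpec (d : ℕ) (δ : Prefix k) (S : Set V) (M : Memory V k)
    (r : Set V × Memory V k) : Prop where
  val : r.1 = layers 𝒢 ℛ d (δ.map Prod.fst) S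
  done : Done 𝒢 ℛ d δ S r.2
  node_eq : ∀ δ', (¬ δ <+: δ' ∨ δ' = δ) → r.2.node δ' = M.node δ'
  limit_eq : ∀ δ', ¬ δ <+: δ' → r.2.limit δ' = M.limit δ'
  cost : r.2.steps + potential d δ r.2 ≤ M.steps + evalCost V d + potential d δ M

/-- Specification of a visit of the node `δ` for `S_δ = S`, from the state `M`. -/
structure VisitSpec (d : ℕ) (δ : Prefix k) (S : Set V) (M : Memory V k)
    (r : Set V × Memory V k) : Prop where
  val : r.1 = layers 𝒢 ℛ d (δ.map Prod.fst) S
  done : NodeDone 𝒢 ℛ d δ S r.2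
  frame : ∀ δ', ¬ δ <+: δ' → r.2.node δ' = M.node δ' ∧ r.2.limit δ' = M.limit δ'
  cost : r.2.steps + fullPot d δ r.2 ≤ M.steps + 1 + fullPot d δ M

theorem NodeReady.ready {d : ℕ} {δ : Prefix k} {S : Set V} {M : Memory V k}
    (h : NodeReady 𝒢 ℛ d δ S M) : Ready 𝒢 ℛ d δ S M := by
  rcases h with h | ⟨S', hS, h⟩
  · exact Or.inl h.2
  · exact Or.inr ⟨S', hS, h.2⟩

theorem Ready.congr {d : ℕ} {δ : Prefix k} {S : Set V} {M M' : Memory V k}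
    (h : AgreeBelow δ M M') (hR : Ready 𝒢 ℛ d δ S M) : Ready 𝒢 ℛ d δ S M' := by
  rcases hR with hR | ⟨S', hS, hR⟩
  · exact Or.inl (hR.congr h)
  · exact Or.inr ⟨S', hS, hR.congr 𝒢 ℛ h⟩

/-- Either the set is the stored one and only the test is paid, or the node is new or its set has
lost a vertex, and the drop of `nodePot` covers `evalCost`. -/
theorem visit_spec {d : ℕ} {δ : Prefix k} {S : Set V} {M : Memory V k}
    {child : Set V → Memory V k → Set V × Memory V k}
    (hchild : ∀ M, Ready 𝒢 ℛ d δ S M → EvalSpec 𝒢 ℛ d δ S M (child S M))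
    (h : NodeReady 𝒢 ℛ d δ S M) : VisitSpec 𝒢 ℛ d δ S M (visit child δ S M) := by
  have hc := hchild M.payTest (h.ready.congr 𝒢 ℛ (agreeBelow_payTest δ M))
  set r := child S M.payTest with hr
  have again : nodePot (evalCost V d) (some (S, r.1)) + evalCost V d ≤
      nodePot (evalCost V d) (M.node δ) → VisitSpec 𝒢 ℛ d δ S M
        (r.1, { r.2 with node := Function.update r.2.node δ (some (S, r.1)) }) := by
    intro hpot
    have hag : AgreeBelow δ r.2
        { r.2 with node := Function.update r.2.node δ (some (S, r.1)) } := by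
      intro δ' _
      exact ⟨fun hne => Function.update_of_ne hne _ _, rfl⟩
    refine ⟨hc.val, ⟨?_, hc.done.congr 𝒢 ℛ hag⟩, fun δ' hδ' => ⟨?_, hc.limit_eq δ' hδ'⟩, ?_⟩
    · simp [hc.val]
    · have hne : δ' ≠ δ := by
        rintro rfl
        exact hδ' List.prefix_rfl
      simp only [Function.update_of_ne hne]
      exact hc.node_eq δ' (Or.inl hδ')
    · have h1 := hc.cost
      rw [fullPot, fullPot, potential_congr hag]
      rw [potential_congr (agreeBelow_payTest δ M)] at h1
      simp only [Function.update_self, Memory.payTest] at h1 ⊢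
      omega
  rcases h with ⟨h1, -⟩ | ⟨S', hS, h1, h2⟩
  · have hv : visit child δ S M =
        (r.1, { r.2 with node := Function.update r.2.node δ (some (S, r.1)) }) := by
      simp only [visit, h1, hr]
    rw [hv]
    refine again ?_
    rw [h1]
    simp only [nodePot, add_mul, one_mul]
    have : S.ncard ≤ Fintype.card V := by
      rw [← Nat.card_eq_fintype_card]; exact Set.ncard_le_card S
    gcongr
  · by_cases hSS : S' = S
    · subst hSS
      have hv : visit child δ S' M = (layers 𝒢 ℛ d (δ.map Prod.fst) S', M.payTest) := by
        simp only [visit, h1, if_true]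
      rw [hv]
      refine ⟨rfl, ⟨h1, h2.congr 𝒢 ℛ (agreeBelow_payTest δ M)⟩, fun _ _ => ⟨rfl, rfl⟩, ?_⟩
      rw [fullPot, fullPot, potential_congr (agreeBelow_payTest δ M)]
      simp only [Memory.payTest]
      omega
    · have hv : visit child δ S M =
          (r.1, { r.2 with node := Function.update r.2.node δ (some (S, r.1)) }) := by
        simp only [visit, h1, if_neg hSS, hr]
      rw [hv]
      refine again ?_
      rw [h1]
      simp only [nodePot]
      have : S.ncard < S'.ncard :=
        Set.ncard_lt_ncard (Set.ssubset_iff_subset_ne.2 ⟨hS, Ne.symm hSS⟩) (Set.toFinite _)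
      calc S.ncard * evalCost V d + evalCost V d = (S.ncard + 1) * evalCost V d := by ring
        _ ≤ S'.ncard * evalCost V d := Nat.mul_le_mul_right _ this

theorem not_prefix_sibling {δ δ' : Prefix k} {q q' : Fin (k + 1) × ℕ} (hne : q ≠ q')
    (h : δ ++ [q] <+: δ') : ¬ δ ++ [q'] <+: δ' := by
  obtain ⟨l, rfl⟩ := h
  rintro ⟨l', h'⟩
  simp only [List.append_assoc, List.cons_append, List.nil_append, List.append_cancel_left_eq,
    List.cons.injEq] at h'
  exact hne h'.1.symm

theorem not_child_prefix (δ : Prefix k) (q : Fin (k + 1) × ℕ) : ¬ δ ++ [q] <+: δ := fun h => by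
  simpa using h.length_le

/-- Specification of `i` iterations over `X_p` below `δ` for `S_δ = S` and `Y_p = Y`. -/
structure SweepSpec (d : ℕ) (δ : Prefix k) (p : Fin (k + 1)) (S Y : Set V) (M : Memory V k)
    (i : ℕ) (r : Set V × Memory V k) : Prop where
  val : r.1 = pairIter 𝒢 ℛ d (δ.map Prod.fst) p S Y i
  done : ∀ j < i, NodeDone 𝒢 ℛ d (δ ++ [(p, j + 1)])
    (nodeSet 𝒢 ℛ d (δ.map Prod.fst) p S Y j) r.2
  frame : ∀ δ', (∀ j < i, ¬ δ ++ [(p, j + 1)] <+: δ') →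
    r.2.node δ' = M.node δ' ∧ r.2.limit δ' = M.limit δ'
  cost : r.2.steps + ∑ j ∈ Finset.range i, fullPot d (δ ++ [(p, j + 1)]) r.2 ≤
    M.steps + 7 * i + ∑ j ∈ Finset.range i, fullPot d (δ ++ [(p, j + 1)]) M

/-- Different counters own disjoint parts of the memory, so a visit leaves the sibling nodes ready
or finished. The 7 per iteration consists of six operations and the test made by `visit`. -/
theorem sweep_spec {d : ℕ} {δ : Prefix k} {p : Fin (k + 1)} {S Y : Set V} {M : Memory V k}
    {child : Prefix k → Set V → Memory V k → Set V × Memory V k}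
    (hchild : ∀ j S M, Ready 𝒢 ℛ d (δ ++ [(p, j)]) S M →
      EvalSpec 𝒢 ℛ d (δ ++ [(p, j)]) S M (child (δ ++ [(p, j)]) S M))
    (h : ∀ j < Fintype.card V, NodeReady 𝒢 ℛ d (δ ++ [(p, j + 1)])
      (nodeSet 𝒢 ℛ d (δ.map Prod.fst) p S Y j) M) (i : ℕ) (hi : i ≤ Fintype.card V) :
    SweepSpec 𝒢 ℛ d δ p S Y M i
      (sweep 𝒢 ℛ child δ p (ℛ.safe (δ.map Prod.fst ++ [p])) S Y i M) := by
  induction i with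
  | zero =>
    exact ⟨rfl, fun j hj => absurd hj (Nat.not_lt_zero j), fun _ _ => ⟨rfl, rfl⟩,
      by simp [sweep]⟩
  | succ i ih =>
    have ih := ih (Nat.le_of_succ_le hi)
    set x := sweep 𝒢 ℛ child δ p (ℛ.safe (δ.map Prod.fst ++ [p])) S Y i M with hx
    set t : SymTerm V := .union (.set S) (.inter (.set (ℛ.safe (δ.map Prod.fst ++ [p])))
      (.union (.inter (.set (ℛ.goal p)) (.cpre (.set Y))) (.apre (.set Y) (.set x.1)))) with ht
    have hval : t.eval 𝒢 = nodeSet 𝒢 ℛ d (δ.map Prod.fst) p S Y i := by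
      rw [nodeSet, ← ih.val]; rfl
    have hops : t.ops = 6 := rfl
    set M₁ : Memory V k := { x.2 with steps := x.2.steps + t.ops } with hM₁
    have hs : sweep 𝒢 ℛ child δ p (ℛ.safe (δ.map Prod.fst ++ [p])) S Y (i + 1) M =
        visit (child (δ ++ [(p, i + 1)])) (δ ++ [(p, i + 1)]) (t.eval 𝒢) M₁ := rfl
    have hag : AgreeOn (δ ++ [(p, i + 1)]) M M₁ := by
      intro δ' hδ'
      refine ih.frame δ' fun j hj => not_prefix_sibling ?_ hδ'
      intro h; simp at h; omega
    rw [hs, hval]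
    have hv := visit_spec 𝒢 ℛ (hchild (i + 1) _) ((h i hi).congr 𝒢 ℛ hag)
    set r := visit (child (δ ++ [(p, i + 1)])) (δ ++ [(p, i + 1)])
      (nodeSet 𝒢 ℛ d (δ.map Prod.fst) p S Y i) M₁ with hr
    have hold : ∀ j < i, AgreeOn (δ ++ [(p, j + 1)]) x.2 r.2 := by
      intro j hj δ' hδ'
      refine hv.frame δ' (not_prefix_sibling ?_ hδ')
      intro h; simp at h; omega
    refine ⟨?_, ?_, ?_, ?_⟩
    · rw [hv.val, pairIter_succ, List.map_append]
      rfl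
    · intro j hj
      rcases Nat.lt_succ_iff_lt_or_eq.1 hj with hj | rfl
      · exact (ih.done j hj).congr 𝒢 ℛ (hold j hj)
      · exact hv.done
    · intro δ' hδ'
      have h1 := hv.frame δ' (hδ' i (Nat.lt_succ_self i))
      have h2 := ih.frame δ' fun j hj => hδ' j (Nat.lt_succ_of_lt hj)
      exact ⟨h1.1.trans h2.1, h1.2.trans h2.2⟩
    · have h1 := hv.cost
      have h2 := ih.cost
      rw [Finset.sum_range_succ, Finset.sum_range_succ,
        Finset.sum_congr rfl fun j hj => fullPot_congr (hold j (Finset.mem_range.1 hj))]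
      rw [fullPot_congr hag] at h1
      have h3 : M₁.steps = x.2.steps + 6 := rfl
      omega

/-- Specification of an evaluation of `νY_p. μX_p. …` below `δ` for `S_δ = S` at cost `e`. -/
structure PairSpec (e d : ℕ) (δ : Prefix k) (p : Fin (k + 1)) (S : Set V) (M : Memory V k)
    (r : Set V × Memory V k) : Prop where
  val : r.1 = pairFix 𝒢 ℛ d (δ.map Prod.fst) p S
  limit : r.2.limit δ p = pairFix 𝒢 ℛ d (δ.map Prod.fst) p S
  done : PairDone 𝒢 ℛ d δ p S (pairFix 𝒢 ℛ d (δ.map Prod.fst) p S) r.2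
  node_eq : ∀ δ', (∀ j, ¬ δ ++ [(p, j)] <+: δ') → r.2.node δ' = M.node δ'
  limit_eq : ∀ δ', (∀ j, ¬ δ ++ [(p, j)] <+: δ') → δ' ≠ δ → r.2.limit δ' = M.limit δ'
  limit_eq_self : ∀ q, q ≠ p → r.2.limit δ q = M.limit δ q
  cost : r.2.steps + pairPot d δ p r.2 ≤ M.steps + e + pairPot d δ p M

/-- The stored value stays above the greatest fixpoint and each round maps it into itself. Rounds
that shrink it are paid by the potential, so only the last one is charged. -/
theorem settle_spec {d : ℕ} {δ : Prefix k} {p : Fin (k + 1)} {S : Set V}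
    {child : Prefix k → Set V → Memory V k → Set V × Memory V k}
    (hchild : ∀ j S M, Ready 𝒢 ℛ d (δ ++ [(p, j)]) S M →
      EvalSpec 𝒢 ℛ d (δ ++ [(p, j)]) S M (child (δ ++ [(p, j)]) S M))
    (m : ℕ) (M : Memory V k) (hM : PairReady 𝒢 ℛ d δ p S M) (hm : (M.limit δ p).ncard < m) :
    PairSpec 𝒢 ℛ (7 * Fintype.card V + 1) d δ p S M
      (settle (fun Y => sweep 𝒢 ℛ child δ p (ℛ.safe (δ.map Prod.fst ++ [p])) S Y
        (Fintype.card V)) δ p m M) := by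
  induction m generalizing M with
  | zero => omega
  | succ m ih =>
    set Y := M.limit δ p with hY
    have hs := sweep_spec 𝒢 ℛ hchild (fun j hj => hM.node 𝒢 ℛ hj) (Fintype.card V) le_rfl
    rw [← hY] at hs
    set x := sweep 𝒢 ℛ child δ p (ℛ.safe (δ.map Prod.fst ++ [p])) S Y (Fintype.card V) M with hx
    have hval : x.1 = mu fun X => pairBody 𝒢 ℛ d (δ.map Prod.fst) p S Y X := by
      rw [hs.val, pairIter_card]
    have hle := hM.2.1
    rw [← hY, ← hval] at hle
    have hlim : x.2.limit δ = M.limit δ :=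
      (hs.frame δ fun j _ => not_child_prefix δ _).2
    have hxcost : x.2.steps + (pairPot d δ p x.2) ≤
        M.steps + 7 * Fintype.card V + pairPot d δ p M := by
      have := hs.cost
      simp only [pairPot, hlim]
      omega
    by_cases heq : x.1 = Y
    · have hr : settle (fun Y => sweep 𝒢 ℛ child δ p (ℛ.safe (δ.map Prod.fst ++ [p])) S Y
          (Fintype.card V)) δ p (m + 1) M = (x.1, x.2.payTest) := by
        simp only [settle, ← hY, ← hx, heq, if_true]
      -- A stable value is a post-fixpoint, hence below the greatest fixpoint; the other inclusion
      -- is part of the invariant.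
      have hfix : Y = pairFix 𝒢 ℛ d (δ.map Prod.fst) p S :=
        (subset_nu (by rw [← hval, heq])).antisymm hM.2.2
      have hag : ∀ δ, AgreeOn δ x.2 x.2.payTest := fun δ δ' _ => ⟨rfl, rfl⟩
      rw [hr]
      refine ⟨heq.trans hfix, ?_, ?_, ?_, ?_, ?_, ?_⟩
      · rw [← hfix, hY, ← hlim]; rfl
      · rw [← hfix]
        exact fun i hi => (hs.done i hi).congr 𝒢 ℛ (hag _)
      · exact fun δ' h => (hs.frame δ' fun j _ => h (j + 1)).1
      · exact fun δ' h _ => (hs.frame δ' fun j _ => h (j + 1)).2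
      · exact fun q _ => congrFun hlim q
      · rw [pairPot_congr (M := x.2) (M' := x.2.payTest) ⟨rfl, fun i => hag _⟩]
        have : x.2.payTest.steps = x.2.steps + 1 := rfl
        simp only [this]
        omega
    · set M₁ : Memory V k := { x.2.payTest with
        limit := Function.update x.2.limit δ (Function.update (x.2.limit δ) p x.1) } with hM₁
      have hr : settle (fun Y => sweep 𝒢 ℛ child δ p (ℛ.safe (δ.map Prod.fst ++ [p])) S Y
          (Fintype.card V)) δ p (m + 1) M =
          settle (fun Y => sweep 𝒢 ℛ child δ p (ℛ.safe (δ.map Prod.fst ++ [p])) S Y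
          (Fintype.card V)) δ p m M₁ := by
        simp only [settle, ← hY, ← hx, heq, if_false, hM₁]
        rfl
      have hl₁ : M₁.limit δ p = x.1 := by simp [hM₁]
      have hag : ∀ i, AgreeOn (δ ++ [(p, i)]) x.2 M₁ := by
        intro i δ' hδ'
        refine ⟨rfl, Function.update_of_ne ?_ _ _⟩
        rintro rfl
        exact not_child_prefix _ _ hδ'
      have hlt : x.1.ncard < Y.ncard :=
        Set.ncard_lt_ncard (Set.ssubset_iff_subset_ne.2 ⟨hle, heq⟩) (Set.toFinite _)
      have hready : PairReady 𝒢 ℛ d δ p S M₁ := by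
        unfold PairReady
        rw [hl₁]
        -- The finished round was for the larger value `Y`, which is what the next round may start
        -- from.
        refine ⟨Or.inr ⟨S, Y, subset_rfl, hle, fun i hi => (hs.done i hi).congr 𝒢 ℛ (hag _)⟩,
          ?_, ?_⟩
        · conv_rhs => rw [hval]
          exact mu_pairBody_monotone 𝒢 ℛ d _ p S hle
        · rw [hval, ← pairFix_eq_mu]
          exact mu_pairBody_monotone 𝒢 ℛ d _ p S hM.2.2
      have h := ih M₁ hready (by rw [hl₁]; omega)
      rw [hr]
      refine ⟨h.val, h.limit, h.done, ?_, ?_, ?_, ?_⟩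
      · exact fun δ' hδ' => (h.node_eq δ' hδ').trans (hs.frame δ' fun j _ => hδ' (j + 1)).1
      · intro δ' hδ' hne
        rw [h.limit_eq δ' hδ' hne, ← (hs.frame δ' fun j _ => hδ' (j + 1)).2]
        exact Function.update_of_ne hne _ _
      · intro q hq
        rw [h.limit_eq_self q hq, ← congrFun hlim q]
        simp [hM₁, Function.update_of_ne hq]
      · have h1 := h.cost
        have h2 : M₁.steps = x.2.steps + 1 := rfl
        -- The vertex lost by the limit releases the price of the round.
        have h3 : pairPot d δ p M₁ + (7 * Fintype.card V + 1) ≤ pairPot d δ p x.2 := by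
          simp only [pairPot, hl₁, hlim, ← hY,
            Finset.sum_congr rfl fun i _ => fullPot_congr (d := d) (hag (i + 1))]
          have : (7 * Fintype.card V + 1) * (x.1.ncard + 1) ≤
            (7 * Fintype.card V + 1) * Y.ncard := Nat.mul_le_mul_left _ hlt
          rw [mul_add, mul_one] at this
          omega
        omega

theorem evalPair_spec {d : ℕ} {δ : Prefix k} {p : Fin (k + 1)} {S : Set V} {M : Memory V k}
    {child : Prefix k → Set V → Set V → Memory V k → Set V × Memory V k}
    (hchild : ∀ j S M, Ready 𝒢 ℛ d (δ ++ [(p, j)]) S M → EvalSpec 𝒢 ℛ d (δ ++ [(p, j)]) S M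
      (child (δ ++ [(p, j)]) (ℛ.safe (δ.map Prod.fst ++ [p])) S M))
    (hM : PairReady 𝒢 ℛ d δ p S M) :
    PairSpec 𝒢 ℛ (7 * Fintype.card V + 2) d δ p S M
      (evalPair 𝒢 ℛ child δ (ℛ.safe (δ.map Prod.fst)) S p M) := by
  set M₁ : Memory V k := { M with steps := M.steps + 1 } with hM₁
  have hag : AgreePair δ p M M₁ := ⟨rfl, fun _ _ _ => ⟨rfl, rfl⟩⟩
  have hr : evalPair 𝒢 ℛ child δ (ℛ.safe (δ.map Prod.fst)) S p M =
      settle (fun Y => sweep 𝒢 ℛ (fun δ' => child δ' (ℛ.safe (δ.map Prod.fst ++ [p]))) δ p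
        (ℛ.safe (δ.map Prod.fst ++ [p])) S Y (Fintype.card V)) δ p (Fintype.card V + 1) M₁ := by
    simp only [evalPair, Memory.compute, SymTerm.eval, SymTerm.ops, safe_append, hM₁]
  have h := settle_spec 𝒢 ℛ
    (child := fun δ' => child δ' (ℛ.safe (δ.map Prod.fst ++ [p]))) hchild
    (Fintype.card V + 1) M₁ (hM.congr 𝒢 ℛ hag) (by
    have := Set.ncard_le_card (M₁.limit δ p)
    rw [Nat.card_eq_fintype_card] at this
    omega)
  rw [hr]
  refine ⟨h.val, h.limit, h.done, h.node_eq, h.limit_eq, h.limit_eq_self, ?_⟩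
  have h1 := h.cost
  rw [pairPot_congr hag] at h1
  have h2 : M₁.steps = M.steps + 1 := rfl
  omega

/-- Pairs with different indices do not touch each other's memory. Each is charged 7n + 2 (last
round, its stability test, the intersection for `Q`) and one union. -/
theorem foldl_spec {d : ℕ} {δ : Prefix k} {S : Set V}
    {pairEval : Fin (k + 1) → Memory V k → Set V × Memory V k}
    (l : List (Fin (k + 1))) (hl : l.Nodup)
    (hpair : ∀ p ∈ l, ∀ M, PairReady 𝒢 ℛ d δ p S M →
      PairSpec 𝒢 ℛ (7 * Fintype.card V + 2) d δ p S M (pairEval p M))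
    (A : Set V) (M : Memory V k) (hM : ∀ p ∈ l, PairReady 𝒢 ℛ d δ p S M)
    (r : Set V × Memory V k)
    (hr : r = l.foldl (fun x p =>
      let y := pairEval p x.2
      y.2.compute 𝒢 (.union (.set x.1) (.set y.1))) (A, M)) :
    (r.1 = A ∪ ⋃ p ∈ l, pairFix 𝒢 ℛ d (δ.map Prod.fst) p S) ∧
    (∀ p ∈ l, r.2.limit δ p = pairFix 𝒢 ℛ d (δ.map Prod.fst) p S ∧
      PairDone 𝒢 ℛ d δ p S (pairFix 𝒢 ℛ d (δ.map Prod.fst) p S) r.2) ∧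
    (∀ δ', (∀ p ∈ l, ∀ j, ¬ δ ++ [(p, j)] <+: δ') → r.2.node δ' = M.node δ' ∧
      (δ' ≠ δ → r.2.limit δ' = M.limit δ')) ∧
    (∀ q, q ∉ l → r.2.limit δ q = M.limit δ q) ∧
    r.2.steps + (l.map fun p => pairPot d δ p r.2).sum ≤
      M.steps + l.length * (7 * Fintype.card V + 3) + (l.map fun p => pairPot d δ p M).sum := by
  induction l generalizing A M with
  | nil => subst hr; simp
  | cons p l ih =>
    have hp := hpair p List.mem_cons_self M (hM p List.mem_cons_self)
    have hpl : p ∉ l := (List.nodup_cons.1 hl).1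
    set y := pairEval p M with hy
    set M₁ : Memory V k := { y.2 with steps := y.2.steps + 1 } with hM₁
    rw [List.foldl_cons] at hr
    have hag : ∀ q ∈ l, AgreePair δ q M M₁ := by
      intro q hq
      have hne : q ≠ p := fun h => hpl (h ▸ hq)
      refine ⟨hp.limit_eq_self q hne, fun i δ' hδ' => ?_⟩
      have hδ : ∀ j, ¬ δ ++ [(p, j)] <+: δ' := fun j =>
        not_prefix_sibling (fun h => hne (congrArg Prod.fst h)) hδ'
      refine ⟨hp.node_eq δ' hδ, hp.limit_eq δ' hδ ?_⟩
      rintro rfl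
      exact not_child_prefix _ _ hδ'
    obtain ⟨h1, h2, h3, h4, h5⟩ := ih (List.nodup_cons.1 hl).2
      (fun q hq => hpair q (List.mem_cons_of_mem p hq)) (A ∪ y.1) M₁
      (fun q hq => (hM q (List.mem_cons_of_mem p hq)).congr 𝒢 ℛ (hag q hq)) hr
    have hag' : AgreePair δ p y.2 r.2 := by
      refine ⟨h4 p hpl, fun i δ' hδ' => ?_⟩
      have := h3 δ' fun q hq j => not_prefix_sibling (q := (p, i)) (q' := (q, j))
        (fun h => hpl (by rwa [show p = q from congrArg Prod.fst h])) hδ'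
      refine ⟨this.1, this.2 ?_⟩
      rintro rfl
      exact not_child_prefix _ _ hδ'
    refine ⟨?_, ?_, ?_, ?_, ?_⟩
    · rw [h1, hp.val, Set.union_assoc]
      congr 1
      ext v
      simp
    · intro q hq
      rcases List.mem_cons.1 hq with rfl | hq
      · exact ⟨hag'.1.trans hp.limit, fun i hi => (hp.done i hi).congr 𝒢 ℛ (hag'.2 _)⟩
      · exact h2 q hq
    · intro δ' hδ'
      have h6 := h3 δ' fun q hq => hδ' q (List.mem_cons_of_mem p hq)
      have h7 := hδ' p List.mem_cons_self
      exact ⟨h6.1.trans (hp.node_eq δ' h7), fun hne => (h6.2 hne).trans (hp.limit_eq δ' h7 hne)⟩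
    · intro q hq
      rw [List.mem_cons, not_or] at hq
      exact (h4 q hq.2).trans (hp.limit_eq_self q hq.1)
    · have h6 := hp.cost
      have h7 : M₁.steps = y.2.steps + 1 := rfl
      have h8 : (l.map fun q => pairPot d δ q M₁) = l.map fun q => pairPot d δ q M :=
        List.map_congr_left fun q hq => pairPot_congr (hag q hq)
      rw [h8] at h5
      simp only [List.map_cons, List.sum_cons, List.length_cons, add_mul, one_mul,
        pairPot_congr hag'] at h5 ⊢
      omega

theorem evalNode_spec (d : ℕ) (δ : Prefix k) (S : Set V) (M : Memory V k)
    (hd : (remaining (δ.map Prod.fst)).length = d) (hM : Ready 𝒢 ℛ d δ S M) :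
    EvalSpec 𝒢 ℛ d δ S M (evalNode 𝒢 ℛ d δ (ℛ.safe (δ.map Prod.fst)) S M) := by
  induction d generalizing δ S M with
  | zero =>
    exact ⟨rfl, trivial, fun _ _ => rfl, fun _ _ => rfl, by simp [evalNode, evalCost]⟩
  | succ d ih =>
    have hpair : ∀ p ∈ remaining (δ.map Prod.fst), ∀ M, PairReady 𝒢 ℛ d δ p S M →
        PairSpec 𝒢 ℛ (7 * Fintype.card V + 2) d δ p S M
          (evalPair 𝒢 ℛ (evalNode 𝒢 ℛ d) δ (ℛ.safe (δ.map Prod.fst)) S p M) := by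
      intro p hp M hM
      refine evalPair_spec 𝒢 ℛ (fun j S M h => ?_) hM
      have hm : (δ ++ [(p, j)]).map Prod.fst = δ.map Prod.fst ++ [p] := by simp
      rw [← hm]
      refine ih _ S M ?_ h
      have := length_remaining_append (mem_remaining.1 hp)
      rw [hm]
      omega
    obtain ⟨h1, h2, h3, h4, h5⟩ := foldl_spec 𝒢 ℛ (remaining (δ.map Prod.fst))
      (remaining_nodup _) hpair ∅ M (fun p hp => hM.pair 𝒢 ℛ (mem_remaining.1 hp))
      (evalNode 𝒢 ℛ (d + 1) δ (ℛ.safe (δ.map Prod.fst)) S M) rfl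
    refine ⟨?_, fun p hp => h2 p (mem_remaining.2 hp), ?_, ?_, ?_⟩
    · rw [h1, Set.empty_union, layers_succ]
      simp only [mem_remaining]
    · intro δ' hδ'
      refine (h3 δ' fun p _ j h => ?_).1
      rcases hδ' with hδ' | rfl
      · exact hδ' ((List.prefix_append _ _).trans h)
      · exact not_child_prefix _ _ h
    · intro δ' hδ'
      refine (h3 δ' fun p _ j h => hδ' ((List.prefix_append _ _).trans h)).2 ?_
      rintro rfl
      exact hδ' List.prefix_rfl
    · rw [hd] at h5
      exact h5

end Evaluation

theorem Prefix.Valid.init {n : ℕ} {δ : Prefix k} {q q' : Fin (k + 1) × ℕ}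
    (h : Prefix.Valid n (δ ++ [q] ++ [q'])) : Prefix.Valid n (δ ++ [q]) := by
  obtain ⟨h1, h2, h3⟩ := h
  refine ⟨?_, ?_, fun x hx => h3 x (List.mem_append_left _ hx)⟩
  · rw [← h1]
    cases δ <;> rfl
  · rw [List.map_append] at h2
    exact h2.of_append_left

/-! ### The whole run: final memory and number of steps -/

section Algorithm
variable [Fintype V] (𝒢 : GameGraph V) (ℛ : RabinCondition V k)

theorem fixpointAlgorithm_spec : PairSpec 𝒢 ℛ (7 * Fintype.card V + 2) k [] 0 ∅ Memory.init
    (fixpointAlgorithm 𝒢 ℛ) := by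
  have hs : (Set.univ : Set V) = ℛ.safe (([] : Prefix k).map Prod.fst) := by
    ext v; simp [RabinCondition.safe]
  rw [fixpointAlgorithm, hs]
  have hrem : (remaining ([] : List (Fin (k + 1)))).length = k + 1 := by simp [remaining]
  refine evalPair_spec 𝒢 ℛ (fun j S M h => evalNode_spec 𝒢 ℛ k [(0, j)] S M ?_ h) ?_
  · have := length_remaining_append (I := []) (p := (0 : Fin (k + 1))) (by simp)
    simp only [List.nil_append] at this
    simp only [List.map_cons, List.map_nil]
    omega
  · exact ⟨Or.inl fun i => ⟨rfl, fun δ' _ => ⟨fun _ => rfl, fun _ => rfl⟩⟩,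
      Set.subset_univ _, Set.subset_univ _⟩

theorem fixpointAlgorithm_val : (fixpointAlgorithm 𝒢 ℛ).1 = rabinFixpoint 𝒢 ℛ := by
  rw [(fixpointAlgorithm_spec 𝒢 ℛ).val, rabinFixpoint_eq]; rfl

/-- A finished node guarantees finished children for the limit values of its `Y` variables, which
are the values used in the definition of `S_δ`. So the property descends from the root along the
prefix. -/
theorem fixpointAlgorithm_nodeDone (δ : Prefix k) (p : Fin (k + 1)) (i : ℕ)
    (h : Prefix.Valid (Fintype.card V) (δ ++ [(p, i)])) :
    NodeDone 𝒢 ℛ (k - δ.length) (δ ++ [(p, i)]) (prefixSet 𝒢 ℛ (δ ++ [(p, i)]))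
      (fixpointAlgorithm 𝒢 ℛ).2 := by
  induction δ using List.reverseRecOn generalizing p i with
  | nil =>
    obtain ⟨h1, -, h3⟩ := h
    have hp : p = 0 := by simpa using h1
    obtain ⟨h4, h5⟩ := h3 (p, i) (by simp)
    obtain ⟨i, rfl⟩ : ∃ i', i = i' + 1 := ⟨i - 1, by simp only at h4; omega⟩
    subst hp
    have := (fixpointAlgorithm_spec 𝒢 ℛ).done i (by simp only at h5; omega)
    have hS : prefixSet 𝒢 ℛ ([] ++ [(0, i + 1)]) =
        nodeSet 𝒢 ℛ k [] 0 ∅ (pairFix 𝒢 ℛ k [] 0 ∅) i := by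
      rw [prefixSet_append, prefixIter, prefixFix, prefixSet_nil]; rfl
    rw [hS]
    exact this
  | append_singleton δ q ih =>
    have hn := ih q.1 q.2 h.init
    have hlen : (δ ++ [(q.1, q.2)]).length + 1 ≤ k + 1 := by
      have := h.2.1.length_le_card
      simpa using this
    have hd : k - δ.length = (k - (δ ++ [q]).length) + 1 := by
      simp at hlen ⊢; omega
    have hp : p ∉ (δ ++ [q]).map Prod.fst := by
      have h2 := h.2.1
      rw [List.map_append, List.nodup_append] at h2
      intro hp
      exact h2.2.2 p hp p (by simp) rfl
    rw [hd] at hn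
    obtain ⟨h4, h5⟩ := h.2.2 (p, i) (by simp)
    obtain ⟨i, rfl⟩ : ∃ i', i = i' + 1 := ⟨i - 1, by simp only at h4; omega⟩
    have := ((done_succ 𝒢 ℛ).1 hn.2 p hp).2 i (by simp only at h5; omega)
    rw [prefixSet_append]
    exact this

theorem fixpointAlgorithm_node (δ : Prefix k) (p : Fin (k + 1)) (i : ℕ)
    (h : Prefix.Valid (Fintype.card V) (δ ++ [(p, i)])) :
    (fixpointAlgorithm 𝒢 ℛ).2.node (δ ++ [(p, i)]) =
      some (prefixSet 𝒢 ℛ (δ ++ [(p, i)]), iterX 𝒢 ℛ (context 𝒢 ℛ δ) p i) := by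
  rw [(fixpointAlgorithm_nodeDone 𝒢 ℛ δ p i h).1, iterX_context]
  obtain ⟨h4, -⟩ := h.2.2 (p, i) (by simp)
  obtain ⟨i, rfl⟩ : ∃ i', i = i' + 1 := ⟨i - 1, by simp only at h4; omega⟩
  rw [prefixIter_succ, List.map_append]
  rfl

variable (V) in
/-- The potential of the initial state below a node with `d` layers. -/
def initialPotential : ℕ → ℕ
  | 0 => 0
  | d + 1 => (d + 1) * ((7 * Fintype.card V + 1) * Fintype.card V + Fintype.card V *
      ((Fintype.card V + 1) * evalCost V d + initialPotential d))

theorem pairPot_init (d : ℕ) (δ : Prefix k) (p : Fin (k + 1)) (B : ℕ)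
    (h : ∀ i, potential d (δ ++ [(p, i)]) (Memory.init : Memory V k) = B) :
    pairPot d δ p (Memory.init : Memory V k) =
      (7 * Fintype.card V + 1) * Fintype.card V + Fintype.card V *
      ((Fintype.card V + 1) * evalCost V d + B) := by
  have hl : (Memory.init : Memory V k).limit δ p = Set.univ := rfl
  have hn : ∀ δ', (Memory.init : Memory V k).node δ' = none := fun _ => rfl
  simp [pairPot, fullPot, h, hl, hn, nodePot, Set.ncard_univ, Nat.card_eq_fintype_card]

theorem potential_init (d : ℕ) (δ : Prefix k) (hd : (remaining (δ.map Prod.fst)).length = d) :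
    potential d δ (Memory.init : Memory V k) = initialPotential V d := by
  induction d generalizing δ with
  | zero => rfl
  | succ d ih =>
    rw [potential_succ, initialPotential, List.map_congr_left (g := fun _ =>
      (7 * Fintype.card V + 1) * Fintype.card V + Fintype.card V *
      ((Fintype.card V + 1) * evalCost V d + initialPotential V d)), List.map_const',
      List.sum_replicate, hd, smul_eq_mul]
    intro p hp
    refine pairPot_init d δ p _ fun i => ih _ ?_
    have := length_remaining_append (mem_remaining.1 hp)
    rw [List.map_append]
    simp only [List.map_cons, List.map_nil]
    omega

theorem evalCost_bound [Nonempty V] (d : ℕ) :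
    Fintype.card V * ((Fintype.card V + 1) * evalCost V d) ≤ 20 * (d * Fintype.card V ^ 3) := by
  have hn : 1 ≤ Fintype.card V := Fintype.card_pos
  unfold evalCost
  generalize Fintype.card V = n at hn ⊢
  calc n * ((n + 1) * (d * (7 * n + 3))) ≤ n * ((2 * n) * (d * (10 * n))) := by
        gcongr <;> omega
    _ = 20 * (d * n ^ 3) := by ring

/-- The recursion adds at most (8 + 20)·d·n^(d+2) to n·T(d) before multiplying by d + 1. The extra
summand 28d + 56 on the left makes the induction absorb this: 28d pays for the addition, and the
remaining 56(d + 1) covers the next slack. -/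
theorem initialPotential_bound [Nonempty V] (d : ℕ) :
    initialPotential V d + (28 * d + 56) * Fintype.card V ^ (d + 1) ≤
      92 * (d.factorial * Fintype.card V ^ (d + 1)) := by
  have hn : 1 ≤ Fintype.card V := Fintype.card_pos
  induction d with
  | zero => simp [initialPotential]; omega
  | succ d ih =>
    have hE := evalCost_bound (V := V) d
    rw [initialPotential, mul_add (Fintype.card V)]
    -- The passage from 0 to 1 determines the constant: 8 + 84 = 92. For d ≥ 1, 28(d + 1) + 56 ≤
    -- 56(d + 1).
    rcases Nat.eq_zero_or_pos d with rfl | hd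
    · simp only [initialPotential, evalCost, zero_mul, mul_zero, Nat.factorial, Nat.succ_eq_add_one,
        zero_add, one_mul, mul_one, add_zero, one_add_one_eq_two]
      nlinarith
    set n := Fintype.card V with hn'
    set e := n * ((n + 1) * evalCost V d)
    set B := initialPotential V d
    have h1 : (7 * n + 1) * n ≤ 8 * (d * n ^ (d + 2)) := by
      have h3 : n ^ 2 ≤ n ^ (d + 2) := Nat.pow_le_pow_right hn (by omega)
      have h4 : 1 * n ^ (d + 2) ≤ d * n ^ (d + 2) := Nat.mul_le_mul_right _ hd
      nlinarith
    have h2 : d * n ^ 3 ≤ d * n ^ (d + 2) :=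
      Nat.mul_le_mul_left _ (Nat.pow_le_pow_right hn (by omega))
    have h3 : n * B + (28 * d + 56) * n ^ (d + 2) ≤ 92 * (d.factorial * n ^ (d + 2)) := by
      calc n * B + (28 * d + 56) * n ^ (d + 2) = n * (B + (28 * d + 56) * n ^ (d + 1)) := by ring
        _ ≤ n * (92 * (d.factorial * n ^ (d + 1))) := Nat.mul_le_mul_left _ ih
        _ = _ := by ring
    have h4 : (7 * n + 1) * n + (e + n * B) + 56 * n ^ (d + 2) ≤
        92 * (d.factorial * n ^ (d + 2)) := by
      rw [add_mul, mul_assoc] at h3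
      omega
    have h5 : (d + 1) * ((7 * n + 1) * n + (e + n * B) + 56 * n ^ (d + 2)) ≤
        92 * ((d + 1).factorial * n ^ (d + 2)) := by
      calc _ ≤ (d + 1) * (92 * (d.factorial * n ^ (d + 2))) := Nat.mul_le_mul_left _ h4
        _ = _ := by rw [Nat.factorial_succ]; ring
    have h6 : (28 * (d + 1) + 56) * n ^ (d + 2) ≤ (d + 1) * (56 * n ^ (d + 2)) := by
      rw [← mul_assoc]
      exact Nat.mul_le_mul_right _ (by omega)
    rw [mul_add] at h5
    exact (Nat.add_le_add_left h6 _).trans h5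

/-- 129 = 8 + 20 + 92 + 9: the rounds at the root, the evaluations of its n children, the potential
below them, and the fixed cost 7n + 2. -/
theorem fixpointAlgorithm_steps [Nonempty V] : (fixpointAlgorithm 𝒢 ℛ).2.steps ≤
    129 * (Fintype.card V ^ (k + 2) * k.factorial) := by
  have hn : 1 ≤ Fintype.card V := Fintype.card_pos
  have hc := (fixpointAlgorithm_spec 𝒢 ℛ).cost
  rw [pairPot_init k [] 0 (initialPotential V k) (fun i => potential_init k _ (by
    have := length_remaining_append (I := []) (p := (0 : Fin (k + 1))) (by simp)
    have h0 : (remaining ([] : List (Fin (k + 1)))).length = k + 1 := by simp [remaining]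
    simp only [List.nil_append, List.map_cons, List.map_nil] at this ⊢
    omega)), mul_add (Fintype.card V)] at hc
  have hE := evalCost_bound (V := V) k
  have hB := Nat.mul_le_mul_left (Fintype.card V)
    ((Nat.le_add_right _ _).trans (initialPotential_bound (V := V) k))
  have hi : (Memory.init : Memory V k).steps = 0 := rfl
  rw [hi] at hc
  set n := Fintype.card V
  set P := n ^ (k + 2) with hP
  have h1 : n ≤ P := by
    calc n = n ^ 1 := (pow_one n).symm
      _ ≤ _ := Nat.pow_le_pow_right hn (by omega)
  have h2 : n ^ 2 ≤ P := Nat.pow_le_pow_right hn (by omega)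
  have hf : 1 ≤ k.factorial := Nat.factorial_pos k
  have h3 : P * 1 ≤ P * k.factorial := Nat.mul_le_mul_left _ hf
  have h4 : k * n ^ 3 ≤ P * k.factorial := by
    rcases Nat.eq_zero_or_pos k with h | h
    · simp [h]
    · calc k * n ^ 3 ≤ k.factorial * P :=
            Nat.mul_le_mul (Nat.self_le_factorial k) (Nat.pow_le_pow_right hn (by omega))
        _ = _ := mul_comm _ _
  have h5 : n * (92 * (k.factorial * n ^ (k + 1))) = 92 * (P * k.factorial) := by
    rw [hP]; ring
  rw [h5] at hB
  have h6 : (7 * n + 1) * n ≤ 8 * P := by nlinarith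
  omega

end Algorithm

/-! ### Truncated configurations -/

/-- The prefix `p₀ i₀ ⋯ p_k i_k`. -/
def Config.toPrefix (d : Config k) : Prefix k := List.ofFn fun b => (d.idx b, d.ctr b)

theorem Config.exists_toPrefix_eq (δ : Prefix k) (h : δ.length = k + 1) :
    ∃ d : Config k, d.toPrefix = δ := by
  refine ⟨toLex fun b => toLex (δ.get (b.cast h.symm)), ?_⟩
  refine List.ext_getElem (by simp [Config.toPrefix, h]) fun i h1 h2 => ?_
  simp only [Config.toPrefix, List.getElem_ofFn]
  rfl

theorem Config.eq_of_prefix {d : Config k} {δ : Prefix k} (h : δ <+: d.toPrefix)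
    (b : Fin (k + 1)) (hb : b < δ.length) : ofLex d b = toLex δ[(b : ℕ)] := by
  rw [h.getElem hb]
  simp only [Config.toPrefix, List.getElem_ofFn]
  rfl

/-- Keep the entries before position `m`, and what `g` leaves of the entry at `m`. -/
def Config.trunc (m : Fin (k + 1)) (g : Fin (k + 1) ×ₗ ℕ → Fin (k + 1) ×ₗ ℕ) (d : Config k) :
    Config k :=
  toLex fun b => if b < m then ofLex d b else if b = m then g (ofLex d b) else toLex (0, 0)

/-- According to the first difference: before m it survives, at m it is subject to `g`, and after m
it is erased. -/
theorem Config.trunc_mono (m : Fin (k + 1)) {g : Fin (k + 1) ×ₗ ℕ → Fin (k + 1) ×ₗ ℕ}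
    (hg : Monotone g) : Monotone (Config.trunc m g) := by
  intro d d' h
  rcases h.eq_or_lt with rfl | ⟨c, hc, hlt⟩
  · exact le_rfl
  rcases lt_trichotomy c m with hcm | rfl | hcm
  · refine le_of_lt ⟨c, fun b hb => ?_, ?_⟩
    · simp only [Config.trunc, Pi.toLex_apply, if_pos (hb.trans hcm)]
      exact hc b hb
    · simp only [Config.trunc, Pi.toLex_apply, if_pos hcm]
      exact hlt
  · rcases (hg hlt.le).eq_or_lt with he | hl
    · refine le_of_eq (congrArg toLex (funext fun b => ?_))
      by_cases hb : b < c
      · simp only [if_pos hb]; exact hc b hb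
      · by_cases hb' : b = c
        · subst hb'; simp only [lt_irrefl, if_false, if_true]; exact he
        · simp only [if_neg hb, if_neg hb']
    · refine le_of_lt ⟨c, fun b hb => ?_, ?_⟩
      · simp only [Config.trunc, Pi.toLex_apply, if_pos hb]
        exact hc b hb
      · simp only [Config.trunc, Pi.toLex_apply, lt_irrefl, if_false, if_true]
        exact hl
  · refine le_of_eq (congrArg toLex (funext fun b => ?_))
    by_cases hb : b < m
    · simp only [if_pos hb]; exact hc b (hb.trans hcm)
    · by_cases hb' : b = m
      · subst hb'; simp only [lt_irrefl, if_false, if_true]; exact congrArg g (hc b hcm)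
      · simp only [if_neg hb, if_neg hb']

/-- Keep `p₀ i₀ ⋯ p_m i_m`. -/
def Config.upto (m : Fin (k + 1)) : Config k → Config k := Config.trunc m id

/-- Keep `p₀ i₀ ⋯ p_m`. -/
def Config.uptoIdx (m : Fin (k + 1)) : Config k → Config k :=
  Config.trunc m fun x => toLex ((ofLex x).1, 0)

theorem Config.upto_mono (m : Fin (k + 1)) : Monotone (Config.upto m) :=
  Config.trunc_mono m monotone_id

theorem Config.uptoIdx_mono (m : Fin (k + 1)) : Monotone (Config.uptoIdx m) := by
  refine Config.trunc_mono m fun x y h => ?_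
  rw [Prod.Lex.le_iff] at h ⊢
  rcases h with h | ⟨h, -⟩
  · exact Or.inl h
  · exact Or.inr ⟨h, le_rfl⟩

theorem Config.upto_uptoIdx {m b : Fin (k + 1)} (h : m < b) (d : Config k) :
    (d.uptoIdx b).upto m = d.upto m := by
  refine congrArg toLex (funext fun c => ?_)
  simp only [Config.uptoIdx, Config.trunc, ofLex_toLex, id]
  split_ifs <;> first | rfl | (exfalso; omega)

theorem Config.uptoIdx_uptoIdx {m b : Fin (k + 1)} (h : m ≤ b) (d : Config k) :
    (d.uptoIdx b).uptoIdx m = d.uptoIdx m := by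
  refine congrArg toLex (funext fun c => ?_)
  simp only [Config.uptoIdx, Config.trunc, ofLex_toLex]
  split_ifs <;> first | rfl | (exfalso; omega)

theorem Config.idx_eq_of_uptoIdx_eq {m : Fin (k + 1)} {d d' : Config k}
    (h : d.uptoIdx m = d'.uptoIdx m) : d.idx m = d'.idx m := by
  have := congrArg (fun e : Config k => (ofLex (ofLex e m)).1) h
  simpa [Config.uptoIdx, Config.trunc, Config.idx] using this

theorem Config.uptoIdx_eq_of_prefix {δ : Prefix k} {p : Fin (k + 1)} {i i' : ℕ}
    {d d' : Config k} (h : δ ++ [(p, i)] <+: d.toPrefix) (h' : δ ++ [(p, i')] <+: d'.toPrefix)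
    (b : Fin (k + 1)) (hb : b = δ.length) : d.uptoIdx b = d'.uptoIdx b := by
  refine congrArg toLex (funext fun c => ?_)
  rcases lt_trichotomy c b with hc | rfl | hc
  · have hc' : (c : ℕ) < δ.length := by rw [← hb]; exact hc
    simp only [if_pos hc]
    rw [Config.eq_of_prefix ((List.prefix_append _ _).trans h) c hc',
      Config.eq_of_prefix ((List.prefix_append _ _).trans h') c hc']
  · simp only [lt_irrefl, if_false, if_true]
    rw [Config.eq_of_prefix h c (by simp [hb]), Config.eq_of_prefix h' c (by simp [hb])]
    simp [hb]
  · simp only [if_neg hc.not_gt, if_neg hc.ne']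

theorem Config.upto_lt_of_prefix {δ : Prefix k} {p : Fin (k + 1)} {i i' : ℕ} (hi : i < i')
    {d d' : Config k} (h : δ ++ [(p, i)] <+: d.toPrefix) (h' : δ ++ [(p, i')] <+: d'.toPrefix)
    (b : Fin (k + 1)) (hb : b = δ.length) : d.upto b < d'.upto b := by
  refine ⟨b, fun c hc => ?_, ?_⟩
  · have hc' : (c : ℕ) < δ.length := by rw [← hb]; exact hc
    simp only [Config.upto, Config.trunc, Pi.toLex_apply, if_pos hc]
    rw [Config.eq_of_prefix ((List.prefix_append _ _).trans h) c hc',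
      Config.eq_of_prefix ((List.prefix_append _ _).trans h') c hc']
  · simp only [Config.upto, Config.trunc, Pi.toLex_apply, lt_irrefl, if_false, if_true, id]
    rw [Config.eq_of_prefix h b (by simp [hb]), Config.eq_of_prefix h' b (by simp [hb]),
      Prod.Lex.lt_iff]
    simp [hb, hi]

/-! ### Ranks -/

theorem length_remaining {I : List (Fin (k + 1))} (h : I.Nodup) :
    (remaining I).length + I.length = k + 1 := by
  induction I using List.reverseRecOn with
  | nil => simp [remaining]
  | append_singleton I p ih =>
    rw [List.nodup_append] at h
    have hp : p ∉ I := fun hp => h.2.2 p hp p (by simp) rfl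
    have h1 := length_remaining_append hp
    have h2 := ih h.1
    simp only [List.length_append, List.length_cons, List.length_nil]
    omega

theorem Prefix.Valid.length_le {n : ℕ} {δ : Prefix k} (h : Prefix.Valid n δ) :
    δ.length ≤ k + 1 := by
  have := length_remaining h.2.1
  rw [List.length_map] at this
  omega

theorem Prefix.Valid.append {n : ℕ} {δ : Prefix k} (h : Prefix.Valid n δ) {p : Fin (k + 1)}
    (hp : p ∉ δ.map Prod.fst) {i : ℕ} (h1 : 1 ≤ i) (h2 : i ≤ n) :
    Prefix.Valid n (δ ++ [(p, i)]) := by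
  obtain ⟨ha, hb, hc⟩ := h
  refine ⟨?_, ?_, ?_⟩
  · cases δ with
    | nil => simp at ha
    | cons q δ => exact ha
  · rw [List.map_append]
    refine List.nodup_append.2 ⟨hb, by simp, ?_⟩
    rintro q hq _ hq' rfl
    exact hp ((List.mem_singleton.1 hq' : q = p) ▸ hq)
  · intro q hq
    rcases List.mem_append.1 hq with hq | hq
    · exact hc q hq
    · rw [List.mem_singleton.1 hq]; exact ⟨h1, h2⟩

theorem Prefix.Valid.replace {n : ℕ} {δ : Prefix k} {p : Fin (k + 1)} {i i' : ℕ}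
    (h : Prefix.Valid n (δ ++ [(p, i)])) (h1 : 1 ≤ i') (h2 : i' ≤ n) :
    Prefix.Valid n (δ ++ [(p, i')]) := by
  obtain ⟨ha, hb, hc⟩ := h
  refine ⟨?_, ?_, ?_⟩
  · cases δ <;> exact ha
  · simpa using hb
  · intro q hq
    rcases List.mem_append.1 hq with hq | hq
    · exact hc q (List.mem_append_left _ hq)
    · rw [List.mem_singleton.1 hq]; exact ⟨h1, h2⟩

theorem Prefix.Valid.of_prefix {n : ℕ} {δ δ' : Prefix k} (h : Prefix.Valid n δ') (hne : δ ≠ [])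
    (hδ : δ <+: δ') : Prefix.Valid n δ := by
  obtain ⟨l, rfl⟩ := hδ
  obtain ⟨ha, hb, hc⟩ := h
  refine ⟨?_, ?_, fun q hq => hc q (List.mem_append_left _ hq)⟩
  · cases δ with
    | nil => exact absurd rfl hne
    | cons q δ => exact ha
  · rw [List.map_append] at hb
    exact hb.of_append_left

section Rank
variable (𝒢 : GameGraph V) (ℛ : RabinCondition V k)

/-- Each layer preserves `S` because `S` is a post-fixpoint. The count `hd` supplies an unbound
index; with none left, a union over the indices would be empty. -/
theorem subset_layers (d : ℕ) (I : List (Fin (k + 1))) (hd : (remaining I).length = d)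
    (S : Set V) : S ⊆ layers 𝒢 ℛ d I S := by
  induction d generalizing I S with
  | zero => exact subset_rfl
  | succ d ih =>
    obtain ⟨p, hp⟩ := List.exists_mem_of_length_pos (l := remaining I) (by omega)
    have hp := mem_remaining.1 hp
    intro v hv
    refine (mem_layers_succ 𝒢 ℛ).2 ⟨p, hp, ?_⟩
    refine subset_nu (Y := S) ?_ hv
    have hlen := length_remaining_append hp
    refine Set.Subset.trans ?_ (mu_fixed (pairBody_monotone 𝒢 ℛ d I p S S)).subset
    exact Set.subset_union_left.trans (ih (I ++ [p]) (by omega) _)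

/-- Every vertex in `S_δ` belongs to one of the sets `𝒞` along `δ`. -/
theorem exists_of_mem_prefixSet {δ : Prefix k} {v : V} (h : v ∈ prefixSet 𝒢 ℛ δ) :
    ∃ δ' p i, δ' ++ [(p, i)] <+: δ ∧ v ∈ ℛ.safe (δ'.map Prod.fst ++ [p]) ∧
      v ∈ (ℛ.goal p ∩ 𝒢.cpre (prefixFix 𝒢 ℛ δ' p)) ∪
        𝒢.apre (prefixFix 𝒢 ℛ δ' p) (prefixIter 𝒢 ℛ δ' p (i - 1)) := by
  induction δ using List.reverseRecOn with
  | nil => rw [prefixSet_nil] at h; exact h.elim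
  | append_singleton δ q ih =>
    rw [show q = (q.1, q.2) from rfl, prefixSet_append] at h
    rcases h with h | ⟨h1, h2⟩
    · obtain ⟨δ', p, i, h1, h2⟩ := ih h
      exact ⟨δ', p, i, h1.trans (List.prefix_append _ _), h2⟩
    · exact ⟨δ, q.1, q.2, List.prefix_rfl, h1, h2⟩

theorem prefixIter_subset_prefixFix (δ : Prefix k) (p : Fin (k + 1)) (i : ℕ) :
    prefixIter 𝒢 ℛ δ p i ⊆ prefixFix 𝒢 ℛ δ p :=
  pairIter_subset_pairFix 𝒢 ℛ _ _ p _ i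

theorem Prefix.Valid.eq_zero {n : ℕ} {p : Fin (k + 1)} {i : ℕ}
    (h : Prefix.Valid n ([] ++ [(p, i)])) : p = 0 := by
  simpa using h.1

theorem Prefix.Valid.exists_pred {n : ℕ} {δ : Prefix k} {p : Fin (k + 1)} {i : ℕ}
    (h : Prefix.Valid n (δ ++ [(p, i)])) : ∃ i', i = i' + 1 ∧ i' + 1 ≤ n := by
  obtain ⟨h4, h5⟩ := h.2.2 (p, i) (by simp)
  simp only at h4 h5
  exact ⟨i - 1, by omega, by omega⟩

/-- Outwards along the prefix, each limit is part of an iterate of the enclosing pair, and this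
iterate lies below the enclosing limit. -/
theorem prefixFix_subset_rabinFixpoint {n : ℕ} (δ : Prefix k) (p : Fin (k + 1)) (i : ℕ)
    (h : Prefix.Valid n (δ ++ [(p, i)])) : prefixFix 𝒢 ℛ δ p ⊆ rabinFixpoint 𝒢 ℛ := by
  induction δ using List.reverseRecOn generalizing p i with
  | nil =>
    rw [h.eq_zero, rabinFixpoint_eq, prefixFix, prefixSet_nil]
    exact subset_rfl
  | append_singleton δ q ih =>
    have hq := h.init
    obtain ⟨j, hj, -⟩ := Prefix.Valid.exists_pred (p := q.1) (i := q.2) hq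
    refine Set.Subset.trans ?_ (ih q.1 q.2 hq)
    refine Set.Subset.trans ?_ (prefixIter_subset_prefixFix 𝒢 ℛ δ q.1 (j + 1))
    have hlen := h.length_le
    have hd : k - δ.length = (k - (δ ++ [q]).length) + 1 := by
      simp at hlen ⊢; omega
    have hp : p ∉ (δ ++ [q]).map Prod.fst := by
      have h2 := h.2.1
      rw [List.map_append, List.nodup_append] at h2
      intro hp
      exact h2.2.2 p hp p (by simp) rfl
    rw [prefixIter_succ, hd, ← hj]
    intro v hv
    refine (mem_layers_succ 𝒢 ℛ).2 ⟨p, ?_, ?_⟩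
    · simpa using hp
    · rw [prefixFix, List.map_append] at hv
      exact hv

theorem prefixSet_subset_rabinFixpoint {n : ℕ} (δ : Prefix k) (p : Fin (k + 1)) (i : ℕ)
    (h : Prefix.Valid n (δ ++ [(p, i)])) :
    prefixSet 𝒢 ℛ (δ ++ [(p, i)]) ⊆ rabinFixpoint 𝒢 ℛ := by
  refine Set.Subset.trans ?_ (prefixFix_subset_rabinFixpoint 𝒢 ℛ δ p i h)
  obtain ⟨j, rfl, -⟩ := h.exists_pred
  refine Set.Subset.trans ?_ (prefixIter_subset_prefixFix 𝒢 ℛ δ p (j + 1))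
  rw [prefixIter_succ]
  refine subset_layers 𝒢 ℛ _ _ ?_ _
  have h1 := length_remaining h.2.1
  have h2 : (δ ++ [(p, j + 1)]).map Prod.fst = δ.map Prod.fst ++ [p] := by simp
  rw [h2] at h1
  simp at h1
  omega

variable [Fintype V]

theorem card_eq_succ (v : V) : ∃ n, Fintype.card V = n + 1 :=
  ⟨Fintype.card V - 1, by have := Fintype.card_pos_iff.2 ⟨v⟩; omega⟩

/-- A fixpoint is its own n-th iterate, so a further index can be appended with counter n until all
indices are bound. This yields upper bounds for ranks. -/
theorem exists_full_of_mem_layers {e : ℕ} {δ : Prefix k}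
    (h : Prefix.Valid (Fintype.card V) δ) (he : δ.length + e = k + 1) {v : V}
    (hv : v ∈ layers 𝒢 ℛ e (δ.map Prod.fst) (prefixSet 𝒢 ℛ δ)) :
    ∃ δ', δ <+: δ' ∧ δ'.length = k + 1 ∧ Prefix.Valid (Fintype.card V) δ' ∧
      v ∈ prefixSet 𝒢 ℛ δ' := by
  obtain ⟨n, hn⟩ := card_eq_succ v
  induction e generalizing δ with
  | zero => exact ⟨δ, List.prefix_rfl, by omega, h, hv⟩
  | succ e ih =>
    obtain ⟨p, hp, hvp⟩ := (mem_layers_succ 𝒢 ℛ).1 hv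
    have hk : k - δ.length = e := by omega
    have h1 : v ∈ prefixIter 𝒢 ℛ δ p (n + 1) := by
      rw [prefixIter, prefixFix, hk, ← hn, pairIter_card_pairFix]; exact hvp
    rw [prefixIter_succ, hk] at h1
    obtain ⟨δ', h2, h3⟩ := ih (h.append hp (i := n + 1) (by omega) (by omega))
      (by simp; omega) (by rw [List.map_append]; exact h1)
    exact ⟨δ', (List.prefix_append _ _).trans h2, h3⟩

theorem Config.take_last (d : Config k) : d.take (Fin.last k) = d.toPrefix := by
  rw [Config.take, List.take_of_length_le (by simp)]; rfl

/-- The rank of a vertex in `X^i_{δ p}` is at most a configuration that extends `δ p i`. -/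
theorem rank_le_of_mem_prefixIter {δ : Prefix k} {p : Fin (k + 1)} {i : ℕ}
    (h : Prefix.Valid (Fintype.card V) (δ ++ [(p, i)])) {v : V}
    (hv : v ∈ prefixIter 𝒢 ℛ δ p i) :
    ∃ d : Config k, δ ++ [(p, i)] <+: d.toPrefix ∧ rank 𝒢 ℛ v ≤ d := by
  obtain ⟨j, rfl, -⟩ := h.exists_pred
  rw [prefixIter_succ] at hv
  have hlen := h.length_le
  simp only [List.length_append, List.length_cons, List.length_nil] at hlen
  obtain ⟨δ', h1, h2, h3, h4⟩ := exists_full_of_mem_layers 𝒢 ℛ (e := k - δ.length) h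
    (by simp; omega) (by rw [List.map_append]; exact hv)
  obtain ⟨d, rfl⟩ := Config.exists_toPrefix_eq δ' h2
  -- With all indices bound, the conditions on the zero tail are void.
  refine ⟨d, h1, (rank_isLeast 𝒢 ℛ v).2 (Or.inr ⟨d, Fin.last k, rfl, ?_, ?_, ?_, ?_, ?_⟩)⟩
  · have := h3.2.1
    rw [Config.toPrefix, List.map_ofFn, List.nodup_ofFn] at this
    exact this
  · exact fun b hb => absurd hb (Fin.le_last b).not_gt
  · exact fun b _ hb => absurd hb (Fin.le_last b).not_gt
  · rwa [Config.take_last]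
  · rwa [Config.take_last]

theorem rank_le_of_mem_prefixFix {δ : Prefix k} {p : Fin (k + 1)} {i : ℕ}
    (h : Prefix.Valid (Fintype.card V) (δ ++ [(p, i)])) {v : V}
    (hv : v ∈ prefixFix 𝒢 ℛ δ p) :
    ∃ (d : Config k) (i' : ℕ), δ ++ [(p, i')] <+: d.toPrefix ∧ rank 𝒢 ℛ v ≤ d := by
  obtain ⟨n, hn⟩ := card_eq_succ v
  have h1 : v ∈ prefixIter 𝒢 ℛ δ p (n + 1) := by
    rw [prefixIter, prefixFix, ← hn, pairIter_card_pairFix]; exact hv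
  obtain ⟨d, hd⟩ := rank_le_of_mem_prefixIter 𝒢 ℛ (h.replace (by omega) (by omega)) h1
  exact ⟨d, _, hd⟩

theorem rank_ne_top_iff {v : V} : rank 𝒢 ℛ v ≠ ⊤ ↔ v ∈ rabinFixpoint 𝒢 ℛ := by
  constructor
  · intro h
    rcases (rank_isLeast 𝒢 ℛ v).1 with h1 | ⟨d, j, -, -, -, -, h1, h2⟩
    · exact absurd h1 h
    · rcases List.eq_nil_or_concat (d.take j) with h3 | ⟨δ, q, h3⟩
      · rw [h3] at h1; simp [Prefix.Valid] at h1
      · rw [h3, List.concat_eq_append] at h1 h2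
        exact prefixSet_subset_rabinFixpoint 𝒢 ℛ δ q.1 q.2 h1 h2
  · intro h
    rw [rabinFixpoint_eq] at h
    have hv : v ∈ prefixFix 𝒢 ℛ [] 0 := by
      rw [prefixFix, prefixSet_nil]; exact h
    obtain ⟨n, hn⟩ := card_eq_succ v
    obtain ⟨d, -, -, hd⟩ := rank_le_of_mem_prefixFix 𝒢 ℛ (δ := []) (i := 1)
      ⟨by simp, by simp, by simp; omega⟩ hv
    exact ne_top_of_le_ne_top (WithTop.coe_ne_top) hd

/-- The rank of a vertex of finite rank. -/
noncomputable def cfg (v : V) : Config k :=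
  (rank 𝒢 ℛ v).untopD (toLex fun _ => toLex (0, 0))

theorem rank_eq_cfg {v : V} (h : rank 𝒢 ℛ v ≠ ⊤) : rank 𝒢 ℛ v = cfg 𝒢 ℛ v := by
  rw [cfg]
  cases hr : rank 𝒢 ℛ v with
  | top => exact absurd hr h
  | coe d => rfl

theorem cfg_le {v : V} {d : Config k} (h : rank 𝒢 ℛ v ≤ d) :
    rank 𝒢 ℛ v ≠ ⊤ ∧ cfg 𝒢 ℛ v ≤ d := by
  have h1 := ne_top_of_le_ne_top (WithTop.coe_ne_top) h
  refine ⟨h1, ?_⟩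
  rw [rank_eq_cfg 𝒢 ℛ h1] at h
  exact WithTop.coe_le_coe.1 h

/-- The progress that is made at a vertex of finite rank, at a position `b` of its rank. -/
theorem exists_progress {v : V} (hv : rank 𝒢 ℛ v ≠ ⊤) : ∃ b : Fin (k + 1),
    (∀ c ≤ b, v ∉ ℛ.avoid ((cfg 𝒢 ℛ v).idx c)) ∧
    ∀ u, 𝒢.E v u → (v ∈ 𝒢.V₀ → ∀ w, 𝒢.E v w → rank 𝒢 ℛ u ≤ rank 𝒢 ℛ w) →
      rank 𝒢 ℛ u ≠ ⊤ ∧ (cfg 𝒢 ℛ u).uptoIdx b ≤ (cfg 𝒢 ℛ v).uptoIdx b ∧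
      (v ∈ ℛ.goal ((cfg 𝒢 ℛ v).idx b) ∨ (cfg 𝒢 ℛ u).upto b < (cfg 𝒢 ℛ v).upto b ∨
        ∃ w, 𝒢.live v w ∧ (cfg 𝒢 ℛ w).upto b < (cfg 𝒢 ℛ v).upto b) := by
  -- The prefix `δ p i` of the rank ends at the set 𝒞 that contains `v`; its last position is the
  -- position of progress.
  obtain ⟨δ, p, i, hpre, hvalid, hsafe, hC⟩ : ∃ δ p i,
      δ ++ [(p, i)] <+: (cfg 𝒢 ℛ v).toPrefix ∧
      Prefix.Valid (Fintype.card V) (δ ++ [(p, i)]) ∧ v ∈ ℛ.safe (δ.map Prod.fst ++ [p]) ∧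
      v ∈ (ℛ.goal p ∩ 𝒢.cpre (prefixFix 𝒢 ℛ δ p)) ∪
        𝒢.apre (prefixFix 𝒢 ℛ δ p) (prefixIter 𝒢 ℛ δ p (i - 1)) := by
    rcases (rank_isLeast 𝒢 ℛ v).1 with h1 | ⟨d, j, hd, -, -, -, h1, h2⟩
    · exact absurd h1 hv
    · obtain ⟨δ, p, i, h3, h4⟩ := exists_of_mem_prefixSet 𝒢 ℛ h2
      have hd' : cfg 𝒢 ℛ v = d := by rw [cfg, hd]; rfl
      rw [hd']
      exact ⟨δ, p, i, h3.trans (List.take_prefix _ _), h1.of_prefix (by simp) h3, h4⟩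
  set d := cfg 𝒢 ℛ v with hd
  have hlen := hvalid.length_le
  simp only [List.length_append, List.length_cons, List.length_nil] at hlen
  have hidx : ∀ c : Fin (k + 1), (hc : (c : ℕ) < (δ ++ [(p, i)]).length) →
      d.idx c = ((δ ++ [(p, i)])[(c : ℕ)]).1 := by
    intro c hc
    rw [Config.idx, Config.eq_of_prefix hpre c hc]; rfl
  set b : Fin (k + 1) := ⟨δ.length, by omega⟩ with hb
  -- Vertices in `Y*_{δp}` have ranks bounded by configurations extending `δ p`, with an arbitrary
  -- counter.
  have hfix : ∀ u ∈ prefixFix 𝒢 ℛ δ p, ∀ u', rank 𝒢 ℛ u' ≤ rank 𝒢 ℛ u →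
      rank 𝒢 ℛ u' ≠ ⊤ ∧ (cfg 𝒢 ℛ u').uptoIdx b ≤ d.uptoIdx b := by
    intro u hu u' hu'
    obtain ⟨d', i', h1, h2⟩ := rank_le_of_mem_prefixFix 𝒢 ℛ hvalid hu
    obtain ⟨h3, h4⟩ := cfg_le 𝒢 ℛ (hu'.trans h2)
    refine ⟨h3, (Config.uptoIdx_mono b h4).trans (le_of_eq ?_)⟩
    exact Config.uptoIdx_eq_of_prefix h1 hpre b rfl
  have hiter : ∀ u ∈ prefixIter 𝒢 ℛ δ p (i - 1), ∀ u', rank 𝒢 ℛ u' ≤ rank 𝒢 ℛ u →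
      (cfg 𝒢 ℛ u').upto b < d.upto b := by
    intro u hu u' hu'
    obtain ⟨j, rfl, hj⟩ := hvalid.exists_pred
    rw [Nat.add_sub_cancel] at hu
    -- Counter 1 belongs to `X^0 = ∅`; a positive counter below i names a valid smaller prefix.
    rcases Nat.eq_zero_or_pos j with rfl | hpos
    · exact absurd hu (Set.notMem_empty u)
    obtain ⟨d', h1, h2⟩ :=
      rank_le_of_mem_prefixIter 𝒢 ℛ (hvalid.replace hpos (Nat.le_of_succ_le hj)) hu
    obtain ⟨-, h4⟩ := cfg_le 𝒢 ℛ (hu'.trans h2)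
    exact (Config.upto_mono b h4).trans_lt
      (Config.upto_lt_of_prefix (Nat.lt_succ_self j) h1 hpre b rfl)
  have hsub := prefixIter_subset_prefixFix 𝒢 ℛ δ p (i - 1)
  refine ⟨b, ?_, ?_⟩
  · intro c hc
    have hc' : (c : ℕ) < (δ ++ [(p, i)]).length := by
      have : (c : ℕ) ≤ δ.length := hc
      simp; omega
    rw [hidx c hc']
    refine hsafe _ ?_
    have : δ.map Prod.fst ++ [p] = (δ ++ [(p, i)]).map Prod.fst := by simp
    rw [this]
    exact List.mem_map_of_mem (List.getElem_mem hc')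
  have hp : d.idx b = p := by
    rw [hidx b (by simp [hb])]; simp [hb]
  rw [hp]
  have hcpre : ∀ A, v ∈ 𝒢.cpre A → ∀ u, 𝒢.E v u →
      (v ∈ 𝒢.V₀ → ∀ w, 𝒢.E v w → rank 𝒢 ℛ u ≤ rank 𝒢 ℛ w) →
      ∃ w ∈ A, rank 𝒢 ℛ u ≤ rank 𝒢 ℛ w := by
    rintro A (⟨h0, w, hw, hA⟩ | ⟨-, h1⟩) u hu hmin
    · exact ⟨w, hA, hmin h0 w hw⟩
    · exact ⟨u, h1 u hu, le_rfl⟩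
  intro u hu hmin
  rcases hC with ⟨hg, hc⟩ | hc | ⟨⟨w, hw, hwX⟩, -, hall⟩
  · obtain ⟨w, hw, hle⟩ := hcpre _ hc u hu hmin
    obtain ⟨h1, h2⟩ := hfix w hw u hle
    exact ⟨h1, h2, Or.inl hg⟩
  · obtain ⟨w, hw, hle⟩ := hcpre _ hc u hu hmin
    obtain ⟨h1, h2⟩ := hfix w (hsub hw) u hle
    exact ⟨h1, h2, Or.inr (Or.inl (hiter w hw u hle))⟩
  · obtain ⟨h1, h2⟩ := hfix u (hall u hu) u le_rfl
    exact ⟨h1, h2, Or.inr (Or.inr ⟨w, hw, hiter w hwX w le_rfl⟩)⟩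

end Rank

/-! ### Strategies of minimal rank win -/

theorem eventually_frequently_eq {α : Type*} [Finite α] (f : ℕ → α) :
    ∀ᶠ t in atTop, ∃ᶠ s in atTop, f s = f t := by
  have h : ∀ a : α, ∀ᶠ t in atTop, f t = a → ∃ᶠ s in atTop, f s = a := by
    intro a
    by_cases ha : ∃ᶠ s in atTop, f s = a
    · exact Eventually.of_forall fun _ _ => ha
    · filter_upwards [not_frequently.1 ha] with t ht h
      exact absurd h ht
  filter_upwards [eventually_all.2 h] with t ht
  exact ht (f t) rfl

theorem exists_frequently_eq {α : Type*} [Finite α] {f : ℕ → α} {P : α → Prop}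
    (h : ∃ᶠ t in atTop, P (f t)) : ∃ a, P a ∧ ∃ᶠ t in atTop, f t = a := by
  obtain ⟨t, ht, hf⟩ := (h.and_eventually (eventually_frequently_eq f)).exists
  exact ⟨f t, ht, hf⟩

theorem exists_frequently_eq_of_minimal {α β : Type*} [Finite α] [LinearOrder β]
    (f : ℕ → α) (g : α → β) :
    ∃ a, (∃ᶠ t in atTop, f t = a) ∧ ∀ᶠ t in atTop, g a ≤ g (f t) := by
  obtain ⟨a₀, -, h₀⟩ := exists_frequently_eq (f := f) (P := fun _ => True)
    (Frequently.of_forall fun _ => trivial)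
  obtain ⟨a, ha, hmin⟩ := Set.exists_min_image {a | ∃ᶠ t in atTop, f t = a} g (Set.toFinite _)
    ⟨a₀, h₀⟩
  refine ⟨a, ha, ?_⟩
  filter_upwards [eventually_frequently_eq f] with t ht
  exact hmin (f t) ht

section Soundness
variable [Fintype V] (𝒢 : GameGraph V) (ℛ : RabinCondition V k)

theorem mem_plays_of_minRank {π : ℕ → V} (hE : ∀ t, 𝒢.E (π t) (π (t + 1)))
    (hmin : ∀ t, π t ∈ 𝒢.V₀ → π t ∈ rabinFixpoint 𝒢 ℛ →
      ∀ w, 𝒢.E (π t) w → rank 𝒢 ℛ (π (t + 1)) ≤ rank 𝒢 ℛ w)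
    (h0 : π 0 ∈ rabinFixpoint 𝒢 ℛ) (hfair : π ∈ 𝒢.fairPlays) : π ∈ ℛ.plays := by
  classical
  have hb : ∀ v, ∃ b : Fin (k + 1), rank 𝒢 ℛ v ≠ ⊤ → (∀ c ≤ b, v ∉ ℛ.avoid ((cfg 𝒢 ℛ v).idx c)) ∧
      ∀ u, 𝒢.E v u → (v ∈ 𝒢.V₀ → ∀ w, 𝒢.E v w → rank 𝒢 ℛ u ≤ rank 𝒢 ℛ w) →
        rank 𝒢 ℛ u ≠ ⊤ ∧ (cfg 𝒢 ℛ u).uptoIdx b ≤ (cfg 𝒢 ℛ v).uptoIdx b ∧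
        (v ∈ ℛ.goal ((cfg 𝒢 ℛ v).idx b) ∨ (cfg 𝒢 ℛ u).upto b < (cfg 𝒢 ℛ v).upto b ∨
          ∃ w, 𝒢.live v w ∧ (cfg 𝒢 ℛ w).upto b < (cfg 𝒢 ℛ v).upto b) := by
    intro v
    by_cases hv : rank 𝒢 ℛ v ≠ ⊤
    · obtain ⟨b, hb⟩ := exists_progress 𝒢 ℛ hv
      exact ⟨b, fun _ => hb⟩
    · exact ⟨0, fun h => absurd h hv⟩
  choose b hb using hb
  have hrank : ∀ t, rank 𝒢 ℛ (π t) ≠ ⊤ := by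
    intro t
    induction t with
    | zero => exact (rank_ne_top_iff 𝒢 ℛ).2 h0
    | succ t ih =>
      exact ((hb _ ih).2 _ (hE t) fun h => hmin t h ((rank_ne_top_iff 𝒢 ℛ).1 ih)).1
  have havoid : ∀ t, ∀ c ≤ b (π t), π t ∉ ℛ.avoid ((cfg 𝒢 ℛ (π t)).idx c) :=
    fun t => (hb _ (hrank t)).1
  have hstep := fun t => ((hb _ (hrank t)).2 _ (hE t)
    fun h => hmin t h ((rank_ne_top_iff 𝒢 ℛ).1 (hrank t))).2
  -- the least position of progress that occurs infinitely often
  obtain ⟨x, hx, hxmin⟩ := exists_frequently_eq_of_minimal π b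
  set m := b x with hm
  obtain ⟨t₀, ht₀⟩ := eventually_atTop.1 hxmin
  -- Progress now takes place at m or beyond, so the rank up to the index at m never increases;
  -- being well-founded, it becomes constant.
  have hdesc : ∀ t ≥ t₀, (cfg 𝒢 ℛ (π (t + 1))).uptoIdx m ≤ (cfg 𝒢 ℛ (π t)).uptoIdx m := by
    intro t ht
    have := Config.uptoIdx_mono m (hstep t).1
    rwa [Config.uptoIdx_uptoIdx (ht₀ t ht), Config.uptoIdx_uptoIdx (ht₀ t ht)] at this
  obtain ⟨-, ⟨t₁, ht₁, rfl⟩, hleast⟩ := wellFounded_lt.has_min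
    ((fun t => (cfg 𝒢 ℛ (π t)).uptoIdx m) '' Set.Ici t₀) ⟨_, t₀, le_refl t₀, rfl⟩
  have hconst : ∀ t ≥ t₁, (cfg 𝒢 ℛ (π t)).uptoIdx m = (cfg 𝒢 ℛ (π t₁)).uptoIdx m := by
    intro t ht
    have hle : (cfg 𝒢 ℛ (π t)).uptoIdx m ≤ (cfg 𝒢 ℛ (π t₁)).uptoIdx m := by
      induction t, ht using Nat.le_induction with
      | base => exact le_rfl
      | succ t ht ih => exact (hdesc t (le_trans ht₁ ht)).trans ih
    exact hle.antisymm (not_lt.1 (hleast _ ⟨t, le_trans ht₁ ht, rfl⟩))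
  set q := (cfg 𝒢 ℛ (π t₁)).idx m with hq
  have hidx : ∀ t ≥ t₁, (cfg 𝒢 ℛ (π t)).idx m = q :=
    fun t ht => Config.idx_eq_of_uptoIdx_eq (hconst t ht)
  have hgoal : ∃ᶠ t in atTop, π t ∈ ℛ.goal q := by
    by_contra hno
    have hno := not_frequently.1 hno
    -- A recurring vertex whose rank up to the counter at m is minimal: from some time on, no
    -- visited vertex is below it.
    obtain ⟨y, hy, hymin⟩ := exists_frequently_eq_of_minimal π
      fun v => (cfg 𝒢 ℛ v).upto m
    obtain ⟨t₂, ht₂⟩ := eventually_atTop.1 hymin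
    have hfreq : ∃ᶠ t in atTop,
        (cfg 𝒢 ℛ (π t)).upto m = (cfg 𝒢 ℛ y).upto m ∧ b (π t) = m := by
      rw [frequently_atTop]
      intro N
      obtain ⟨t, ht, hty⟩ := frequently_atTop.1 hy (max N (max t₀ t₂))
      -- Between a visit to `y` and the next progress at m, all progress is strictly beyond m, so
      -- the rank up to m cannot grow and stays at the minimum.
      have hex : ∃ s, b (π (t + s)) = m := by
        obtain ⟨s, hs, hsx⟩ := frequently_atTop.1 hx t
        exact ⟨s - t, by rw [Nat.add_sub_cancel' hs, hsx]⟩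
      have hstay : ∀ s ≤ Nat.find hex,
          (cfg 𝒢 ℛ (π (t + s))).upto m = (cfg 𝒢 ℛ y).upto m := by
        intro s hs
        induction s with
        | zero => rw [add_zero, hty]
        | succ s ih =>
          have h1 : b (π (t + s)) ≠ m := Nat.find_min hex hs
          have h2 : m < b (π (t + s)) := lt_of_le_of_ne (ht₀ _ (by omega)) (Ne.symm h1)
          have h3 := Config.upto_mono m (hstep (t + s)).1
          rw [Config.upto_uptoIdx h2, Config.upto_uptoIdx h2, ih (Nat.le_of_succ_le hs)] at h3
          exact h3.antisymm (ht₂ (t + s + 1) (by omega))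
      exact ⟨t + Nat.find hex, by omega, hstay _ le_rfl, Nat.find_spec hex⟩
    obtain ⟨z, ⟨hz1, hz2⟩, hz⟩ := exists_frequently_eq
      (P := fun v => (cfg 𝒢 ℛ v).upto m = (cfg 𝒢 ℛ y).upto m ∧ b v = m) hfreq
    obtain ⟨t, ⟨htz, htno⟩, ht⟩ :=
      ((hz.and_eventually hno).and_eventually (eventually_ge_atTop (max t₁ t₂))).exists
    have hs := (hstep t).2
    rw [htz, hz2, hz1] at hs
    rw [htz] at htno
    have hzq : (cfg 𝒢 ℛ z).idx m = q := htz ▸ hidx t (by omega)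
    rw [hzq] at hs
    -- The goal is excluded late in the play, a drop contradicts minimality, and by fairness the
    -- live edge is taken late enough to contradict it too.
    rcases hs with hs | hs | ⟨w, hw, hlt⟩
    · exact htno hs
    · exact absurd (ht₂ (t + 1) (by omega)) (not_le.2 hs)
    · obtain ⟨s, ⟨-, hsw⟩, hsge⟩ :=
        ((hfair z w hw hz).and_eventually (eventually_ge_atTop t₂)).exists
      have := ht₂ (s + 1) (by omega)
      rw [hsw] at this
      exact absurd this (not_le.2 hlt)
  have havoid' : ∀ᶠ t in atTop, π t ∉ ℛ.avoid q := by
    filter_upwards [eventually_ge_atTop (max t₀ t₁)] with t ht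
    rw [← hidx t (by omega)]
    exact havoid t m (ht₀ t (by omega))
  -- The artificial pair has an empty goal and cannot be the recurring index.
  rcases Fin.eq_zero_or_eq_succ q with h | ⟨j, h⟩
  · rw [h] at hgoal
    obtain ⟨t, ht⟩ := hgoal.exists
    exact absurd ht (Set.notMem_empty _)
  · rw [h] at hgoal havoid'
    exact ⟨j, havoid', hgoal⟩

theorem winsFrom_of_minRank {ρ₀ : Strategy 𝒢 𝒢.V₀} (hρ : MinRank 𝒢 ℛ ρ₀) {v : V}
    (hv : v ∈ rabinFixpoint 𝒢 ℛ) : 𝒢.WinsFrom ρ₀ (𝒢.fairAdversarial ℛ.plays) v := by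
  intro ρ₁ π h0 hρ₀ hρ₁ hfair
  refine mem_plays_of_minRank 𝒢 ℛ (fun t => ?_) (fun t ht hZ => ?_) (h0 ▸ hv) hfair
  · by_cases ht : π t ∈ 𝒢.V₀
    · rw [hρ₀ t ht]; exact ρ₀.legal _ ⟨π t, ht⟩
    · have ht' : π t ∈ 𝒢.V₁ := ht
      rw [hρ₁ t ht']; exact ρ₁.legal _ ⟨π t, ht'⟩
  · rw [hρ₀ t ht]
    exact hρ _ ⟨π t, ht⟩ hZ

theorem exists_memoryless_minRank (hE : ∀ v, ∃ w, 𝒢.E v w) :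
    ∃ ρ₀ : Strategy 𝒢 𝒢.V₀, ρ₀.Memoryless ∧ MinRank 𝒢 ℛ ρ₀ := by
  have h : ∀ v, ∃ w, 𝒢.E v w ∧ ∀ u, 𝒢.E v u → rank 𝒢 ℛ w ≤ rank 𝒢 ℛ u :=
    fun v => Set.exists_min_image {w | 𝒢.E v w} (rank 𝒢 ℛ) (Set.toFinite _) (hE v)
  choose f hf1 hf2 using h
  exact ⟨⟨fun _ v => f v, fun _ v => hf1 v⟩, fun _ _ _ => rfl, fun _ v _ u hu => hf2 v u hu⟩

end Soundness

/-! ### Positional determinacy for winning conditions on the edges that are taken infinitely often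

The opponent wins the plays whose set of edges that are taken infinitely often belongs to a family
that is closed under unions. Player 0 then wins with a positional strategy from every vertex from
which the opponent does not win. -/

/-- The edges that a play takes infinitely often. -/
def infEdges (π : ℕ → V) : Set (V × V) := {e | ∃ᶠ t in atTop, (π t, π (t + 1)) = e}

theorem infEdges_shift (π : ℕ → V) (N : ℕ) : infEdges (fun t => π (t + N)) = infEdges π := by
  ext e
  have h := frequently_map (P := fun t => (π t, π (t + 1)) = e) (f := atTop) (m := fun t => t + N)
  rw [map_add_atTop_eq_nat] at h
  refine Iff.trans ?_ h.symm
  simp only [infEdges, Set.mem_ofPred_eq, add_right_comm _ N 1]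

section Determinacy
variable (V₀ : Set V) (ℱ : Set (Set (V × V)))

/-- Every play from `v` in which the opponent follows the strategy
`(upd, act)`, started in the memory state `m`, is won by the opponent. -/
def WinsAt {M : Type} (E : V → V → Prop) (upd : M → V → V → M) (act : M → V → V) (v : V) (m : M) :
    Prop :=
  ∀ (π : ℕ → V) (mem : ℕ → M), π 0 = v → mem 0 = m →
    (∀ t, mem (t + 1) = upd (mem t) (π t) (π (t + 1))) → (∀ t, π t ∈ V₀ → E (π t) (π (t + 1))) →
    (∀ t, π t ∉ V₀ → π (t + 1) = act (mem t) (π t)) → infEdges π ∈ ℱ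

/-- The opponent wins from `v`. -/
def OpponentWins (E : V → V → Prop) (v : V) : Prop :=
  ∃ (M : Type) (m₀ : M) (upd : M → V → V → M) (act : M → V → V),
    (∀ m, ∀ x ∉ V₀, E x (act m x)) ∧ WinsAt V₀ ℱ E upd act v m₀

/-- Player 0 wins from `v` with a positional strategy. -/
def PositionalWins (E : V → V → Prop) (v : V) : Prop :=
  ∃ σ : V → V, (∀ x ∈ V₀, E x (σ x)) ∧ ∀ π : ℕ → V, π 0 = v → (∀ t, E (π t) (π (t + 1))) →
    (∀ t, π t ∈ V₀ → π (t + 1) = σ (π t)) → infEdges π ∉ ℱ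

variable {V₀ ℱ}

theorem WinsAt.step {M : Type} {E : V → V → Prop} {upd : M → V → V → M} {act : M → V → V} {v : V}
    {m : M} (h : WinsAt V₀ ℱ E upd act v m) {w : V} (h₀ : v ∈ V₀ → E v w)
    (h₁ : v ∉ V₀ → w = act m v) : WinsAt V₀ ℱ E upd act w (upd m v w) := by
  intro π mem hπ hmem hupd hE hact
  have := h (fun t => t.casesOn v π) (fun t => t.casesOn m mem) rfl rfl ?_ ?_ ?_
  · rwa [← infEdges_shift _ 1] at this
  · rintro (_ | t)
    · change mem 0 = upd m v (π 0)
      rw [hmem, hπ]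
    · exact hupd t
  · rintro (_ | t) ht
    · simp only [hπ]; exact h₀ ht
    · exact hE t ht
  · rintro (_ | t) ht
    · simp only [hπ]; exact h₁ ht
    · exact hact t ht

/-- A vertex from which Player 0 wins is not reached when the opponent plays a winning strategy, so
that edges may be added there. -/
theorem OpponentWins.mono {E' E : V → V → Prop} {v₀ u : V} (hsub : ∀ x y, E' x y → E x y)
    (hoff : ∀ x y, x ≠ v₀ → E x y → E' x y) (h₀ : PositionalWins V₀ ℱ E' v₀)
    (hu : OpponentWins V₀ ℱ E' u) : OpponentWins V₀ ℱ E u := by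
  classical
  obtain ⟨M, m₀, upd, act, hlegal, hwin⟩ := hu
  obtain ⟨σ, hσ, hσwin⟩ := h₀
  -- Playing both strategies against each other from `v₀` would give one play won by both sides.
  have hne : ∀ m, ¬ WinsAt V₀ ℱ E' upd act v₀ m := by
    intro m h
    let st : ℕ → V × M := fun t => (fun s : V × M =>
      let x := if s.1 ∈ V₀ then σ s.1 else act s.2 s.1
      (x, upd s.2 s.1 x))^[t] (v₀, m)
    have hst1 : ∀ t, (st (t + 1)).1 = if (st t).1 ∈ V₀ then σ (st t).1 else act (st t).2 (st t).1 :=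
      fun t => by simp only [st, Function.iterate_succ_apply']
    have hst2 : ∀ t, (st (t + 1)).2 = upd (st t).2 (st t).1 (st (t + 1)).1 :=
      fun t => by simp only [st, Function.iterate_succ_apply']
    refine hσwin (fun t => (st t).1) rfl (fun t => ?_) (fun t ht => ?_)
      (h (fun t => (st t).1) (fun t => (st t).2) rfl rfl hst2 (fun t ht => ?_) (fun t ht => ?_))
    · by_cases ht : (st t).1 ∈ V₀
      · rw [hst1, if_pos ht]; exact hσ _ ht
      · rw [hst1, if_neg ht]; exact hlegal _ _ ht
    · rw [hst1, if_pos ht]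
    · rw [hst1, if_pos ht]; exact hσ _ ht
    · rw [hst1, if_neg ht]
  refine ⟨M, m₀, upd, act, fun m x hx => hsub _ _ (hlegal m x hx), ?_⟩
  intro π mem hπ hmem hupd hE hact
  have hinv : ∀ t, WinsAt V₀ ℱ E' upd act (π t) (mem t) := by
    intro t
    induction t with
    | zero => rw [hπ, hmem]; exact hwin
    | succ t ih =>
      rw [hupd]
      refine ih.step (fun ht => hoff _ _ ?_ (hE t ht)) (hact t)
      intro h
      rw [h] at ih
      exact hne _ ih
  refine hwin π mem hπ hmem hupd (fun t ht => hoff _ _ ?_ (hE t ht)) hact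
  intro h
  exact hne (mem t) (h ▸ hinv t)

/-- Sampling at the times in `A` loses nothing, since `f` is constant in between. It turns each of
two interleaved plays into a genuine play. -/
theorem stutter {α : Type*} {A : ℕ → Prop} (hA : {t | A t}.Infinite) {f : ℕ → α}
    (hf : ∀ t, ¬ A t → f (t + 1) = f t) :
    f (Nat.nth A 0) = f 0 ∧ ∀ j, f (Nat.nth A (j + 1)) = f (Nat.nth A j + 1) := by
  have key : ∀ a b, a ≤ b → (∀ t, a ≤ t → t < b → ¬ A t) → f b = f a := by
    intro a b hab
    induction b, hab using Nat.le_induction with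
    | base => exact fun _ => rfl
    | succ b hab ih =>
      intro h
      rw [hf b (h b hab (Nat.lt_succ_self b)), ih fun t h1 h2 => h t h1 (Nat.lt_succ_of_lt h2)]
  have hsurj : ∀ t, A t → ∃ i, Nat.nth A i = t := fun t ht => by
    obtain ⟨i, -, hi⟩ := Nat.exists_lt_card_nth_eq ht
    exact ⟨i, hi⟩
  refine ⟨key _ _ (Nat.zero_le _) fun t _ ht hAt => ?_, fun j => key _ _ ?_ fun t h1 h2 hAt => ?_⟩
  · obtain ⟨i, rfl⟩ := hsurj t hAt
    exact absurd ((Nat.nth_lt_nth hA).1 ht) (Nat.not_lt_zero i)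
  · exact (Nat.nth_lt_nth hA).2 (Nat.lt_succ_self j)
  · obtain ⟨i, rfl⟩ := hsurj t hAt
    have h3 := (Nat.nth_lt_nth hA).1 (Nat.lt_of_succ_le h1)
    have h4 := (Nat.nth_lt_nth hA).1 h2
    omega

/-- If a play only moves at the times in an infinite set `A`, and follows a winning strategy of the
opponent at these times, then the edges that are taken infinitely often form a set in `ℱ`. -/
theorem WinsAt.of_stutter {M : Type} {E : V → V → Prop} {upd : M → V → V → M} {act : M → V → V}
    {v : V} {m : M} (h : WinsAt V₀ ℱ E upd act v m) {A : ℕ → Prop} (hA : {t | A t}.Infinite)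
    {X : ℕ → V} {mem : ℕ → M} (hX : X 0 = v) (hmem : mem 0 = m)
    (hoff : ∀ t, ¬ A t → X (t + 1) = X t ∧ mem (t + 1) = mem t)
    (hupd : ∀ t, A t → mem (t + 1) = upd (mem t) (X t) (X (t + 1)))
    (hE : ∀ t, A t → X t ∈ V₀ → E (X t) (X (t + 1)))
    (hact : ∀ t, A t → X t ∉ V₀ → X (t + 1) = act (mem t) (X t)) :
    {e | ∃ᶠ t in atTop, A t ∧ (X t, X (t + 1)) = e} ∈ ℱ := by
  obtain ⟨hX0, hXs⟩ := stutter hA fun t ht => (hoff t ht).1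
  obtain ⟨hm0, hms⟩ := stutter hA fun t ht => (hoff t ht).2
  have hmemA : ∀ j, A (Nat.nth A j) := fun j => Nat.nth_mem_of_infinite hA j
  have hw := h (fun j => X (Nat.nth A j)) (fun j => mem (Nat.nth A j)) (hX0.trans hX)
    (hm0.trans hmem) (fun j => by rw [hms, hXs]; exact hupd _ (hmemA j))
    (fun j hj => by rw [hXs]; exact hE _ (hmemA j) hj)
    (fun j hj => by rw [hXs]; exact hact _ (hmemA j) hj)
  convert hw using 1
  ext e
  simp only [infEdges, Set.mem_ofPred_eq, hXs, frequently_atTop]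
  constructor
  · intro hf N
    obtain ⟨t, ht, hAt, he⟩ := hf (Nat.nth A N)
    obtain ⟨i, -, rfl⟩ := Nat.exists_lt_card_nth_eq hAt
    exact ⟨i, (Nat.nth_le_nth hA).1 ht, he⟩
  · intro hf N
    obtain ⟨j, hj, he⟩ := hf N
    exact ⟨Nat.nth A j, hj.trans (Nat.nth_strictMono hA).le_apply, hmemA j, he⟩

/-- Strategies of the opponent for two parts of the edges of `v₀` can be combined. -/
theorem OpponentWins.combine (hℱ : ∀ A ∈ ℱ, ∀ B ∈ ℱ, A ∪ B ∈ ℱ) {E₁ E₂ E : V → V → Prop}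
    {v₀ u : V} (hv₀ : v₀ ∈ V₀) (h₁ : ∀ x y, E₁ x y → E x y) (h₂ : ∀ x y, E₂ x y → E x y)
    (hE : ∀ x y, E x y → E₁ x y ∨ E₂ x y)
    (hoff : ∀ x y, x ≠ v₀ → E x y → E₁ x y ∧ E₂ x y)
    (hw₁ : OpponentWins V₀ ℱ E₁ u) (hw₂ : OpponentWins V₀ ℱ E₂ v₀) : OpponentWins V₀ ℱ E u := by
  classical
  obtain ⟨M₁, m₁, upd₁, act₁, hl₁, hw₁⟩ := hw₁
  obtain ⟨M₂, m₂, upd₂, act₂, hl₂, hw₂⟩ := hw₂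
  -- The edge chosen at `v₀` decides which of the two games is continued; the memory of the other
  -- one is frozen.
  let side : Bool → V → V → Bool := fun c x y => if x = v₀ then decide (E₁ x y) else c
  let upd : M₁ × M₂ × Bool → V → V → M₁ × M₂ × Bool := fun m x y =>
    (if side m.2.2 x y = true then upd₁ m.1 x y else m.1,
      if side m.2.2 x y = false then upd₂ m.2.1 x y else m.2.1, side m.2.2 x y)
  let act : M₁ × M₂ × Bool → V → V := fun m x =>
    if m.2.2 = true then act₁ m.1 x else act₂ m.2.1 x
  refine ⟨M₁ × M₂ × Bool, (m₁, m₂, true), upd, act, fun m x hx => ?_, ?_⟩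
  · simp only [act]
    split_ifs
    · exact h₁ _ _ (hl₁ _ _ hx)
    · exact h₂ _ _ (hl₂ _ _ hx)
  intro π mem hπ hmem hupd hleg hact
  set T : ℕ → Bool := fun t => side (mem t).2.2 (π t) (π (t + 1)) with hT
  have hc : ∀ t, (mem (t + 1)).2.2 = T t := fun t => by rw [hupd]
  have hm₁ : ∀ t, (mem (t + 1)).1 = if T t = true then upd₁ (mem t).1 (π t) (π (t + 1))
      else (mem t).1 := fun t => by rw [hupd]
  have hm₂ : ∀ t, (mem (t + 1)).2.1 = if T t = false then upd₂ (mem t).2.1 (π t) (π (t + 1))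
      else (mem t).2.1 := fun t => by rw [hupd]
  have hTc : ∀ t, π t ≠ v₀ → T t = (mem t).2.2 := fun t ht => if_neg ht
  -- the current vertices of the two interleaved plays
  set X : Bool → ℕ → V := fun b t => if (mem t).2.2 = b then π t else v₀ with hX
  have hXon : ∀ b t, T t = b → X b t = π t ∧ X b (t + 1) = π (t + 1) := by
    intro b t hb
    refine ⟨?_, ?_⟩
    · simp only [hX]
      split_ifs with h
      · rfl
      · by_contra hne
        exact h ((hTc t (Ne.symm hne)).symm.trans hb)
    · simp only [hX, hc, hb, if_true]
  have hXoff : ∀ b t, T t ≠ b → X b (t + 1) = X b t := by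
    intro b t hb
    simp only [hX, hc, if_neg hb]
    split_ifs with h
    · by_contra hne
      exact hb ((hTc t (Ne.symm hne)).trans h)
    · rfl
  have hsplit : infEdges π = {e | ∃ᶠ t in atTop, T t = true ∧ (X true t, X true (t + 1)) = e} ∪
      {e | ∃ᶠ t in atTop, T t = false ∧ (X false t, X false (t + 1)) = e} := by
    ext e
    simp only [infEdges, Set.mem_union, Set.mem_ofPred_eq, ← frequently_or_distrib]
    refine frequently_congr (Eventually.of_forall fun t => ?_)
    cases hb : T t
    · obtain ⟨h3, h4⟩ := hXon false t hb
      simp [h3, h4]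
    · obtain ⟨h3, h4⟩ := hXon true t hb
      simp [h3, h4]
  have hne : ∀ t, π t ∉ V₀ → π t ≠ v₀ := fun t ht h => ht (h ▸ hv₀)
  have hw₁' : {t | T t = true}.Infinite →
      {e | ∃ᶠ t in atTop, T t = true ∧ (X true t, X true (t + 1)) = e} ∈ ℱ := by
    intro hinf
    refine hw₁.of_stutter (mem := fun t => (mem t).1) hinf ?_ ?_ ?_ ?_ ?_ ?_
    · simp only [hX, hmem, hπ, if_true]
    · simp only [hmem]
    · intro t ht
      exact ⟨hXoff true t ht, by rw [hm₁, if_neg ht]⟩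
    · intro t ht
      obtain ⟨h3, h4⟩ := hXon true t ht
      rw [h3, h4, hm₁, if_pos ht]
    · intro t ht h0
      obtain ⟨h3, h4⟩ := hXon true t ht
      rw [h3] at h0
      rw [h3, h4]
      by_cases hv : π t = v₀
      · simpa [hT, side, hv] using ht
      · exact (hoff _ _ hv (hleg t h0)).1
    · intro t ht h0
      obtain ⟨h3, h4⟩ := hXon true t ht
      rw [h3] at h0
      rw [h3, h4, hact t h0]
      have := hTc t (hne t h0)
      simp only [act, ← this, ht, if_true]
  have hw₂' : {t | T t = false}.Infinite →
      {e | ∃ᶠ t in atTop, T t = false ∧ (X false t, X false (t + 1)) = e} ∈ ℱ := by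
    intro hinf
    refine hw₂.of_stutter (mem := fun t => (mem t).2.1) hinf ?_ ?_ ?_ ?_ ?_ ?_
    · simp [hX, hmem]
    · simp only [hmem]
    · intro t ht
      exact ⟨hXoff false t ht, by rw [hm₂, if_neg ht]⟩
    · intro t ht
      obtain ⟨h3, h4⟩ := hXon false t ht
      rw [h3, h4, hm₂, if_pos ht]
    · intro t ht h0
      obtain ⟨h3, h4⟩ := hXon false t ht
      rw [h3] at h0
      rw [h3, h4]
      by_cases hv : π t = v₀
      · refine (hE _ _ (hleg t h0)).resolve_left ?_
        simpa [hT, side, hv] using ht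
      · exact (hoff _ _ hv (hleg t h0)).2
    · intro t ht h0
      obtain ⟨h3, h4⟩ := hXon false t ht
      rw [h3] at h0
      rw [h3, h4, hact t h0]
      have := hTc t (hne t h0)
      simp [act, ← this, ht]
  -- A game that is continued only finitely often contributes no recurring edge, so its winning
  -- strategy is not needed.
  have hempty : ∀ b, ¬ {t | T t = b}.Infinite →
      {e | ∃ᶠ t in atTop, T t = b ∧ (X b t, X b (t + 1)) = e} = ∅ := by
    intro b hb
    rw [← Nat.frequently_atTop_iff_infinite, not_frequently] at hb
    refine Set.eq_empty_of_forall_notMem fun e he => ?_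
    obtain ⟨t, ht, ht'⟩ := (Frequently.and_eventually he hb).exists
    exact ht' ht.1
  rw [hsplit]
  by_cases hi₁ : {t | T t = true}.Infinite
  · by_cases hi₂ : {t | T t = false}.Infinite
    · exact hℱ _ (hw₁' hi₁) _ (hw₂' hi₂)
    · rw [hempty false hi₂, Set.union_empty]; exact hw₁' hi₁
  · rw [hempty true hi₁, Set.empty_union]
    refine hw₂' fun hfin => ?_
    refine Set.infinite_univ (((Set.not_infinite.1 hi₁).union hfin).subset fun t _ => ?_)
    cases hb : T t
    · exact Or.inr hb
    · exact Or.inl hb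

/-- Player 0 has no choice, so the opponent wins iff some path has its recurring edges in `ℱ`; it
follows that path with a clock as memory. -/
theorem positionalWins_or_opponentWins_of_subsingleton {E : V → V → Prop}
    (hE : ∀ x, ∃ y, E x y) (h : ∀ x ∈ V₀, ∀ y z, E x y → E x z → y = z) (v : V) :
    PositionalWins V₀ ℱ E v ∨ OpponentWins V₀ ℱ E v := by
  classical
  choose f hf using hE
  by_cases hp : ∃ π : ℕ → V, π 0 = v ∧ (∀ t, E (π t) (π (t + 1))) ∧ infEdges π ∈ ℱ
  · obtain ⟨π, h0, hπ, hin⟩ := hp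
    refine Or.inr ⟨ℕ, 0, fun t _ _ => t + 1, fun t x => if x = π t then π (t + 1) else f x, ?_, ?_⟩
    · intro t x _
      dsimp only
      split_ifs with hx
      · rw [hx]; exact hπ t
      · exact hf x
    · intro π' mem h0' hmem hupd hE' hact
      have hmt : ∀ t, mem t = t := by
        intro t
        induction t with
        | zero => exact hmem
        | succ t ih => rw [hupd, ih]
      have heq : π' = π := by
        funext t
        induction t with
        | zero => rw [h0, h0']
        | succ t ih =>
          by_cases ht : π' t ∈ V₀
          · exact h _ ht _ _ (hE' t ht) (ih ▸ hπ t)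
          · rw [hact t ht, hmt]; exact if_pos ih
      rw [heq]; exact hin
  · exact Or.inl ⟨f, fun x _ => hf x, fun π h0 hπ _ hin => hp ⟨π, h0, hπ, hin⟩⟩

theorem PositionalWins.mono {E' E : V → V → Prop} {v : V} (hsub : ∀ x y, E' x y → E x y)
    (hoff : ∀ x ∉ V₀, ∀ y, E x y → E' x y) (h : PositionalWins V₀ ℱ E' v) :
    PositionalWins V₀ ℱ E v := by
  obtain ⟨σ, hσ, hwin⟩ := h
  refine ⟨σ, fun x hx => hsub _ _ (hσ x hx), fun π h0 hπ hc => hwin π h0 (fun t => ?_) hc⟩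
  by_cases ht : π t ∈ V₀
  · rw [hc t ht]; exact hσ _ ht
  · exact hoff _ ht _ (hπ t)

/-- Positional determinacy for Player 0. -/
theorem positionalWins_or_opponentWins [Finite V] (hℱ : ∀ A ∈ ℱ, ∀ B ∈ ℱ, A ∪ B ∈ ℱ)
    {E : V → V → Prop} (hE : ∀ x, ∃ y, E x y) (v : V) :
    PositionalWins V₀ ℱ E v ∨ OpponentWins V₀ ℱ E v := by
  induction hn : {e : V × V | e.1 ∈ V₀ ∧ E e.1 e.2}.ncard using Nat.strong_induction_on
    generalizing E v with
  | _ n ih =>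
  by_cases hs : ∀ x ∈ V₀, ∀ y z, E x y → E x z → y = z
  · exact positionalWins_or_opponentWins_of_subsingleton hE hs v
  push Not at hs
  obtain ⟨v₀, hv₀, y, z, hy, hz, hyz⟩ := hs
  -- Split the choices at `v₀`: all but `y`, or only `y`. Both games have fewer edges of Player 0.
  let E₁ : V → V → Prop := fun a b => E a b ∧ ¬ (a = v₀ ∧ b = y)
  let E₂ : V → V → Prop := fun a b => E a b ∧ (a = v₀ → b = y)
  have hE₁ : ∀ x, ∃ y, E₁ x y := by
    intro x
    by_cases hx : x = v₀
    · exact ⟨z, hx ▸ hz, fun h => hyz h.2.symm⟩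
    · obtain ⟨w, hw⟩ := hE x
      exact ⟨w, hw, fun h => hx h.1⟩
  have hE₂ : ∀ x, ∃ y, E₂ x y := by
    intro x
    by_cases hx : x = v₀
    · exact ⟨y, hx ▸ hy, fun _ => rfl⟩
    · obtain ⟨w, hw⟩ := hE x
      exact ⟨w, hw, fun h => absurd h hx⟩
  have hlt : ∀ E' : V → V → Prop, (∀ a b, E' a b → E a b) → ∀ w, E v₀ w → ¬ E' v₀ w →
      {e : V × V | e.1 ∈ V₀ ∧ E' e.1 e.2}.ncard < n := by
    intro E' hsub w hw hw'
    rw [← hn]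
    refine Set.ncard_lt_ncard ⟨fun e he => ⟨he.1, hsub _ _ he.2⟩, fun hle => ?_⟩ (Set.toFinite _)
    exact hw' (hle (show (v₀, w) ∈ _ from ⟨hv₀, hw⟩)).2
  have d₁ := fun u => ih _ (hlt E₁ (fun _ _ h => h.1) y hy fun h => h.2 ⟨rfl, rfl⟩) hE₁ u rfl
  have d₂ := fun u => ih _ (hlt E₂ (fun _ _ h => h.1) z hz fun h => hyz (h.2 rfl).symm) hE₂ u rfl
  have hoff : ∀ a b, a ≠ v₀ → E a b → E₁ a b ∧ E₂ a b :=
    fun a b ha hab => ⟨⟨hab, fun h => ha h.1⟩, ⟨hab, fun h => absurd h ha⟩⟩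
  have hne : ∀ a, a ∉ V₀ → a ≠ v₀ := fun a ha h => ha (h ▸ hv₀)
  rcases d₁ v with h₁ | h₁
  · exact Or.inl (h₁.mono (fun _ _ h => h.1) fun a ha b hab => (hoff a b (hne a ha) hab).1)
  rcases d₂ v with h₂ | h₂
  · exact Or.inl (h₂.mono (fun _ _ h => h.1) fun a ha b hab => (hoff a b (hne a ha) hab).2)
  right
  -- If Player 0 wins the second game from `v₀`, the opponent's winning plays from `v` avoid `v₀`
  -- and survive in `E`. Otherwise the two opponent strategies are interleaved at `v₀`.
  rcases d₂ v₀ with h₀ | h₀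
  · exact OpponentWins.mono (fun _ _ h => h.1) (fun a b ha hab => (hoff a b ha hab).2) h₀ h₂
  · refine OpponentWins.combine hℱ hv₀ (fun _ _ h => h.1) (fun _ _ h => h.1) (fun a b hab => ?_)
      hoff h₁ h₀
    by_cases h : a = v₀ ∧ b = y
    · exact Or.inr ⟨hab, fun _ => h.2⟩
    · exact Or.inl ⟨hab, h⟩

end Determinacy

/-! ### Plays and components of finite graphs -/

/-- In a finite strongly connected graph there is a play that takes every edge infinitely often. -/
theorem exists_play_infEdges [Finite V] {r : V → V → Prop} {C : Set V}
    (hsucc : ∀ x ∈ C, ∃ y ∈ C, r x y)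
    (hconn : ∀ x ∈ C, ∀ y ∈ C, Relation.ReflTransGen (fun a b => r a b ∧ b ∈ C) x y)
    {c : V} (hc : c ∈ C) :
    ∃ π : ℕ → V, π 0 = c ∧ (∀ t, r (π t) (π (t + 1))) ∧
      infEdges π = {e | e.1 ∈ C ∧ e.2 ∈ C ∧ r e.1 e.2} := by
  classical
  -- Each vertex lists its successors in `C`, every one infinitely often; the n-th visit takes the
  -- n-th entry.
  have hs : ∀ x : C, ∃ s : ℕ → V, (∀ n, s n ∈ C ∧ r x (s n)) ∧
      ∀ y ∈ C, r x y → ∀ N, ∃ n ≥ N, s n = y := by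
    intro x
    obtain ⟨y₀, hy₀, hr₀⟩ := hsucc x x.2
    have : Nonempty {y // y ∈ C ∧ r x y} := ⟨⟨y₀, hy₀, hr₀⟩⟩
    obtain ⟨g, hg⟩ := exists_surjective_nat {y // y ∈ C ∧ r x y}
    refine ⟨fun n => g n.unpair.1, fun n => (g n.unpair.1).2, fun y hy hr N => ?_⟩
    obtain ⟨m, hm⟩ := hg ⟨y, hy, hr⟩
    exact ⟨Nat.pair m N, Nat.right_le_pair m N, by simp [hm]⟩
  choose s hs hsy using hs
  let st : ℕ → C × (C → ℕ) := fun t => (fun q : C × (C → ℕ) =>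
    ((⟨s q.1 (q.2 q.1), (hs _ _).1⟩ : C), Function.update q.2 q.1 (q.2 q.1 + 1)))^[t]
      (⟨c, hc⟩, fun _ => 0)
  have hst1 : ∀ t, ((st (t + 1)).1 : V) = s (st t).1 ((st t).2 (st t).1) :=
    fun t => by simp only [st, Function.iterate_succ_apply']
  have hst2 : ∀ t, (st (t + 1)).2 = Function.update (st t).2 (st t).1 ((st t).2 (st t).1 + 1) :=
    fun t => by simp only [st, Function.iterate_succ_apply']
  have hcount : ∀ t x, (st t).2 x = Nat.count (fun i => (st i).1 = x) t := by
    intro t x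
    induction t with
    | zero => rfl
    | succ t ih =>
      rw [hst2, Nat.count_succ, ← ih]
      by_cases h : (st t).1 = x
      · subst h; simp
      · rw [Function.update_of_ne (Ne.symm h), if_neg h, add_zero]
  have hedge : ∀ t, r (st t).1 (st (t + 1)).1 := fun t => by rw [hst1]; exact (hs _ _).2
  have hall : ∀ x : C, (∃ᶠ t in atTop, (st t).1 = x) → ∀ y ∈ C, r x y →
      ∃ᶠ t in atTop, (st t).1 = x ∧ ((st (t + 1)).1 : V) = y := by
    intro x hx y hy hr
    rw [Nat.frequently_atTop_iff_infinite] at hx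
    rw [frequently_atTop]
    intro N
    obtain ⟨n, hn, hny⟩ := hsy x y hy hr N
    have h1 : (st (Nat.nth (fun i => (st i).1 = x) n)).1 = x := Nat.nth_mem_of_infinite hx n
    refine ⟨Nat.nth (fun i => (st i).1 = x) n, hn.trans (Nat.nth_strictMono hx).le_apply, h1, ?_⟩
    rw [hst1, h1, hcount, Nat.count_nth_of_infinite hx, hny]
  obtain ⟨x₀, -, hx₀⟩ := exists_frequently_eq (f := fun t => (st t).1) (P := fun _ => True)
    (Frequently.of_forall fun _ => trivial)
  have hfreq : ∀ y ∈ C, ∃ᶠ t in atTop, ((st t).1 : V) = y := by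
    intro y hy
    have := hconn x₀ x₀.2 y hy
    induction this with
    | refl => exact hx₀.mono fun t ht => congrArg Subtype.val ht
    | tail _ hbc ih =>
      rename_i a b hab
      have ha : a ∈ C := by
        cases hab with
        | refl => exact x₀.2
        | tail _ h => exact h.2
      have h1 := hall ⟨a, ha⟩ ((ih ha).mono fun t ht => Subtype.ext ht) b hbc.2 hbc.1
      rw [frequently_atTop] at h1 ⊢
      intro N
      obtain ⟨t, ht, -, h2⟩ := h1 N
      exact ⟨t + 1, by omega, h2⟩
  refine ⟨fun t => (st t).1, rfl, hedge, Set.ext fun e => ⟨fun he => ?_, ?_⟩⟩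
  · obtain ⟨t, rfl⟩ := Frequently.exists he
    exact ⟨(st t).1.2, (st (t + 1)).1.2, hedge t⟩
  · rintro ⟨h1, h2, h3⟩
    refine (hall ⟨e.1, h1⟩ ((hfreq e.1 h1).mono fun t ht => Subtype.ext ht) e.2 h2 h3).mono ?_
    rintro t ⟨h4, h5⟩
    exact Prod.ext (congrArg Subtype.val h4) h5

/-- A finite graph has a strongly connected subgraph that no edge leaves. -/
theorem exists_bottom_component [Finite V] (r : V → V → Prop) {U : Set V} (hU : U.Nonempty) :
    ∃ C ⊆ U, C.Nonempty ∧ (∀ x ∈ C, ∀ y ∈ U, r x y → y ∈ C) ∧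
      ∀ x ∈ C, ∀ y ∈ C, Relation.ReflTransGen (fun a b => r a b ∧ b ∈ C) x y := by
  let reach : V → Set V := fun x => {y | Relation.ReflTransGen (fun a b => r a b ∧ b ∈ U) x y}
  have hreach : ∀ x ∈ U, reach x ⊆ U := by
    intro x hx y hy
    cases hy with
    | refl => exact hx
    | tail _ h => exact h.2
  -- A reachable set of least size is reachable from each of its own vertices.
  obtain ⟨x, hx, hmin⟩ := Set.exists_min_image U (fun x => (reach x).ncard) (Set.toFinite _) hU
  refine ⟨reach x, hreach x hx, ⟨x, Relation.ReflTransGen.refl⟩,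
    fun a ha b hb hab => Relation.ReflTransGen.tail ha ⟨hab, hb⟩, fun a ha b hb => ?_⟩
  have hsub : reach a ⊆ reach x := fun c hc => Relation.ReflTransGen.trans ha hc
  have heq : reach a = reach x :=
    Set.eq_of_subset_of_ncard_le hsub (hmin a (hreach x hx ha)) (Set.toFinite _)
  have hb' : b ∈ reach a := heq ▸ hb
  have key : ∀ c, Relation.ReflTransGen (fun a b => r a b ∧ b ∈ U) a c →
      Relation.ReflTransGen (fun a b => r a b ∧ b ∈ reach x) a c := by
    intro c hc
    induction hc with
    | refl => exact Relation.ReflTransGen.refl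
    | tail h1 h2 ih => exact ih.tail ⟨h2.1, hsub (h1.tail h2)⟩
  exact key b hb'

/-! ### Completeness -/

section Completeness
variable (𝒢 : GameGraph V) (ℛ : RabinCondition V k)

/-- At its fixpoint a pair has `X = Y`, where both parts of 𝒞 force a step back into `Y`. So only
vertices of `S` can lie outside this controllable predecessor. -/
theorem layers_subset (d : ℕ) (I : List (Fin (k + 1))) (S : Set V) :
    layers 𝒢 ℛ d I S ⊆ S ∪ (ℛ.safe I ∩ 𝒢.cpre (layers 𝒢 ℛ d I S)) := by
  induction d generalizing I S with
  | zero => exact Set.subset_union_left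
  | succ d ih =>
    intro v hv
    obtain ⟨p, hp, hvp⟩ := (mem_layers_succ 𝒢 ℛ).1 hv
    set Y := pairFix 𝒢 ℛ d I p S with hY
    have hle : Y ⊆ layers 𝒢 ℛ (d + 1) I S := fun w hw => (mem_layers_succ 𝒢 ℛ).2 ⟨p, hp, hw⟩
    have hfix : layers 𝒢 ℛ d (I ++ [p]) (pairStep 𝒢 ℛ I p S Y Y) = Y :=
      pairBody_pairFix 𝒢 ℛ d I p S
    have h1 := ih (I ++ [p]) (pairStep 𝒢 ℛ I p S Y Y)
    rw [hfix] at h1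
    rcases h1 hvp with (h2 | ⟨h2, h3⟩) | ⟨h2, h3⟩
    · exact Or.inl h2
    · rw [safe_append] at h2
      refine Or.inr ⟨h2.1, cpre_mono 𝒢 hle ?_⟩
      rcases h3 with h3 | h3
      · exact h3.2
      · exact apre_self_subset 𝒢 Y h3
    · rw [safe_append] at h2
      exact Or.inr ⟨h2.1, cpre_mono 𝒢 hle h3⟩

/-- The sets of edges that are taken infinitely often by the fair plays outside of the Rabin
condition. -/
def lossSets : Set (Set (V × V)) :=
  {F | (∀ v w, 𝒢.live v w → (∃ e ∈ F, e.1 = v) → (v, w) ∈ F) ∧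
    ∀ j, (∃ e ∈ F, e.1 ∈ ℛ.G j) → ∃ e ∈ F, e.1 ∈ ℛ.R j}

/-- Fairness and failure of the Rabin condition are both implications of Streett type: whatever
triggers one in a union triggers it in one of the parts. -/
theorem lossSets_union : ∀ A ∈ lossSets 𝒢 ℛ, ∀ B ∈ lossSets 𝒢 ℛ, A ∪ B ∈ lossSets 𝒢 ℛ := by
  rintro A ⟨hA, hA'⟩ B ⟨hB, hB'⟩
  refine ⟨?_, ?_⟩
  · rintro v w hl ⟨e, he | he, h⟩
    · exact Or.inl (hA v w hl ⟨e, he, h⟩)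
    · exact Or.inr (hB v w hl ⟨e, he, h⟩)
  · rintro j ⟨e, he | he, h⟩
    · obtain ⟨e', he', h'⟩ := hA' j ⟨e, he, h⟩
      exact ⟨e', Or.inl he', h'⟩
    · obtain ⟨e', he', h'⟩ := hB' j ⟨e, he, h⟩
      exact ⟨e', Or.inr he', h'⟩

theorem exists_mem_infEdges [Finite V] {π : ℕ → V} {A : Set V} (h : ∃ᶠ t in atTop, π t ∈ A) :
    ∃ e ∈ infEdges π, e.1 ∈ A := by
  obtain ⟨e, he, hf⟩ := exists_frequently_eq (f := fun t => (π t, π (t + 1)))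
    (P := fun e => e.1 ∈ A) h
  exact ⟨e, hf, he⟩

theorem not_mem_fairAdversarial [Finite V] {π : ℕ → V} (h : infEdges π ∈ lossSets 𝒢 ℛ) :
    π ∉ 𝒢.fairAdversarial ℛ.plays := by
  intro hπ
  obtain ⟨hl, hs⟩ := h
  obtain ⟨j, hR, hG⟩ := hπ fun v w hvw hf => by
    obtain ⟨e, he, hev⟩ := exists_mem_infEdges (A := {v}) hf
    exact (hl v w hvw ⟨e, he, hev⟩ : ∃ᶠ t in atTop, (π t, π (t + 1)) = (v, w)).mono
      fun t ht => ⟨congrArg Prod.fst ht, congrArg Prod.snd ht⟩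
  obtain ⟨e, he, heR⟩ := hs j (exists_mem_infEdges hG)
  obtain ⟨t, ht, ht'⟩ := (Frequently.and_eventually he hR).exists
  exact ht' (by rw [← ht] at heR; exact heR)

/-- The edges that remain when Player 0 plays the positional strategy `σ`. -/
def GameGraph.restrict (σ : V → V) (v w : V) : Prop := 𝒢.E v w ∧ (v ∈ 𝒢.V₀ → w = σ v)

/-! ### Components of the graph left by a positional strategy -/

variable {𝒢} {σ : V → V}

theorem mem_cpre_of_restrict (hσ : ∀ v ∈ 𝒢.V₀, 𝒢.E v (σ v)) {A : Set V} {v : V}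
    (h : ∀ w, 𝒢.restrict σ v w → w ∈ A) : v ∈ 𝒢.cpre A := by
  by_cases hv : v ∈ 𝒢.V₀
  · exact Or.inl ⟨hv, σ v, hσ v hv, h _ ⟨hσ v hv, fun _ => rfl⟩⟩
  · exact Or.inr ⟨hv, fun w hw => h w ⟨hw, fun h => absurd h hv⟩⟩

theorem restrict_of_live {v w : V} (h : 𝒢.live v w) : 𝒢.restrict σ v w :=
  ⟨𝒢.live_edge _ _ h, fun hv => absurd hv (𝒢.live_owner _ _ h)⟩

variable (𝒢 σ)

/-- The strongly connected sets `C` that contain the live edges of their vertices, that can be left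
for `S` only, and that fit to the indices in `I`. -/
structure IsComponent (W : Set V) (I : List (Fin (k + 1))) (S C : Set V) : Prop where
  subset : C ⊆ W
  exits : ∀ x ∈ C, ∀ y, 𝒢.restrict σ x y → y ∈ C ∪ S
  live : ∀ x ∈ C, ∀ y, 𝒢.live x y → y ∈ C
  safe : C ⊆ ℛ.safe I
  goal : ∀ q ∈ I, ∀ x ∈ C, x ∉ ℛ.goal q
  nonempty : C.Nonempty
  succ : ∀ x ∈ C, ∃ y ∈ C, 𝒢.restrict σ x y
  conn : ∀ x ∈ C, ∀ y ∈ C, Relation.ReflTransGen (fun a b => 𝒢.restrict σ a b ∧ b ∈ C) x y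

variable {𝒢 σ} {W : Set V}

/-- `C ∪ S` is a post-fixpoint: a bottom component of the vertices of `C` missed by `μX` would
satisfy `IsComponent` with `p` bound, and by `hmeet` would then meet `X`. -/
theorem subset_pairFix [Finite V] (hσ : ∀ v ∈ 𝒢.V₀, 𝒢.E v (σ v))
    {d : ℕ} {I : List (Fin (k + 1))} {p : Fin (k + 1)} {S C : Set V}
    (hd : (remaining (I ++ [p])).length = d)
    (hmeet : ∀ S C, IsComponent 𝒢 ℛ σ W (I ++ [p]) S C →
      (C ∩ layers 𝒢 ℛ d (I ++ [p]) S).Nonempty)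
    (hW : C ⊆ W) (hexits : ∀ x ∈ C, ∀ y, 𝒢.restrict σ x y → y ∈ C ∪ S)
    (hsafe : C ⊆ ℛ.safe (I ++ [p]))
    (hgoal : ∀ q ∈ I, ∀ x ∈ C, x ∉ ℛ.goal q) : C ⊆ pairFix 𝒢 ℛ d I p S := by
  refine Set.subset_union_left.trans (subset_nu (Y := C ∪ S) ?_)
  set Y := C ∪ S with hY
  set X := mu fun X => pairBody 𝒢 ℛ d I p S Y X with hX
  have hfix : layers 𝒢 ℛ d (I ++ [p]) (pairStep 𝒢 ℛ I p S Y X) = X :=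
    mu_fixed (pairBody_monotone 𝒢 ℛ d I p S Y)
  set S' := pairStep 𝒢 ℛ I p S Y X with hS'
  have hS'X : S' ⊆ X := by
    conv_rhs => rw [← hfix]
    exact subset_layers 𝒢 ℛ d _ hd S'
  have hapre : ∀ x ∈ ℛ.safe (I ++ [p]), x ∈ 𝒢.apre Y X → x ∈ S' :=
    fun x h1 h2 => Or.inr ⟨h1, Or.inr h2⟩
  -- Vertices added by the inner layers lie in `Cpre X` and are safe, so they already belong to 𝒞_p
  -- through `Apre`.
  have hXS' : X ⊆ S' := by
    have h := layers_subset 𝒢 ℛ d (I ++ [p]) S'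
    rw [hfix] at h
    intro x hx
    rcases h hx with h | ⟨h1, h2⟩
    · exact h
    · exact hapre x h1 (Or.inl h2)
  have hSX : S ⊆ X := Set.subset_union_left.trans hS'X
  refine Set.union_subset ?_ hSX
  by_contra hne
  obtain ⟨x₀, hx₀⟩ := Set.sdiff_nonempty.2 hne
  obtain ⟨C', hC', hne', hclosed, hconn⟩ :=
    exists_bottom_component (𝒢.restrict σ) (U := C \ X) ⟨x₀, hx₀⟩
  have hnotS' : ∀ x ∈ C', x ∉ S' := fun x hx h => (hC' hx).2 (hS'X h)
  have hexits' : ∀ x ∈ C', ∀ y, 𝒢.restrict σ x y → y ∉ X → y ∈ C' := by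
    intro x hx y hxy hyX
    refine hclosed x hx y ⟨?_, hyX⟩ hxy
    exact (hexits x (hC' hx).1 y hxy).resolve_right fun h => hyX (hSX h)
  -- Each property holds because its failure would put the vertex into 𝒞_p: a live edge into `X`, a
  -- goal of `p`, or no successor inside.
  have hcomp : IsComponent 𝒢 ℛ σ W (I ++ [p]) S' C' := by
    refine ⟨fun x hx => hW (hC' hx).1, ?_, ?_, fun x hx => hsafe (hC' hx).1, ?_, hne', ?_, hconn⟩
    · intro x hx y hxy
      by_cases hyX : y ∈ X
      · exact Or.inr (hXS' hyX)
      · exact Or.inl (hexits' x hx y hxy hyX)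
    · intro x hx y hxy
      refine hexits' x hx y (restrict_of_live hxy) fun hyX => hnotS' x hx ?_
      have hx₁ : x ∉ 𝒢.V₀ := 𝒢.live_owner _ _ hxy
      refine hapre x (hsafe (hC' hx).1) (Or.inr ⟨⟨y, hxy, hyX⟩, hx₁, fun w hw => ?_⟩)
      exact hexits x (hC' hx).1 w ⟨hw, fun h => absurd h hx₁⟩
    · intro q hq x hx hxq
      rcases List.mem_append.1 hq with hq | hq
      · exact hgoal q hq x (hC' hx).1 hxq
      · rw [List.mem_singleton.1 hq] at hxq
        exact hnotS' x hx (Or.inr ⟨hsafe (hC' hx).1, Or.inl ⟨hxq,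
          mem_cpre_of_restrict hσ (hexits x (hC' hx).1)⟩⟩)
    · intro x hx
      by_contra hno
      push Not at hno
      refine hnotS' x hx (hapre x (hsafe (hC' hx).1) (Or.inl (mem_cpre_of_restrict hσ ?_)))
      intro w hw
      by_contra hwX
      exact hno w (hexits' x hx w hw hwX) hw
  obtain ⟨x, hx, hxX⟩ := hmeet S' C' hcomp
  rw [hfix] at hxX
  exact (hC' hx).2 hxX

/-- The play through all edges of `C` is fair and not lost, so some pair has its goal met in `C` and
its R avoided. Its index is unbound, since `C` contains no goals of bound ones, and is bound next.
-/
theorem component_meets_layers [Finite V] (hσ : ∀ v ∈ 𝒢.V₀, 𝒢.E v (σ v))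
    (hW : ∀ π : ℕ → V, π 0 ∈ W → (∀ t, 𝒢.restrict σ (π t) (π (t + 1))) →
      infEdges π ∉ lossSets 𝒢 ℛ)
    (d : ℕ) (I : List (Fin (k + 1))) (hd : (remaining I).length = d) (S C : Set V)
    (hC : IsComponent 𝒢 ℛ σ W I S C) : (C ∩ layers 𝒢 ℛ d I S).Nonempty := by
  induction d generalizing I S C with
  | zero => ?_
  | succ d ih => ?_
  all_goals
    obtain ⟨c, hc⟩ := hC.nonempty
    obtain ⟨π, hπ0, hπ, hinf⟩ := exists_play_infEdges hC.succ hC.conn hc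
    have hloss := hW π (hπ0 ▸ hC.subset hc) hπ
    rw [hinf] at hloss
    obtain ⟨j, ⟨x, hx, hxG⟩, hR⟩ : ∃ j, (∃ x ∈ C, x ∈ ℛ.G j) ∧ ∀ x ∈ C, x ∉ ℛ.R j := by
      by_contra hno
      push Not at hno
      refine hloss ⟨?_, ?_⟩
      · rintro v w hvw ⟨e, he, rfl⟩
        exact ⟨he.1, hC.live _ he.1 w hvw, restrict_of_live hvw⟩
      · rintro j ⟨e, he, heG⟩
        obtain ⟨x, hx, hxR⟩ := hno j ⟨e.1, he.1, heG⟩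
        obtain ⟨y, hy, hxy⟩ := hC.succ x hx
        exact ⟨(x, y), ⟨hx, hy, hxy⟩, hxR⟩
    have hj : j.succ ∉ I := fun h => hC.goal _ h x hx hxG
  -- With no layer left, no unbound index exists.
  · have := List.length_pos_of_mem (mem_remaining.2 hj)
    omega
  · have hd' := length_remaining_append hj
    refine ⟨c, hc, (mem_layers_succ 𝒢 ℛ).2 ⟨j.succ, hj, ?_⟩⟩
    refine subset_pairFix ℛ hσ (by omega) (fun S C => ih _ (by omega) S C) hC.subset hC.exits
      ?_ hC.goal hc
    rw [safe_append]
    exact fun x hx => ⟨hC.safe hx, hR x hx⟩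

/-- The set `W` where `σ` wins is closed under the remaining edges, so it meets the requirements for
the artificial pair with `S = ∅`. -/
theorem PositionalWins.mem_rabinFixpoint [Finite V] {v : V}
    (h : PositionalWins 𝒢.V₀ (lossSets 𝒢 ℛ) 𝒢.E v) : v ∈ rabinFixpoint 𝒢 ℛ := by
  obtain ⟨σ, hσ, hwin⟩ := h
  let W : Set V := {x | ∀ π : ℕ → V, π 0 = x → (∀ t, 𝒢.restrict σ (π t) (π (t + 1))) →
    infEdges π ∉ lossSets 𝒢 ℛ}
  have hv : v ∈ W := fun π h0 hπ => hwin π h0 (fun t => (hπ t).1) fun t => (hπ t).2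
  have hclosed : ∀ x ∈ W, ∀ y, 𝒢.restrict σ x y → y ∈ W := by
    intro x hx y hxy π h0 hπ
    have := hx (fun t => t.casesOn x π) rfl ?_
    · rwa [← infEdges_shift _ 1] at this
    · rintro (_ | t)
      · change 𝒢.restrict σ x (π 0)
        rw [h0]; exact hxy
      · exact hπ t
  rw [rabinFixpoint_eq]
  have hlen : (remaining ([] ++ [(0 : Fin (k + 1))])).length = k := by
    have := length_remaining (I := [(0 : Fin (k + 1))]) (by simp)
    simpa using this
  refine subset_pairFix (W := W) ℛ hσ hlen
    (component_meets_layers ℛ hσ (fun (π : ℕ → V) (h0 : π 0 ∈ W) => h0 π rfl) k _ hlen) subset_rfl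
    (fun x hx y hxy => Or.inl (hclosed x hx y hxy)) ?_ (by simp) hv
  intro x _ q hq
  rw [List.mem_singleton.1 hq]
  exact Set.notMem_empty x

variable (𝒢)

/-- Every play obeys some strategy of Player 1. -/
theorem exists_strategy_obeys (hE : ∀ v, ∃ w, 𝒢.E v w) {π : ℕ → V}
    (hπ : ∀ t, 𝒢.E (π t) (π (t + 1))) : ∃ ρ₁ : Strategy 𝒢 𝒢.V₁, ρ₁.Obeys π := by
  classical
  choose f hf using hE
  refine ⟨⟨fun w v => if (v : V) = π w.length then π (w.length + 1) else f v, fun w v => ?_⟩,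
    fun t h => by simp⟩
  split_ifs with h
  · rw [h]; exact hπ _
  · exact hf v

/-- The opponent's memory strategy is run against `ρ₀`; the history is carried along in the state,
as `ρ₀` may depend on it. -/
theorem OpponentWins.not_winsFrom [Finite V] (hE : ∀ v, ∃ w, 𝒢.E v w) {v : V}
    (h : OpponentWins 𝒢.V₀ (lossSets 𝒢 ℛ) 𝒢.E v) (ρ₀ : Strategy 𝒢 𝒢.V₀) :
    ¬ 𝒢.WinsFrom ρ₀ (𝒢.fairAdversarial ℛ.plays) v := by
  classical
  obtain ⟨M, m₀, upd, act, hlegal, hwin⟩ := h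
  let next : List V × V × M → V := fun s =>
    if hs : s.2.1 ∈ 𝒢.V₀ then ρ₀.move s.1 ⟨s.2.1, hs⟩ else act s.2.2 s.2.1
  let st : ℕ → List V × V × M := fun t =>
    (fun s => (s.1 ++ [s.2.1], next s, upd s.2.2 s.2.1 (next s)))^[t] ([], v, m₀)
  have hst : ∀ t, st (t + 1) = ((st t).1 ++ [(st t).2.1], next (st t),
      upd (st t).2.2 (st t).2.1 (next (st t))) :=
    fun t => by simp only [st, Function.iterate_succ_apply']
  set π : ℕ → V := fun t => (st t).2.1 with hπ
  have hhist : ∀ t, (st t).1 = (List.range t).map π := by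
    intro t
    induction t with
    | zero => rfl
    | succ t ih => rw [hst, List.range_succ, List.map_append, ← ih]; rfl
  have hπs : ∀ t, π (t + 1) = next (st t) := fun t => by simp only [hπ, hst]
  have hobeys : ρ₀.Obeys π := by
    intro t ht
    rw [hπs, ← hhist]
    exact dif_pos ht
  have hact : ∀ t, π t ∉ 𝒢.V₀ → π (t + 1) = act (st t).2.2 (π t) := by
    intro t ht
    rw [hπs]
    exact dif_neg ht
  have hedge : ∀ t, 𝒢.E (π t) (π (t + 1)) := by
    intro t
    by_cases ht : π t ∈ 𝒢.V₀
    · rw [hobeys t ht]; exact ρ₀.legal _ ⟨π t, ht⟩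
    · rw [hact t ht]; exact hlegal _ _ ht
  obtain ⟨ρ₁, hρ₁⟩ := exists_strategy_obeys 𝒢 hE hedge
  intro hw
  refine not_mem_fairAdversarial 𝒢 ℛ (hwin π (fun t => (st t).2.2) rfl rfl (fun t => ?_)
    (fun t _ => hedge t) hact) (hw ρ₁ π rfl hobeys hρ₁)
  rw [hst, hπs]

theorem rabinFixpoint_eq_winningRegion [Fintype V] (hE : ∀ v, ∃ w, 𝒢.E v w) :
    rabinFixpoint 𝒢 ℛ = 𝒢.winningRegion (𝒢.fairAdversarial ℛ.plays) := by
  refine Set.Subset.antisymm (fun v hv => ?_) ?_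
  · obtain ⟨ρ₀, -, hρ₀⟩ := exists_memoryless_minRank 𝒢 ℛ hE
    exact ⟨ρ₀, winsFrom_of_minRank 𝒢 ℛ hρ₀ hv⟩
  · rintro v ⟨ρ₀, hρ₀⟩
    rcases positionalWins_or_opponentWins (V₀ := 𝒢.V₀) (lossSets_union 𝒢 ℛ) hE v with h | h
    · exact h.mem_rabinFixpoint ℛ
    · exact absurd hρ₀ (h.not_winsFrom 𝒢 ℛ hE ρ₀)

end Completeness

end FairRabin

theorem mainTheorem1 :
    ∃ C : ℕ, ∀ (V : Type u) [Fintype V] [Nonempty V] (k : ℕ)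
      (𝒢 : FairRabin.GameGraph V) (ℛ : FairRabin.RabinCondition V k),
      (∀ v, ∃ w, 𝒢.E v w) →
      -- the fixpoint is the winning region of Player 0 in the fair adversarial Rabin game
      FairRabin.rabinFixpoint 𝒢 ℛ = 𝒢.winningRegion (𝒢.fairAdversarial ℛ.plays) ∧
      -- the fixpoint algorithm computes it, together with all sets that define the ranking,
      (FairRabin.fixpointAlgorithm 𝒢 ℛ).1 = FairRabin.rabinFixpoint 𝒢 ℛ ∧
      (∀ (δ : FairRabin.Prefix k) (p : Fin (k + 1)) (i : ℕ),
        FairRabin.Prefix.Valid (Fintype.card V) (δ ++ [(p, i)]) →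
        (FairRabin.fixpointAlgorithm 𝒢 ℛ).2.node (δ ++ [(p, i)]) =
          some (FairRabin.prefixSet 𝒢 ℛ (δ ++ [(p, i)]),
            FairRabin.iterX 𝒢 ℛ (FairRabin.context 𝒢 ℛ δ) p i)) ∧
      -- in `O(n ^ (k + 2) * k!)` symbolic steps
      (FairRabin.fixpointAlgorithm 𝒢 ℛ).2.steps ≤
        C * (Fintype.card V ^ (k + 2) * k.factorial) ∧
      -- there are memoryless strategies that always move to a successor of minimal rank, and each
      -- of them wins from every vertex of the winning region
      (∃ ρ₀ : FairRabin.Strategy 𝒢 𝒢.V₀, ρ₀.Memoryless ∧ FairRabin.MinRank 𝒢 ℛ ρ₀) ∧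
      (∀ ρ₀ : FairRabin.Strategy 𝒢 𝒢.V₀, ρ₀.Memoryless → FairRabin.MinRank 𝒢 ℛ ρ₀ →
        ∀ v ∈ 𝒢.winningRegion (𝒢.fairAdversarial ℛ.plays),
          𝒢.WinsFrom ρ₀ (𝒢.fairAdversarial ℛ.plays) v) := by
  refine ⟨129, fun V _ _ k 𝒢 ℛ hE => ?_⟩
  have hW := FairRabin.rabinFixpoint_eq_winningRegion 𝒢 ℛ hE
  refine ⟨hW, FairRabin.fixpointAlgorithm_val 𝒢 ℛ, FairRabin.fixpointAlgorithm_node 𝒢 ℛ,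
    FairRabin.fixpointAlgorithm_steps 𝒢 ℛ, FairRabin.exists_memoryless_minRank 𝒢 ℛ hE,
    fun ρ₀ _ hρ₀ v hv => FairRabin.winsFrom_of_minRank 𝒢 ℛ hρ₀ ?_⟩
  rw [hW]
  exact hv
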